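/- Let $d\ge 1$, let $D\subset\mathbb R^d$ be open, and let $K$ be a positive definite kernel on $D$ of the form $K(x,y)=\log\frac1{|x-y|}+L(x,y)$ for $x\neq y$ in $D$, with $L$ continuous on $D\times D$; positive definite means $\int_{D^2}K(x,y)\varphi(x)\varphi(y)\,dx\,dy\ge 0$ for every $\varphi\in C_c(D)$, where $C_c(D)$ denotes the continuous functions with compact support in $D$. Let $X=(\langle X,\varphi\rangle)$ and $Y=(\langle Y,\varphi\rangle)$, indexed by the real functions $\varphi\in C_c(D)$, be two independent centred Gaussian fields on a common probability space, both with covariance $\mathbb E[\langle X,\varphi\rangle\langle X,\psi\rangle]=\mathbb E[\langle Y,\varphi\rangle\langle Y,\psi\rangle]=\int_{D^2}K(x,y)\varphi(x)\psi(y)\,dx\,dy$. A smoothing kernel is a non-negative $C^\infty$ function $\theta$ on $\mathbb R^d$ with support in the closed Euclidean unit ball and $\int\theta=1$. For $\varepsilon\in(0,1]$ put $\theta_\varepsilon(x)=\varepsilon^{-d}\theta(x/\varepsilon)$ and $D_\varepsilon=\{x\in D:\operatorname{dist}(x,\mathbb R^d\setminus D)>2\varepsilon\}$ (with $D_\varepsilon=\mathbb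 R^d$ if $D=\mathbb R^d$). For $x\in D_\varepsilon$ put $X_\varepsilon(x)=\langle X,\theta_\varepsilon(x-\cdot)\rangle$, $Y_\varepsilon(x)=\langle Y,\theta_\varepsilon(x-\cdot)\rangle$ and $K_\varepsilon(x)=\mathbb E[X_\varepsilon(x)^2]=\iint\theta_\varepsilon(x-z_1)\theta_\varepsilon(x-z_2)K(z_1,z_2)\,dz_1\,dz_2$, where $X_\varepsilon(x)$ and $Y_\varepsilon(x)$ are always taken in versions that are jointly continuous in $(\varepsilon,x)$, $\varepsilon\in(0,1]$, $x\in D_\varepsilon$. Let $\varrho$ be a bounded measurable real function on $D$, let $f:D\to\mathbb C$ be continuous with compact support in $D$, and for $\alpha,\beta\in\mathbb R$ set $$M_\varepsilon^{(\alpha,\beta)}(f)=\int_{D_\varepsilon}\exp\Big(\alpha X_\varepsilon(x)+i\beta Y_\varepsilon(x)+\tfrac{\beta^2-\alpha^2}{2}K_\varepsilon(x)\Big)f(x)\,\varrho(x)\,dx .$$ Suppose that $(\alpha,\beta)$ belongs to $$\mathcal P_{\mathrm{sub}}=\{\alpha^2+\beta^2<d\}\cup\{|\alpha|\in(\sqrt{d/2},\sqrt{2d})\text{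 and }|\beta|<\sqrt{2d}-|\alpha|\}.$$ Then there is an integrable complex random variable $M_0^{(\alpha,\beta)}(f)$ such that, for every smoothing kernel $\theta$, $M_\varepsilon^{(\alpha,\beta)}(f)$ is integrable for all sufficiently small $\varepsilon$ and $$\lim_{\varepsilon\to0}M_\varepsilon^{(\alpha,\beta)}(f)=M_0^{(\alpha,\beta)}(f)\quad\text{in probability and in }L^1 .$$ In particular the limit does not depend on the choice of $\theta$. -/

import Mathlib

open MeasureTheory ProbabilityTheory Filter Topology Set

noncomputable section

namespace ComplexGMC

/-- Euclidean space of dimension `d`. -/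
abbrev Euc (d : ℕ) : Type := EuclideanSpace ℝ (Fin d)

/-- `f` is a continuous function whose support is a compact subset of `D`. Such functions
are defined on the whole space and vanish outside `D`. -/
structure IsTestFun {d : ℕ} {F : Type*} [NormedAddCommGroup F] (D : Set (Euc d))
    (f : Euc d → F) : Prop where
  continuous : Continuous f
  hasCompactSupport : HasCompactSupport f
  tsupport_subset : tsupport f ⊆ D

/-- The space of real continuous functions with compact support in `D`. -/
abbrev TestFun {d : ℕ} (D : Set (Euc d)) : Type := {φ : Euc d → ℝ // IsTestFun D φ}

/-- The bilinear form `∬ K(x, y) φ(x) ψ(y) dx dy`. It is only used for functions `φ`, `ψ`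
that vanish outside `D`, so that only the values of `K` on `D × D` matter. -/
def kernelForm {d : ℕ} (K : Euc d → Euc d → ℝ) (φ ψ : Euc d → ℝ) : ℝ :=
  ∫ z : Euc d × Euc d, K z.1 z.2 * φ z.1 * ψ z.2

/-- `K` is a positive definite kernel on `D` of the form `log (1 / |x - y|) + L(x, y)`, where
`L` is continuous. (The values of `K` on the diagonal, a null set, are irrelevant.) -/
structure IsLogKernel {d : ℕ} (D : Set (Euc d)) (K : Euc d → Euc d → ℝ) : Prop where
  exists_continuous : ∃ L : Euc d × Euc d → ℝ, ContinuousOn L (D ×ˢ D) ∧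
    ∀ x ∈ D, ∀ y ∈ D, x ≠ y → K x y = Real.log (1 / dist x y) + L (x, y)
  posDef : ∀ φ : TestFun D, 0 ≤ kernelForm K φ.1 φ.1

/-- `X = (⟨X, φ⟩)_φ` is a centred Gaussian field on `D` with covariance kernel `K`. -/
structure IsGaussianField {d : ℕ} {Ω : Type*} [MeasurableSpace Ω] (P : Measure Ω)
    (D : Set (Euc d)) (K : Euc d → Euc d → ℝ) (X : TestFun D → Ω → ℝ) : Prop where
  measurable : ∀ φ, Measurable (X φ)
  gaussian : IsGaussianProcess X P
  centred : ∀ φ, ∫ ω, X φ ω ∂P = 0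
  covariance : ∀ φ ψ, ∫ ω, X φ ω * X ψ ω ∂P = kernelForm K φ.1 ψ.1

/-- A smoothing kernel: a non-negative smooth function supported in the unit ball, with
integral one. -/
structure Mollifier (d : ℕ) where
  toFun : Euc d → ℝ
  smooth : ContDiff ℝ ((⊤ : ℕ∞) : WithTop ℕ∞) toFun
  nonneg : ∀ x, 0 ≤ toFun x
  tsupport_subset : tsupport toFun ⊆ Metric.closedBall 0 1
  integral_eq_one : ∫ x, toFun x = 1

/-- The rescaled smoothing kernel `θ_ε(x) = ε^{-d} θ(x / ε)`. -/
def Mollifier.scaled {d : ℕ} (θ : Mollifier d) (ε : ℝ) (x : Euc d) : ℝ :=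
  (ε ^ d)⁻¹ * θ.toFun (ε⁻¹ • x)

/-- `D_ε`, the set of points of `D` at distance larger than `2ε` from the complement of `D`
(the whole space if `D` is the whole space: the distance to the empty set is infinite). -/
def innerDomain {d : ℕ} (D : Set (Euc d)) (ε : ℝ) : Set (Euc d) :=
  {x | x ∈ D ∧ ENNReal.ofReal (2 * ε) < Metric.infEDist x Dᶜ}

/-- The set of pairs `(ε, x)` with `ε ∈ (0, 1]` and `x ∈ D_ε`. -/
def mollDomain {d : ℕ} (D : Set (Euc d)) : Set (ℝ × Euc d) :=
  {p | p.1 ∈ Ioc (0 : ℝ) 1 ∧ p.2 ∈ innerDomain D p.1}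

theorem Mollifier.isTestFun {d : ℕ} (θ : Mollifier d) {D : Set (Euc d)} {ε : ℝ} {x : Euc d}
    (h : (ε, x) ∈ mollDomain D) : IsTestFun D (fun y => θ.scaled ε (x - y)) := by
  obtain ⟨⟨hε, -⟩, hx⟩ := h
  simp only at hε hx
  have hcont : Continuous (fun y => θ.scaled ε (x - y)) := by
    have := θ.smooth.continuous
    unfold Mollifier.scaled
    fun_prop
  have hsub : tsupport (fun y => θ.scaled ε (x - y)) ⊆ Metric.closedBall x ε := by
    refine closure_minimal ?_ Metric.isClosed_closedBall
    intro y hy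
    have h1 : θ.toFun (ε⁻¹ • (x - y)) ≠ 0 := by
      intro h0
      exact hy (by simp [Mollifier.scaled, h0])
    have h2 := θ.tsupport_subset (subset_tsupport _ h1)
    rw [mem_closedBall_zero_iff, norm_smul, norm_inv, Real.norm_of_nonneg hε.le,
      inv_mul_le_iff₀ hε, mul_one] at h2
    rwa [Metric.mem_closedBall, dist_comm, dist_eq_norm]
  refine ⟨hcont, HasCompactSupport.of_support_subset_isCompact (isCompact_closedBall x ε)
    ((subset_tsupport _).trans hsub), fun y hy => ?_⟩
  by_contra hyD
  have h3 : Metric.infEDist x Dᶜ ≤ edist x y := Metric.infEDist_le_edist_of_mem hyD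
  have h4 : dist x y ≤ ε := by
    have := hsub hy
    rwa [Metric.mem_closedBall, dist_comm] at this
  have h5 : edist x y ≤ ENNReal.ofReal (2 * ε) := by
    rw [edist_dist]
    exact ENNReal.ofReal_le_ofReal (by linarith)
  exact absurd (hx.2.trans_le (h3.trans h5)) (lt_irrefl _)

/-- The test function `y ↦ θ_ε(x - y)`, for `(ε, x)` in `mollDomain D`. -/
def Mollifier.testFun {d : ℕ} (θ : Mollifier d) {D : Set (Euc d)} (ε : ℝ) (x : Euc d)
    (h : (ε, x) ∈ mollDomain D) : TestFun D :=
  ⟨fun y => θ.scaled ε (x - y), θ.isTestFun h⟩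

/-- `Xc` is a continuous version of the mollified field: for every `(ε, x)`, almost surely
`Xc ε x = ∫ X(y) θ_ε(x - y) dy`, and almost surely `Xc ε x` is jointly continuous in `(ε, x)`. -/
structure IsMollifiedField {d : ℕ} {Ω : Type*} [MeasurableSpace Ω] (P : Measure Ω)
    {D : Set (Euc d)} (X : TestFun D → Ω → ℝ) (θ : Mollifier d)
    (Xc : ℝ → Euc d → Ω → ℝ) : Prop where
  version : ∀ (ε : ℝ) (x : Euc d) (h : (ε, x) ∈ mollDomain D),
    Xc ε x =ᵐ[P] X (θ.testFun ε x h)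
  continuous : ∀ᵐ ω ∂P, ContinuousOn (fun p : ℝ × Euc d => Xc p.1 p.2 ω) (mollDomain D)

/-- `K_ε(x) = ∬ θ_ε(x - z₁) θ_ε(x - z₂) K(z₁, z₂) dz₁ dz₂`, the variance of `X_ε(x)`. -/
def mollVariance {d : ℕ} (K : Euc d → Euc d → ℝ) (θ : Mollifier d) (ε : ℝ) (x : Euc d) : ℝ :=
  kernelForm K (fun y => θ.scaled ε (x - y)) (fun y => θ.scaled ε (x - y))

/-- The mollified chaos `M_ε^{(α, β)}(f)`, with reference measure `ϱ(x) dx`: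
the integral over `D_ε` of `exp (α X_ε + i β Y_ε + (β² - α²) K_ε / 2) f ϱ`. -/
def mollChaos {d : ℕ} {Ω : Type*} (D : Set (Euc d)) (K : Euc d → Euc d → ℝ)
    (θ : Mollifier d) (Xc Yc : ℝ → Euc d → Ω → ℝ) (ϱ : Euc d → ℝ) (f : Euc d → ℂ)
    (α β ε : ℝ) (ω : Ω) : ℂ :=
  ∫ x in innerDomain D ε,
    Complex.exp ((α : ℂ) * (Xc ε x ω : ℂ) + Complex.I * (β : ℂ) * (Yc ε x ω : ℂ)
      + ((β : ℂ) ^ 2 - (α : ℂ) ^ 2) / 2 * (mollVariance K θ ε x : ℂ)) * f x * (ϱ x : ℂ)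

/-- The subcritical set of parameters `(α, β)` in dimension `d`. -/
def subcritical (d : ℕ) : Set (ℝ × ℝ) :=
  {p | p.1 ^ 2 + p.2 ^ 2 < d} ∪
    {p | |p.1| ∈ Ioo (√((d : ℝ) / 2)) (√(2 * (d : ℝ))) ∧ |p.2| < √(2 * (d : ℝ)) - |p.1|}

end ComplexGMC

end

/-!
The chaos is treated by a truncated second moment method. By independence and the Cameron–Martin
formula, the correlation of the Wick exponentials at two points `x ≠ y` is
`exp ((α² + β²) Cov (X_ε(x), X_ε(y)))`, of order `|x - y|^(-(α² + β²))`: the characteristic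
function of `Y_ε(x) - Y_ε(y)` contributes `β²`, and the real exponentials contribute `α²`. It is
integrable in the disc `α² + β² < d` only. In the rest of the subcritical phase the second moment is
dominated by rare configurations in which `X` is exceptionally high, and these are removed by a
barrier: only the points `x` are kept for which the average of `X` at scale `e⁻ᵏ` near `x` is
at most `lam k + q` for all large `k`, where `lam > √(2d)`.

*Truncated correlations.* With the indicator of an event of the field `X` inserted
(`integral_wick_mul_conj`), the Cameron–Martin shift moves `X` at scale `e⁻ᵏ ≈ |x - y|` by about
`2αk`, so that the barrier event has probability at most
`exp (-(2σα - σ lam - σ² / 2) k + σ q)` for every `σ ≥ 0`. For a suitable `σ < √(2d)` the total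
exponent of `1 / |x - y|` is less than `d` in the subcritical phase
(`exists_isAdmissible`, `CovData.exists_truncated_le`). This dominates the truncated correlations
uniformly in `ε`, and off the diagonal they converge to a limit independent of the smoothing kernel
(`CovData.exists_tendsto_truncated`): almost surely, the infinitely many constraints of the barrier
are decided by finitely many of them (`IsCentredGaussian.ae_eventually_barrier_iff`). By dominated
convergence the truncated chaos is Cauchy in `L²` as `ε → 0`, also when two different smoothing
kernels are compared (`ChaosSetup.tendsto_lintegral_truncChaos_sub_sq`).

*Removing the barrier.* By a union bound over grids of mesh `e⁻ᵏ`, the field `X` exceeds the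
barrier with offset `q` somewhere with probability `O(e^{-√(2d) q})`, while the second moment of
the truncated chaos is only `O(e^{σ q})`. As `σ < √(2d)`, the variation of the truncated chaos
between the offsets `q` and `q + 1` is exponentially small in `L¹`, uniformly in `ε`
(`ChaosSetup.exists_lintegral_chaos_sub_le`), so the chaos itself is Cauchy in `L¹`.

The probabilistic part only uses logarithmic bounds on the covariances of the mollified field and
their convergence (`CovData`); these follow from the form of `K` in `exists_kernelForm_bounds`,
`kernelForm_near_of_ne` and `kernelForm_near_potential`. The sign of `α` is immaterial, since `-X`
is a field with the same law.
-/

noncomputable section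

namespace ComplexGMC

/-! ### Integrability of logarithmic and power singularities -/

theorem integrableOn_norm_rpow_neg {d : ℕ} (hd : 0 < d) {γ : ℝ} (hγ : γ < d) (R : ℝ) :
    IntegrableOn (fun x : Euc d => ‖x‖ ^ (-γ)) (Metric.ball 0 R) := by
  have : Nonempty (Fin d) := ⟨⟨0, hd⟩⟩
  rw [MeasureTheory.integrableOn_fun_norm_addHaar volume (f := fun t : ℝ => t ^ (-γ))]
  have h1 : IntegrableOn (fun y : ℝ => y ^ ((d : ℝ) - 1 - γ)) (Ioo 0 R) := by
    rcases le_or_gt R 0 with hR | hR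
    · simp [Ioo_eq_empty (not_lt.2 hR)]
    · rw [intervalIntegral.integrableOn_Ioo_rpow_iff hR]
      linarith
  refine h1.congr_fun (fun y hy => ?_) measurableSet_Ioo
  have hy0 : (0 : ℝ) < y := hy.1
  simp only [finrank_euclideanSpace, Fintype.card_fin, smul_eq_mul]
  rw [← Real.rpow_natCast, ← Real.rpow_add hy0, Nat.cast_sub hd]
  congr 1
  push_cast
  ring

theorem integrableOn_log_norm {d : ℕ} (hd : 0 < d) (R : ℝ) :
    IntegrableOn (fun x : Euc d => Real.log ‖x‖) (Metric.ball 0 R) := by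
  have hγ : (1 / 2 : ℝ) < d := by
    have : (1 : ℝ) ≤ d := by exact_mod_cast hd
    linarith
  have h := (integrableOn_norm_rpow_neg hd hγ R).const_mul 2
  have hc : IntegrableOn (fun _ : Euc d => |Real.log (|R| + 1)|) (Metric.ball 0 R) :=
    integrableOn_const measure_ball_lt_top.ne
  refine Integrable.mono' (h.add hc)
    (Real.measurable_log.comp measurable_norm).aestronglyMeasurable ?_
  filter_upwards [ae_restrict_mem measurableSet_ball] with x hx
  have hxR : ‖x‖ < R := by simpa using hx
  simp only [Pi.add_apply, Real.norm_eq_abs]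
  rcases eq_or_ne x 0 with rfl | hx0
  · simp only [norm_zero, Real.log_zero, abs_zero]
    positivity
  have hpos : 0 < ‖x‖ := norm_pos_iff.2 hx0
  rcases le_total ‖x‖ 1 with h1 | h1
  · rw [abs_of_nonpos (Real.log_nonpos hpos.le h1), ← Real.log_inv]
    have h2 := Real.log_le_rpow_div (inv_nonneg.2 hpos.le) (ε := 1 / 2) (by norm_num)
    rw [Real.inv_rpow hpos.le, ← Real.rpow_neg hpos.le] at h2
    have h3 := abs_nonneg (Real.log (|R| + 1))
    linarith
  · rw [abs_of_nonneg (Real.log_nonneg h1)]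
    have h2 : Real.log ‖x‖ ≤ Real.log (|R| + 1) :=
      Real.log_le_log hpos (by linarith [le_abs_self R])
    have h3 := le_abs_self (Real.log (|R| + 1))
    have h4 : (0 : ℝ) ≤ 2 * ‖x‖ ^ (-(1 / 2 : ℝ)) := by positivity
    linarith

theorem integrable_prod_rpow_dist {d : ℕ} (hd : 0 < d) {γ : ℝ} (hγ : γ < d) {S : Set (Euc d)}
    (hS : IsCompact S) :
    IntegrableOn (fun p : Euc d × Euc d => dist p.1 p.2 ^ (-γ)) (S ×ˢ S) := by
  obtain ⟨R, hR⟩ := hS.isBounded.subset_ball (0 : Euc d)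
  have hf : Integrable (S.indicator (fun _ : Euc d => (1 : ℝ))) :=
    (integrableOn_const hS.measure_lt_top.ne).integrable_indicator hS.measurableSet
  have hg := (integrableOn_norm_rpow_neg hd hγ (R + R)).integrable_indicator measurableSet_ball
  have h := hf.convolution_integrand (ContinuousLinearMap.mul ℝ ℝ) hg
  refine (h.integrableOn (s := S ×ˢ S)).congr_fun (fun p hp => ?_)
    (hS.measurableSet.prod hS.measurableSet)
  have h1 : p.1 - p.2 ∈ Metric.ball (0 : Euc d) (R + R) := by
    have h2 := hR hp.1
    have h3 := hR hp.2
    rw [mem_ball_zero_iff] at *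
    exact (norm_sub_le _ _).trans_lt (add_lt_add h2 h3)
  simp [indicator_of_mem hp.2, indicator_of_mem h1, dist_eq_norm]

theorem ae_ne_prod {d : ℕ} (hd : 0 < d) : ∀ᵐ p : Euc d × Euc d, p.1 ≠ p.2 := by
  have : Nonempty (Fin d) := ⟨⟨0, hd⟩⟩
  rw [Measure.volume_eq_prod]
  refine (Measure.ae_prod_iff_ae_ae ?_).2 ?_
  · exact (isClosed_diagonal.measurableSet).compl
  · refine Eventually.of_forall fun x => ?_
    have : ∀ᵐ y : Euc d, y ≠ x := by
      simp [ae_iff]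
    filter_upwards [this] with y hy using hy.symm

/-! ### The covariance form on test functions -/

theorem integrable_log_dist_mul {d : ℕ} (hd : 0 < d) {φ ψ : Euc d → ℝ} (hφ : Continuous φ)
    (hφc : HasCompactSupport φ) (hψ : Continuous ψ) (hψc : HasCompactSupport ψ) :
    Integrable (fun p : Euc d × Euc d => Real.log (1 / dist p.1 p.2) * φ p.1 * ψ p.2) := by
  obtain ⟨R, hR⟩ := (hφc.isCompact.union hψc.isCompact).isBounded.subset_ball (0 : Euc d)
  have hf : Integrable ψ := hψ.integrable_of_hasCompactSupport hψc
  have hg := (integrableOn_log_norm hd (R + R)).integrable_indicator measurableSet_ball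
  have h := hf.convolution_integrand (ContinuousLinearMap.mul ℝ ℝ) hg
  obtain ⟨C, hC⟩ := hφ.bounded_above_of_compact_support hφc
  have h2 := (h.bdd_mul (f := fun p : Euc d × Euc d => φ p.1) (c := C)
    (by fun_prop) (Eventually.of_forall fun p => hC p.1)).neg
  refine h2.congr (Eventually.of_forall fun p => ?_)
  by_cases h3 : φ p.1 = 0
  · simp [h3]
  by_cases h4 : ψ p.2 = 0
  · simp [h4]
  have h1 : p.1 - p.2 ∈ Metric.ball (0 : Euc d) (R + R) := by
    have h2 := hR (Or.inl (subset_tsupport _ h3))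
    have h3 := hR (Or.inr (subset_tsupport _ h4))
    rw [mem_ball_zero_iff] at *
    exact (norm_sub_le _ _).trans_lt (add_lt_add h2 h3)
  simp [indicator_of_mem h1, dist_eq_norm]
  ring

theorem integrable_contOn_mul {d : ℕ} {D : Set (Euc d)} {L : Euc d × Euc d → ℝ}
    (hL : ContinuousOn L (D ×ˢ D)) (φ ψ : TestFun D) :
    Integrable (fun p : Euc d × Euc d => L p * φ.1 p.1 * ψ.1 p.2) := by
  have h1 : IntegrableOn (fun p : Euc d × Euc d => L p * φ.1 p.1 * ψ.1 p.2)
      (tsupport φ.1 ×ˢ tsupport ψ.1) := by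
    refine ContinuousOn.integrableOn_compact
      (φ.2.hasCompactSupport.isCompact.prod ψ.2.hasCompactSupport.isCompact) ?_
    have h2 := φ.2.continuous
    have h3 := ψ.2.continuous
    exact ((hL.mono (prod_mono φ.2.tsupport_subset ψ.2.tsupport_subset)).mul
      (by fun_prop)).mul (by fun_prop)
  refine (integrableOn_iff_integrable_of_support_subset fun p hp => ?_).1 h1
  have h4 : L p * φ.1 p.1 * ψ.1 p.2 ≠ 0 := hp
  exact ⟨subset_tsupport _ fun h => h4 (by simp [h]), subset_tsupport _ fun h => h4 (by simp [h])⟩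

theorem kernel_mul_ae_eq {d : ℕ} (hd : 0 < d) {D : Set (Euc d)} {K : Euc d → Euc d → ℝ}
    {L : Euc d × Euc d → ℝ}
    (hKL : ∀ x ∈ D, ∀ y ∈ D, x ≠ y → K x y = Real.log (1 / dist x y) + L (x, y))
    (φ ψ : TestFun D) :
    (fun p : Euc d × Euc d => K p.1 p.2 * φ.1 p.1 * ψ.1 p.2) =ᵐ[volume]
      (fun p => Real.log (1 / dist p.1 p.2) * φ.1 p.1 * ψ.1 p.2 + L p * φ.1 p.1 * ψ.1 p.2) := by
  filter_upwards [ae_ne_prod hd] with p hp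
  by_cases h3 : φ.1 p.1 = 0
  · simp [h3]
  by_cases h4 : ψ.1 p.2 = 0
  · simp [h4]
  rw [hKL p.1 (φ.2.tsupport_subset (subset_tsupport _ h3)) p.2
    (ψ.2.tsupport_subset (subset_tsupport _ h4)) hp]
  ring

theorem IsLogKernel.integrable {d : ℕ} (hd : 0 < d) {D : Set (Euc d)} {K : Euc d → Euc d → ℝ}
    (hK : IsLogKernel D K) (φ ψ : TestFun D) :
    Integrable (fun p : Euc d × Euc d => K p.1 p.2 * φ.1 p.1 * ψ.1 p.2) := by
  obtain ⟨L, hL, hKL⟩ := hK.exists_continuous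
  exact ((integrable_log_dist_mul hd φ.2.continuous φ.2.hasCompactSupport ψ.2.continuous
    ψ.2.hasCompactSupport).add (integrable_contOn_mul hL φ ψ)).congr
      (kernel_mul_ae_eq hd hKL φ ψ).symm

/-- A probability density concentrated on the closed ball `B(x, r)` and of height at most
`A / r ^ d`. -/
structure IsBump {d : ℕ} (A : ℝ) (x : Euc d) (r : ℝ) (φ : Euc d → ℝ) : Prop where
  nonneg : ∀ z, 0 ≤ φ z
  dist_le : ∀ z, φ z ≠ 0 → dist z x ≤ r
  le : ∀ z, φ z ≤ A * (r ^ d)⁻¹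
  integral_eq_one : ∫ z, φ z = 1

theorem Mollifier.exists_isBump {d : ℕ} (θ : Mollifier d) :
    ∃ A : ℝ, 0 ≤ A ∧ ∀ ε : ℝ, 0 < ε → ∀ x : Euc d,
      IsBump A x ε (fun y => θ.scaled ε (x - y)) := by
  have hcs : HasCompactSupport θ.toFun :=
    HasCompactSupport.of_support_subset_isCompact (isCompact_closedBall 0 1)
      ((subset_tsupport _).trans θ.tsupport_subset)
  obtain ⟨A, hA⟩ := θ.smooth.continuous.bounded_above_of_compact_support hcs
  refine ⟨A, (norm_nonneg _).trans (hA 0), fun ε hε x => ⟨fun z => ?_, fun z hz => ?_, fun z => ?_,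
    ?_⟩⟩
  · exact mul_nonneg (by positivity) (θ.nonneg _)
  · have h1 : θ.toFun (ε⁻¹ • (x - z)) ≠ 0 := by
      intro h0
      exact hz (by simp [Mollifier.scaled, h0])
    have h2 := θ.tsupport_subset (subset_tsupport _ h1)
    rw [mem_closedBall_zero_iff, norm_smul, norm_inv, Real.norm_of_nonneg hε.le,
      inv_mul_le_iff₀ hε, mul_one] at h2
    rwa [dist_comm, dist_eq_norm]
  · rw [Mollifier.scaled, mul_comm]
    exact mul_le_mul_of_nonneg_right ((le_abs_self _).trans (hA _)) (by positivity)
  · rw [integral_sub_left_eq_self (fun y => θ.scaled ε y)]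
    simp only [Mollifier.scaled]
    rw [integral_const_mul, Measure.integral_comp_inv_smul_of_nonneg _ _ hε.le,
      θ.integral_eq_one]
    have : ε ^ d ≠ 0 := (pow_pos hε d).ne'
    simp [this]

/-! ### Covariances of mollified fields -/

theorem IsBump.mono {d : ℕ} {A A' : ℝ} {x : Euc d} {r : ℝ} {φ : Euc d → ℝ} (h : IsBump A x r φ)
    (hA : A ≤ A') (hr : 0 ≤ r) : IsBump A' x r φ :=
  ⟨h.nonneg, h.dist_le, fun z => (h.le z).trans (mul_le_mul_of_nonneg_right hA (by positivity)),
    h.integral_eq_one⟩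

theorem IsBump.integral_mul {d : ℕ} {A A' : ℝ} {x y : Euc d} {r r' : ℝ} {φ ψ : Euc d → ℝ}
    (hφ : IsBump A x r φ) (hψ : IsBump A' y r' ψ) :
    ∫ p : Euc d × Euc d, φ p.1 * ψ p.2 = 1 := by
  rw [Measure.volume_eq_prod, integral_prod_mul, hφ.integral_eq_one, hψ.integral_eq_one, mul_one]

theorem TestFun.integrable {d : ℕ} {D : Set (Euc d)} (φ : TestFun D) : Integrable φ.1 :=
  φ.2.continuous.integrable_of_hasCompactSupport φ.2.hasCompactSupport

theorem le_kernelForm {d : ℕ} (hd : 0 < d) {D : Set (Euc d)} {K : Euc d → Euc d → ℝ}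
    (hK : IsLogKernel D K) {A A' : ℝ} {x y : Euc d} {r r' : ℝ} {φ ψ : TestFun D}
    (hφ : IsBump A x r φ.1) (hψ : IsBump A' y r' ψ.1) {c : ℝ}
    (hc : ∀ z w, φ.1 z ≠ 0 → ψ.1 w ≠ 0 → z ≠ w → c ≤ K z w) : c ≤ kernelForm K φ.1 ψ.1 := by
  have h1 : ∫ p : Euc d × Euc d, c * (φ.1 p.1 * ψ.1 p.2) = c := by
    rw [integral_const_mul, hφ.integral_mul hψ, mul_one]
  rw [← h1, kernelForm]
  refine integral_mono_ae ((φ.integrable.mul_prod ψ.integrable).const_mul c)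
    (hK.integrable hd φ ψ) ?_
  filter_upwards [ae_ne_prod hd] with p hp
  by_cases h3 : φ.1 p.1 = 0
  · simp [h3]
  by_cases h4 : ψ.1 p.2 = 0
  · simp [h4]
  rw [mul_assoc]
  exact mul_le_mul_of_nonneg_right (hc _ _ h3 h4 hp) (mul_nonneg (hφ.nonneg _) (hψ.nonneg _))

theorem kernelForm_le {d : ℕ} (hd : 0 < d) {D : Set (Euc d)} {K : Euc d → Euc d → ℝ}
    (hK : IsLogKernel D K) {A A' : ℝ} {x y : Euc d} {r r' : ℝ} {φ ψ : TestFun D}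
    (hφ : IsBump A x r φ.1) (hψ : IsBump A' y r' ψ.1) {c : ℝ} {H : Euc d × Euc d → ℝ}
    (hH : Integrable (fun p : Euc d × Euc d => H p * (φ.1 p.1 * ψ.1 p.2)))
    (hc : ∀ z w, φ.1 z ≠ 0 → ψ.1 w ≠ 0 → z ≠ w → K z w ≤ c + H (z, w)) :
    kernelForm K φ.1 ψ.1 ≤ c + ∫ p : Euc d × Euc d, H p * (φ.1 p.1 * ψ.1 p.2) := by
  have h1 : ∫ p : Euc d × Euc d, c * (φ.1 p.1 * ψ.1 p.2) = c := by
    rw [integral_const_mul, hφ.integral_mul hψ, mul_one]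
  have h2 : Integrable (fun p : Euc d × Euc d => c * (φ.1 p.1 * ψ.1 p.2)) :=
    (φ.integrable.mul_prod ψ.integrable).const_mul c
  have h3 : c + ∫ p : Euc d × Euc d, H p * (φ.1 p.1 * ψ.1 p.2)
      = ∫ p : Euc d × Euc d, (c * (φ.1 p.1 * ψ.1 p.2) + H p * (φ.1 p.1 * ψ.1 p.2)) := by
    rw [integral_add h2 hH, h1]
  rw [h3, kernelForm]
  refine integral_mono_ae (hK.integrable hd φ ψ) (h2.add hH) ?_
  filter_upwards [ae_ne_prod hd] with p hp
  by_cases h3 : φ.1 p.1 = 0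
  · simp [h3]
  by_cases h4 : ψ.1 p.2 = 0
  · simp [h4]
  rw [mul_assoc, ← add_mul]
  exact mul_le_mul_of_nonneg_right (hc _ _ h3 h4 hp) (mul_nonneg (hφ.nonneg _) (hψ.nonneg _))

/-- The integral of `log⁺ (1 / |u|)` over the whole space. -/
def posLogIntegral (d : ℕ) : ℝ := ∫ u : Euc d, Real.posLog (1 / ‖u‖)

theorem posLogIntegral_nonneg (d : ℕ) : 0 ≤ posLogIntegral d :=
  integral_nonneg fun _ => Real.posLog_nonneg

theorem integrable_posLog_inv_norm {d : ℕ} (hd : 0 < d) {r : ℝ} (hr : 0 < r) :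
    Integrable (fun u : Euc d => Real.posLog (r / ‖u‖)) := by
  have h1 : Integrable (fun u : Euc d => Real.posLog (1 / ‖u‖)) := by
    have h := ((integrableOn_log_norm hd 1).integrable_indicator measurableSet_ball).neg
    refine h.congr (Eventually.of_forall fun u => ?_)
    simp only [Pi.neg_apply, indicator, mem_ball_zero_iff]
    rcases eq_or_ne u 0 with rfl | hu
    · simp
    have hu' : 0 < ‖u‖ := norm_pos_iff.2 hu
    split_ifs with h2
    · rw [Real.posLog_eq_log, one_div, Real.log_inv]
      rw [abs_of_nonneg (by positivity), one_div]
      exact (one_le_inv₀ hu').2 h2.le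
    · symm
      rw [neg_zero, Real.posLog_eq_zero_iff, abs_of_nonneg (by positivity), one_div]
      exact inv_le_one_of_one_le₀ (not_lt.1 h2)
  refine (h1.comp_smul (inv_ne_zero hr.ne')).congr (Eventually.of_forall fun u => ?_)
  simp only [norm_smul, norm_inv, Real.norm_of_nonneg hr.le]
  congr 1
  field_simp

theorem integral_posLog_div_norm {d : ℕ} {r : ℝ} (hr : 0 < r) :
    ∫ u : Euc d, Real.posLog (r / ‖u‖) = r ^ d * posLogIntegral d := by
  have h := Measure.integral_comp_inv_smul_of_nonneg (volume : Measure (Euc d))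
    (fun u : Euc d => Real.posLog (1 / ‖u‖)) hr.le
  simp only [finrank_euclideanSpace, Fintype.card_fin, smul_eq_mul] at h
  rw [posLogIntegral, ← h]
  congr 1
  ext u
  rw [norm_smul, norm_inv, Real.norm_of_nonneg hr.le]
  congr 1
  field_simp

theorem integrable_posLog_mul {d : ℕ} (hd : 0 < d) {D : Set (Euc d)} {r : ℝ} (hr : 0 < r)
    (φ ψ : TestFun D) :
    Integrable (fun p : Euc d × Euc d =>
      Real.posLog (r / dist p.1 p.2) * (φ.1 p.1 * ψ.1 p.2)) := by
  have h := ψ.integrable.convolution_integrand (ContinuousLinearMap.mul ℝ ℝ)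
    (integrable_posLog_inv_norm hd hr)
  obtain ⟨C, hC⟩ := φ.2.continuous.bounded_above_of_compact_support φ.2.hasCompactSupport
  have hφ := φ.2.continuous
  have h2 := h.bdd_mul (f := fun p : Euc d × Euc d => φ.1 p.1) (c := C)
    (by fun_prop) (Eventually.of_forall fun p => hC p.1)
  refine h2.congr (Eventually.of_forall fun p => ?_)
  simp only [ContinuousLinearMap.mul_apply', dist_eq_norm]
  ring

/-- The excess of `log (1 / |z - w|)` over `log (1 / r)` has a bounded mean against a density of
height `r⁻ᵈ`, by scaling. -/
theorem integral_posLog_mul_le_left {d : ℕ} (hd : 0 < d) {D : Set (Euc d)} {A A' : ℝ}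
    {x y : Euc d} {r r' : ℝ} (hr : 0 < r) {φ ψ : TestFun D} (hφ : IsBump A x r φ.1)
    (hψ : IsBump A' y r' ψ.1) :
    ∫ p : Euc d × Euc d, Real.posLog (r / dist p.1 p.2) * (φ.1 p.1 * ψ.1 p.2)
      ≤ A * posLogIntegral d := by
  have h := (ψ.integrable.convolution_integrand (ContinuousLinearMap.mul ℝ ℝ)
    (integrable_posLog_inv_norm hd hr)).const_mul (A * (r ^ d)⁻¹)
  have h1 : ∫ p : Euc d × Euc d, Real.posLog (r / dist p.1 p.2) * (φ.1 p.1 * ψ.1 p.2)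
      ≤ ∫ p : Euc d × Euc d, A * (r ^ d)⁻¹ * (ψ.1 p.2 * Real.posLog (r / ‖p.1 - p.2‖)) := by
    refine integral_mono (integrable_posLog_mul hd hr φ ψ) h fun p => ?_
    simp only [dist_eq_norm]
    calc Real.posLog (r / ‖p.1 - p.2‖) * (φ.1 p.1 * ψ.1 p.2)
        = φ.1 p.1 * (ψ.1 p.2 * Real.posLog (r / ‖p.1 - p.2‖)) := by ring
      _ ≤ _ := mul_le_mul_of_nonneg_right (hφ.le _)
          (mul_nonneg (hψ.nonneg _) Real.posLog_nonneg)
  refine h1.trans (le_of_eq ?_)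
  have h0 : Integrable (fun p : Euc d × Euc d => ψ.1 p.2 * Real.posLog (r / ‖p.1 - p.2‖))
      ((volume : Measure (Euc d)).prod volume) :=
    ψ.integrable.convolution_integrand (ContinuousLinearMap.mul ℝ ℝ)
      (integrable_posLog_inv_norm hd hr)
  rw [integral_const_mul, Measure.volume_eq_prod, integral_prod_symm _ h0]
  have h2 : ∀ w : Euc d, (∫ z : Euc d, ψ.1 w * Real.posLog (r / ‖z - w‖))
      = ψ.1 w * (r ^ d * posLogIntegral d) := fun w => by
    rw [integral_const_mul, integral_sub_right_eq_self (fun z : Euc d => Real.posLog (r / ‖z‖)),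
      integral_posLog_div_norm hr]
  simp only [h2]
  rw [integral_mul_const, hψ.integral_eq_one]
  have : r ^ d ≠ 0 := (pow_pos hr d).ne'
  field_simp

theorem integral_posLog_mul_le_right {d : ℕ} (hd : 0 < d) {D : Set (Euc d)} {A A' : ℝ}
    {x y : Euc d} {r r' : ℝ} (hr : 0 < r') {φ ψ : TestFun D} (hφ : IsBump A x r φ.1)
    (hψ : IsBump A' y r' ψ.1) :
    ∫ p : Euc d × Euc d, Real.posLog (r' / dist p.1 p.2) * (φ.1 p.1 * ψ.1 p.2)
      ≤ A' * posLogIntegral d := by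
  refine le_trans (le_of_eq ?_) (integral_posLog_mul_le_left hd hr hψ hφ)
  rw [Measure.volume_eq_prod, ← integral_prod_swap]
  congr 1
  ext p
  simp only [Prod.fst_swap, Prod.snd_swap, dist_comm]
  ring

/-- The covariance of two averages of the field, at scales `r`, `r'` and points `x`, `y`, is
the logarithm of the inverse of the largest of `r`, `r'` and `|x - y|`, up to a constant. -/
theorem exists_kernelForm_bounds {d : ℕ} (hd : 0 < d) {D : Set (Euc d)} {K : Euc d → Euc d → ℝ}
    (hK : IsLogKernel D K) {S : Set (Euc d)} (hS : IsCompact S) {δ : ℝ}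
    (hSD : Metric.cthickening δ S ⊆ D) {A : ℝ} (hA : 0 ≤ A) :
    ∃ C : ℝ, 0 ≤ C ∧ ∀ (φ ψ : TestFun D) (x y : Euc d) (r r' : ℝ), x ∈ S → y ∈ S → r ∈ Ioc 0 δ →
      r' ∈ Ioc 0 δ → IsBump A x r φ.1 → IsBump A y r' ψ.1 →
      Real.log (1 / (r + r' + dist x y)) - C ≤ kernelForm K φ.1 ψ.1 ∧
      kernelForm K φ.1 ψ.1 ≤ Real.log (1 / max (max r r') (dist x y)) + C := by
  obtain ⟨L, hL, hKL⟩ := hK.exists_continuous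
  have hT : IsCompact (Metric.cthickening δ S) := hS.cthickening
  obtain ⟨C, hC⟩ := (hT.prod hT).exists_bound_of_continuousOn (hL.mono (prod_mono hSD hSD))
  have hI := posLogIntegral_nonneg d
  refine ⟨|C| + A * posLogIntegral d + Real.log 4, by positivity, ?_⟩
  intro φ ψ x y r r' hx hy hr hr' hφ hψ
  have hlog2 : Real.log 2 ≤ Real.log 4 := Real.log_le_log (by norm_num) (by norm_num)
  have hlog4 : 0 ≤ Real.log 4 := Real.log_nonneg (by norm_num)
  have hAI : 0 ≤ A * posLogIntegral d := by positivity
  have hLz : ∀ z w, φ.1 z ≠ 0 → ψ.1 w ≠ 0 → z ≠ w →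
      |K z w - Real.log (1 / dist z w)| ≤ |C| := by
    intro z w hz hw hzw
    have hz1 : z ∈ Metric.cthickening δ S :=
      Metric.mem_cthickening_of_dist_le z x δ S hx ((hφ.dist_le z hz).trans hr.2)
    have hw1 : w ∈ Metric.cthickening δ S :=
      Metric.mem_cthickening_of_dist_le w y δ S hy ((hψ.dist_le w hw).trans hr'.2)
    rw [hKL z (hSD hz1) w (hSD hw1) hzw, add_sub_cancel_left]
    exact (hC (z, w) ⟨hz1, hw1⟩).trans (le_abs_self C)
  have hr0 := hr.1
  have hr0' := hr'.1
  have hxy := dist_nonneg (x := x) (y := y)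
  constructor
  · refine le_kernelForm hd hK hφ hψ fun z w hz hw hzw => ?_
    have h1 := (abs_le.1 (hLz z w hz hw hzw)).1
    have h2 := hφ.dist_le z hz
    have h3 := hψ.dist_le w hw
    have h4 : dist z w ≤ r + r' + dist x y := by
      have := dist_triangle4 z x y w
      rw [dist_comm y w] at this
      linarith
    have h5 : Real.log (1 / (r + r' + dist x y)) ≤ Real.log (1 / dist z w) :=
      Real.log_le_log (by positivity)
        (one_div_le_one_div_of_le (dist_pos.2 hzw) h4)
    linarith
  · have hm : 0 < max r r' := lt_max_of_lt_left hr0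
    rcases le_or_gt (4 * max r r') (dist x y) with h | h
    · have hpos : 0 < dist x y := by linarith
      have h0 := kernelForm_le hd hK hφ hψ (c := Real.log (1 / dist x y) + Real.log 2 + |C|)
        (H := fun _ => 0) (by simp) fun z w hz hw hzw => by
          have h1 := (abs_le.1 (hLz z w hz hw hzw)).2
          have h2 := hφ.dist_le z hz
          have h3 := hψ.dist_le w hw
          have h4 : dist x y / 2 ≤ dist z w := by
            have := dist_triangle4 x z w y
            rw [dist_comm x z] at this
            have := le_max_left r r'
            have := le_max_right r r'
            linarith
          have h5 : Real.log (1 / dist z w) ≤ Real.log (1 / dist x y) + Real.log 2 := by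
            rw [← Real.log_mul (by positivity) (by norm_num)]
            refine Real.log_le_log (one_div_pos.2 (dist_pos.2 hzw)) ?_
            have h6 : 1 / dist x y * 2 = 1 / (dist x y / 2) := by field_simp
            rw [h6]
            exact one_div_le_one_div_of_le (by positivity) h4
          linarith
      simp only [zero_mul, integral_zero, add_zero] at h0
      rw [max_eq_right (by linarith : max r r' ≤ dist x y)]
      linarith
    · have key : ∀ ρ, 0 < ρ → ∀ z w, φ.1 z ≠ 0 → ψ.1 w ≠ 0 → z ≠ w →
          K z w ≤ Real.log (1 / ρ) + |C| + Real.posLog (ρ / dist z w) := by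
        intro ρ hρ z w hz hw hzw
        have h1 := (abs_le.1 (hLz z w hz hw hzw)).2
        have h2 : Real.log (1 / dist z w) = Real.log (1 / ρ) + Real.log (ρ / dist z w) := by
          have := dist_pos.2 hzw
          rw [← Real.log_mul (by positivity) (by positivity)]
          congr 1
          field_simp
        have h3 : Real.log (ρ / dist z w) ≤ Real.posLog (ρ / dist z w) := le_max_right _ _
        linarith
      have h0 : kernelForm K φ.1 ψ.1
          ≤ Real.log (1 / max r r') + |C| + A * posLogIntegral d := by
        rcases le_total r r' with h1 | h1
        · rw [max_eq_right h1]
          refine (kernelForm_le hd hK hφ hψ (integrable_posLog_mul hd hr0' φ ψ)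
            (key r' hr0')).trans ?_
          linarith [integral_posLog_mul_le_right hd hr0' hφ hψ]
        · rw [max_eq_left h1]
          refine (kernelForm_le hd hK hφ hψ (integrable_posLog_mul hd hr0 φ ψ)
            (key r hr0)).trans ?_
          linarith [integral_posLog_mul_le_left hd hr0 hφ hψ]
      have h2 : Real.log (1 / max r r')
          ≤ Real.log (1 / max (max r r') (dist x y)) + Real.log 4 := by
        have h3 : max (max r r') (dist x y) ≤ 4 * max r r' := max_le (by linarith) h.le
        have h4 : 0 < max (max r r') (dist x y) := lt_max_of_lt_left hm
        rw [← Real.log_mul (by positivity) (by norm_num)]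
        refine Real.log_le_log (by positivity) ?_
        rw [div_mul_eq_mul_div, one_mul, div_le_div_iff₀ hm h4]
        linarith
      linarith

/-- Off the diagonal the covariance of two averages of the field tends to `K x y` as the scales go
to `0`. -/
theorem kernelForm_near_of_ne {d : ℕ} (hd : 0 < d) {D : Set (Euc d)} (hD : IsOpen D)
    {K : Euc d → Euc d → ℝ} (hK : IsLogKernel D K) {x y : Euc d} (hx : x ∈ D) (hy : y ∈ D)
    (hxy : x ≠ y) {η : ℝ} (hη : 0 < η) :
    ∃ ρ > 0, ∀ (φ ψ : TestFun D) (A A' r r' : ℝ), r < ρ → r' < ρ → IsBump A x r φ.1 →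
      IsBump A' y r' ψ.1 → |kernelForm K φ.1 ψ.1 - K x y| ≤ η := by
  obtain ⟨L, hL, hKL⟩ := hK.exists_continuous
  have hcont : ContinuousAt (fun p : Euc d × Euc d => Real.log (1 / dist p.1 p.2) + L p)
      (x, y) := by
    have h1 : ContinuousAt L (x, y) := hL.continuousAt ((hD.prod hD).mem_nhds ⟨hx, hy⟩)
    have h2 : dist x y ≠ 0 := dist_ne_zero.2 hxy
    have h3 : ContinuousAt (fun p : Euc d × Euc d => dist p.1 p.2) (x, y) := by fun_prop
    exact ((continuousAt_const.div h3 h2).log (by simp [hxy])).add h1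
  obtain ⟨ρ, hρ, hball⟩ := Metric.continuousAt_iff.1 hcont η hη
  refine ⟨ρ, hρ, fun φ ψ A A' r r' hr hr' hφ hψ => ?_⟩
  have key : ∀ z w, φ.1 z ≠ 0 → ψ.1 w ≠ 0 → z ≠ w → |K z w - K x y| ≤ η := by
    intro z w hz hw hzw
    have h1 := hball (x := (z, w)) (max_lt ((hφ.dist_le z hz).trans_lt hr)
      ((hψ.dist_le w hw).trans_lt hr'))
    rw [hKL z (φ.2.tsupport_subset (subset_tsupport _ hz)) w
      (ψ.2.tsupport_subset (subset_tsupport _ hw)) hzw, hKL x hx y hy hxy]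
    exact h1.le
  rw [abs_le]
  constructor
  · have := le_kernelForm hd hK hφ hψ (c := K x y - η) fun z w hz hw hzw => by
      linarith [(abs_le.1 (key z w hz hw hzw)).1]
    linarith
  · have := kernelForm_le hd hK hφ hψ (c := K x y + η) (H := fun _ => 0) (by simp)
      fun z w hz hw hzw => by linarith [(abs_le.1 (key z w hz hw hzw)).2]
    simp only [zero_mul, integral_zero, add_zero] at this
    linarith

/-- The potential `∫ K(z, w) φ(z) dz` of a test function. -/
def potential {d : ℕ} (K : Euc d → Euc d → ℝ) (φ : Euc d → ℝ) (w : Euc d) : ℝ :=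
  ∫ z, K z w * φ z

theorem locallyIntegrable_log_norm {d : ℕ} (hd : 0 < d) :
    LocallyIntegrable (fun x : Euc d => Real.log ‖x‖) := by
  intro x
  refine ⟨Metric.ball 0 (‖x‖ + 1), Metric.isOpen_ball.mem_nhds (by simp),
    integrableOn_log_norm hd _⟩

/-- The potential is continuous: the logarithmic part of `K` gives a convolution of a continuous
function with a locally integrable one. -/
theorem continuousOn_potential {d : ℕ} (hd : 0 < d) {D : Set (Euc d)} (hD : IsOpen D)
    {K : Euc d → Euc d → ℝ} (hK : IsLogKernel D K) (φ : TestFun D) :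
    ContinuousOn (potential K φ.1) D := by
  have : Nonempty (Fin d) := ⟨⟨0, hd⟩⟩
  obtain ⟨L, hL, hKL⟩ := hK.exists_continuous
  have h1 : Continuous (fun w : Euc d => ∫ z, φ.1 z * Real.log ‖w - z‖) :=
    HasCompactSupport.continuous_convolution_left (ContinuousLinearMap.mul ℝ ℝ)
      φ.2.hasCompactSupport φ.2.continuous (locallyIntegrable_log_norm hd)
  have h2c : ContinuousOn (Function.uncurry fun w z : Euc d => L (z, w) * φ.1 z) (D ×ˢ univ) := by
    rintro ⟨w, z⟩ ⟨hw, -⟩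
    refine ContinuousAt.continuousWithinAt ?_
    by_cases hz : z ∈ tsupport φ.1
    · have hLc : ContinuousAt (fun p : Euc d × Euc d => L (p.2, p.1)) (w, z) :=
        ContinuousAt.comp (f := fun p : Euc d × Euc d => (p.2, p.1)) (g := L)
          (hL.continuousAt ((hD.prod hD).mem_nhds ⟨φ.2.tsupport_subset hz, hw⟩)) (by fun_prop)
      have := φ.2.continuous
      exact hLc.mul (by fun_prop)
    · have h3 : ∀ᶠ p : Euc d × Euc d in 𝓝 (w, z), p.2 ∉ tsupport φ.1 :=
        (continuous_snd.tendsto (w, z)).eventually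
          ((isClosed_tsupport φ.1).isOpen_compl.mem_nhds hz)
      refine (continuousAt_const (y := (0 : ℝ))).congr ?_
      filter_upwards [h3] with p hp
      simp [Function.uncurry, image_eq_zero_of_notMem_tsupport hp]
  have h2 : ContinuousOn (fun w : Euc d => ∫ z, L (z, w) * φ.1 z) D :=
    continuousOn_integral_of_compact_support φ.2.hasCompactSupport.isCompact h2c
      fun w z _ hz => by simp [image_eq_zero_of_notMem_tsupport hz]
  refine ((h1.neg.continuousOn (s := D)).add h2).congr fun w hw => ?_
  have h3 : Integrable (fun z => -(φ.1 z * Real.log ‖w - z‖)) := Integrable.neg <|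
    φ.2.hasCompactSupport.convolutionExists_left (ContinuousLinearMap.mul ℝ ℝ)
      φ.2.continuous (locallyIntegrable_log_norm hd) w
  have h4 : Integrable (fun z => L (z, w) * φ.1 z) := by
    have h5 : Continuous (fun z => L (z, w) * φ.1 z) := by
      rw [← continuousOn_univ]
      exact h2c.comp (f := fun z => (w, z)) (by fun_prop) fun z _ => ⟨hw, mem_univ _⟩
    exact h5.integrable_of_hasCompactSupport (φ.2.hasCompactSupport.mul_left)
  simp only [Pi.add_apply, Pi.neg_apply]
  rw [potential, ← integral_neg, ← integral_add h3 h4]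
  refine integral_congr_ae ?_
  have h6 : ∀ᵐ z : Euc d, z ≠ w := by simp [ae_iff]
  filter_upwards [h6] with z hz
  by_cases h7 : φ.1 z = 0
  · simp [h7]
  rw [hKL z (φ.2.tsupport_subset (subset_tsupport _ h7)) w hw hz, one_div, Real.log_inv,
    dist_comm, dist_eq_norm]
  ring

/-- The covariance of a fixed variable of the field with its averages near `x` tends to the
potential at `x`. -/
theorem kernelForm_near_potential {d : ℕ} (hd : 0 < d) {D : Set (Euc d)} (hD : IsOpen D)
    {K : Euc d → Euc d → ℝ} (hK : IsLogKernel D K) (φ : TestFun D) {x : Euc d} (hx : x ∈ D)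
    {η : ℝ} (hη : 0 < η) :
    ∃ ρ > 0, ∀ (ψ : TestFun D) (A r : ℝ), r < ρ → IsBump A x r ψ.1 →
      |kernelForm K φ.1 ψ.1 - potential K φ.1 x| ≤ η := by
  have hcont := (continuousOn_potential hd hD hK φ).continuousAt (hD.mem_nhds hx)
  obtain ⟨ρ, hρ, hball⟩ := Metric.continuousAt_iff.1 hcont η hη
  refine ⟨ρ, hρ, fun ψ A r hr hψ => ?_⟩
  have hint := hK.integrable hd φ ψ
  rw [Measure.volume_eq_prod] at hint
  have h1 : kernelForm K φ.1 ψ.1 = ∫ w, potential K φ.1 w * ψ.1 w := by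
    rw [kernelForm, Measure.volume_eq_prod, integral_prod_symm _ hint]
    refine integral_congr_ae (Eventually.of_forall fun w => ?_)
    simp only [potential]
    rw [← integral_mul_const]
  have hi : Integrable (fun w => potential K φ.1 w * ψ.1 w) := by
    refine hint.integral_prod_right.congr (Eventually.of_forall fun w => ?_)
    simp only [potential]
    rw [← integral_mul_const]
  have h2 : potential K φ.1 x = ∫ w, potential K φ.1 x * ψ.1 w := by
    rw [integral_const_mul, hψ.integral_eq_one, mul_one]
  rw [h1, h2, ← integral_sub hi (ψ.integrable.const_mul _), ← Real.norm_eq_abs]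
  have h3 : ∫ w, η * ψ.1 w = η := by rw [integral_const_mul, hψ.integral_eq_one, mul_one]
  rw [← h3]
  refine norm_integral_le_of_norm_le (ψ.integrable.const_mul _)
    (Eventually.of_forall fun w => ?_)
  by_cases hw : ψ.1 w = 0
  · simp [hw]
  rw [← sub_mul, norm_mul, Real.norm_of_nonneg (hψ.nonneg w)]
  exact mul_le_mul_of_nonneg_right
    (hball ((hψ.dist_le w hw).trans_lt hr)).le (hψ.nonneg w)

/-! ### Exponential moments of Gaussian processes -/

section GaussianVariable

variable {Ω : Type*} [MeasurableSpace Ω] {P : Measure Ω} {Z : Ω → ℝ}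

theorem map_eq_gaussianReal_of_centred [IsProbabilityMeasure P] (hZ : HasGaussianLaw Z P)
    (h0 : ∫ ω, Z ω ∂P = 0) :
    P.map Z = gaussianReal 0 (∫ ω, Z ω ^ 2 ∂P).toNNReal := by
  rw [hZ.map_eq_gaussianReal, h0, variance_of_integral_eq_zero hZ.aemeasurable h0]

theorem integral_exp_of_gaussian [IsProbabilityMeasure P] (hZ : HasGaussianLaw Z P)
    (h0 : ∫ ω, Z ω ∂P = 0) :
    ∫ ω, Real.exp (Z ω) ∂P = Real.exp ((∫ ω, Z ω ^ 2 ∂P) / 2) := by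
  have h := mgf_gaussianReal (map_eq_gaussianReal_of_centred hZ h0) 1
  rw [mgf] at h
  simp only [one_mul, zero_add, one_pow, mul_one] at h
  rw [h, Real.coe_toNNReal _ (integral_nonneg fun _ => sq_nonneg _)]

theorem integrable_exp_of_gaussian [IsProbabilityMeasure P] (hZ : HasGaussianLaw Z P)
    (h0 : ∫ ω, Z ω ∂P = 0) : Integrable (fun ω => Real.exp (Z ω)) P := by
  by_contra h
  have h1 := integral_exp_of_gaussian hZ h0
  rw [integral_undef h] at h1
  exact (Real.exp_pos _).ne h1

theorem integral_cexp_of_gaussian [IsProbabilityMeasure P] (hZ : HasGaussianLaw Z P)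
    (h0 : ∫ ω, Z ω ∂P = 0) :
    ∫ ω, Complex.exp (Complex.I * (Z ω : ℂ)) ∂P
      = ((Real.exp (-(∫ ω, Z ω ^ 2 ∂P) / 2) : ℝ) : ℂ) := by
  have h := complexMGF_gaussianReal (map_eq_gaussianReal_of_centred hZ h0) Complex.I
  rw [complexMGF] at h
  have h2 : (((∫ ω, Z ω ^ 2 ∂P).toNNReal : ℝ) : ℂ) = ((∫ ω, Z ω ^ 2 ∂P : ℝ) : ℂ) := by
    rw [Real.coe_toNNReal _ (integral_nonneg fun _ => sq_nonneg _)]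
  rw [h, h2]
  push_cast
  congr 1
  rw [Complex.I_sq]
  simp only [mul_zero, zero_add]
  ring

/-- A Gaussian variable of positive variance has no atoms. -/
theorem measure_eq_zero_of_gaussian [IsProbabilityMeasure P] (hZ : HasGaussianLaw Z P)
    (h0 : ∫ ω, Z ω ∂P = 0) (hv : 0 < ∫ ω, Z ω ^ 2 ∂P) (τ : ℝ) : P {ω | Z ω = τ} = 0 := by
  have h := map_eq_gaussianReal_of_centred hZ h0
  have h1 : (∫ ω, Z ω ^ 2 ∂P).toNNReal ≠ 0 := by simpa using hv
  have h2 := nullSingletonClass_gaussianReal (μ := 0) h1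
  have h3 : P.map Z {τ} = 0 := by
    rw [h]
    exact measure_singleton τ
  rwa [Measure.map_apply_of_aemeasurable hZ.aemeasurable (measurableSet_singleton τ)] at h3

/-- Exponential tilting of a centred Gaussian law is a translation by its variance. -/
theorem lintegral_mul_exp_gaussianReal {v : NNReal} (hv : v ≠ 0) {F : ℝ → ENNReal}
    (hF : Measurable F) :
    ∫⁻ z, F z * ENNReal.ofReal (Real.exp z) ∂(gaussianReal 0 v)
      = ENNReal.ofReal (Real.exp (v / 2)) * ∫⁻ z, F (z + v) ∂(gaussianReal 0 v) := by
  have h1 : ∫⁻ z, F (z + v) ∂(gaussianReal 0 v) = ∫⁻ z, F z ∂(gaussianReal v v) := by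
    have h := gaussianReal_map_add_const (μ := 0) (v := v) (v : ℝ)
    rw [zero_add] at h
    rw [← h, lintegral_map hF (by fun_prop)]
  have hm : ∀ m : ℝ, Measurable (gaussianPDF m v) := fun m => measurable_gaussianPDF m v
  rw [h1, gaussianReal_of_var_ne_zero _ hv, gaussianReal_of_var_ne_zero _ hv,
    lintegral_withDensity_eq_lintegral_mul _ (hm _) (by fun_prop),
    lintegral_withDensity_eq_lintegral_mul _ (hm _) hF,
    ← lintegral_const_mul _ ((hm _).mul hF)]
  congr 1
  ext z
  have h2 : gaussianPDFReal 0 v z * Real.exp z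
      = Real.exp (v / 2) * gaussianPDFReal v v z := by
    have hv' : (v : ℝ) ≠ 0 := by exact_mod_cast hv
    simp only [gaussianPDFReal]
    rw [mul_assoc, mul_left_comm (Real.exp _), ← Real.exp_add, ← Real.exp_add]
    congr 2
    field_simp
    ring
  have h3 : gaussianPDF 0 v z * ENNReal.ofReal (Real.exp z)
      = ENNReal.ofReal (Real.exp (v / 2)) * gaussianPDF v v z := by
    rw [gaussianPDF, gaussianPDF, ← ENNReal.ofReal_mul (gaussianPDFReal_nonneg _ _ _), h2,
      ENNReal.ofReal_mul (Real.exp_pos _).le]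
  simp only [Pi.mul_apply]
  calc gaussianPDF 0 v z * (F z * ENNReal.ofReal (Real.exp z))
      = (gaussianPDF 0 v z * ENNReal.ofReal (Real.exp z)) * F z := by ring
    _ = _ := by rw [h3]; ring

end GaussianVariable

/-- A centred Gaussian process `X` with measurable coordinates and covariance `c`. -/
structure IsCentredGaussian {Ω T : Type*} [MeasurableSpace Ω] (P : Measure Ω) (X : T → Ω → ℝ)
    (c : T → T → ℝ) : Prop where
  measurable : ∀ t, Measurable (X t)
  gaussian : IsGaussianProcess X P
  centred : ∀ t, ∫ ω, X t ω ∂P = 0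
  covariance : ∀ s t, ∫ ω, X s ω * X t ω ∂P = c s t

theorem IsGaussianField.isCentredGaussian {d : ℕ} {Ω : Type*} [MeasurableSpace Ω] {P : Measure Ω}
    {D : Set (Euc d)} {K : Euc d → Euc d → ℝ} {X : TestFun D → Ω → ℝ}
    (hX : IsGaussianField P D K X) :
    IsCentredGaussian P X (fun φ ψ => kernelForm K φ.1 ψ.1) :=
  ⟨hX.measurable, hX.gaussian, hX.centred, hX.covariance⟩

namespace IsCentredGaussian

variable {Ω T : Type*} [MeasurableSpace Ω] {P : Measure Ω} {X : T → Ω → ℝ} {c : T → T → ℝ}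

theorem integral_add_add {f g h : Ω → ℝ} (hf : Integrable f P) (hg : Integrable g P)
    (hh : Integrable h P) :
    ∫ ω, (f ω + g ω + h ω) ∂P = ∫ ω, f ω ∂P + ∫ ω, g ω ∂P + ∫ ω, h ω ∂P := by
  have hfg : Integrable (fun ω => f ω + g ω) P := hf.add hg
  rw [integral_add hfg hh, integral_add hf hg]

theorem symm (hX : IsCentredGaussian P X c) (s t : T) : c s t = c t s := by
  rw [← hX.covariance, ← hX.covariance]
  simp only [mul_comm]

theorem memLp (hX : IsCentredGaussian P X c) (t : T) : MemLp (X t) 2 P :=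
  (hX.gaussian.hasGaussianLaw_eval t).memLp (by simp)

theorem integrable [IsProbabilityMeasure P]
    (hX : IsCentredGaussian P X c) (t : T) : Integrable (X t) P :=
  (hX.memLp t).integrable one_le_two

theorem integrable_mul (hX : IsCentredGaussian P X c) (s t : T) :
    Integrable (fun ω => X s ω * X t ω) P :=
  (hX.memLp s).integrable_mul (hX.memLp t)

/-- Combinations of at most three values of a Gaussian process, in any number, form a Gaussian
process. -/
theorem isGaussianProcess_comb (hX : IsCentredGaussian P X c) {S : Type*} (i j k : S → T)
    (a b e : S → ℝ) :
    IsGaussianProcess (fun s ω => a s * X (i s) ω + b s * X (j s) ω + e s * X (k s) ω) P := by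
  classical
  refine hX.gaussian.of_isGaussianProcess fun s => ⟨{i s, j s, k s},
    a s • ContinuousLinearMap.proj ⟨i s, by simp⟩ + b s • ContinuousLinearMap.proj ⟨j s, by simp⟩
      + e s • ContinuousLinearMap.proj ⟨k s, by simp⟩, fun ω => ?_⟩
  simp

theorem integral_comb [IsProbabilityMeasure P]
    (hX : IsCentredGaussian P X c) (s t u : T) (a b e : ℝ) :
    ∫ ω, (a * X s ω + b * X t ω + e * X u ω) ∂P = 0 := by
  have h := fun t => hX.integrable t
  rw [integral_add_add ((h s).const_mul a) ((h t).const_mul b) ((h u).const_mul e)]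
  simp [integral_const_mul, hX.centred]

theorem integral_comb_mul [IsProbabilityMeasure P]
    (hX : IsCentredGaussian P X c) (s t u w : T) (a b e : ℝ) :
    ∫ ω, (a * X s ω + b * X t ω + e * X u ω) * X w ω ∂P = a * c s w + b * c t w + e * c u w := by
  have h := fun t => (hX.integrable_mul t w)
  have h1 : ∀ ω, (a * X s ω + b * X t ω + e * X u ω) * X w ω
      = a * (X s ω * X w ω) + b * (X t ω * X w ω) + e * (X u ω * X w ω) := fun ω => by ring
  simp only [h1]
  rw [integral_add_add ((h s).const_mul a) ((h t).const_mul b) ((h u).const_mul e)]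
  simp [integral_const_mul, hX.covariance]

theorem integral_comb_sq [IsProbabilityMeasure P]
    (hX : IsCentredGaussian P X c) (s t u : T) (a b e : ℝ) :
    ∫ ω, (a * X s ω + b * X t ω + e * X u ω) ^ 2 ∂P
      = a ^ 2 * c s s + b ^ 2 * c t t + e ^ 2 * c u u + 2 * a * b * c s t + 2 * a * e * c s u
        + 2 * b * e * c t u := by
  have hm : MemLp (fun ω => a * X s ω + b * X t ω + e * X u ω) 2 P :=
    (((hX.memLp s).const_mul a).add ((hX.memLp t).const_mul b)).add ((hX.memLp u).const_mul e)
  have h : ∀ w, Integrable (fun ω => (a * X s ω + b * X t ω + e * X u ω) * X w ω) P :=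
    fun w => hm.integrable_mul (hX.memLp w)
  have h1 : ∀ ω, (a * X s ω + b * X t ω + e * X u ω) ^ 2
      = a * ((a * X s ω + b * X t ω + e * X u ω) * X s ω)
        + b * ((a * X s ω + b * X t ω + e * X u ω) * X t ω)
        + e * ((a * X s ω + b * X t ω + e * X u ω) * X u ω) := fun ω => by ring
  simp only [h1]
  rw [integral_add_add ((h s).const_mul a) ((h t).const_mul b) ((h u).const_mul e)]
  simp only [integral_const_mul, hX.integral_comb_mul]
  rw [hX.symm t s, hX.symm u s, hX.symm u t]
  ring

theorem integral_exp_comb [IsProbabilityMeasure P]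
    (hX : IsCentredGaussian P X c) (s t u : T) (a b e : ℝ) :
    ∫ ω, Real.exp (a * X s ω + b * X t ω + e * X u ω) ∂P
      = Real.exp ((a ^ 2 * c s s + b ^ 2 * c t t + e ^ 2 * c u u) / 2 + a * b * c s t
        + a * e * c s u + b * e * c t u) := by
  rw [integral_exp_of_gaussian ((hX.isGaussianProcess_comb (fun _ : Unit => s) (fun _ => t)
    (fun _ => u) (fun _ => a) (fun _ => b) (fun _ => e)).hasGaussianLaw_eval ())
    (hX.integral_comb s t u a b e), hX.integral_comb_sq]
  congr 1
  ring

theorem integrable_exp_comb [IsProbabilityMeasure P]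
    (hX : IsCentredGaussian P X c) (s t u : T) (a b e : ℝ) :
    Integrable (fun ω => Real.exp (a * X s ω + b * X t ω + e * X u ω)) P :=
  integrable_exp_of_gaussian ((hX.isGaussianProcess_comb (fun _ : Unit => s) (fun _ => t)
    (fun _ => u) (fun _ => a) (fun _ => b) (fun _ => e)).hasGaussianLaw_eval ())
    (hX.integral_comb s t u a b e)

theorem integral_cexp_sub [IsProbabilityMeasure P]
    (hX : IsCentredGaussian P X c) (s t : T) (a : ℝ) :
    ∫ ω, Complex.exp (Complex.I * ((a * X s ω - a * X t ω : ℝ) : ℂ)) ∂P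
      = ((Real.exp (-(a ^ 2 * (c s s + c t t - 2 * c s t)) / 2) : ℝ) : ℂ) := by
  have h1 := (hX.isGaussianProcess_comb (fun _ : Unit => s) (fun _ => t) (fun _ => t)
    (fun _ => a) (fun _ => -a) (fun _ => 0)).hasGaussianLaw_eval ()
  have h2 := integral_cexp_of_gaussian h1 (hX.integral_comb s t t a (-a) 0)
  rw [hX.integral_comb_sq] at h2
  simp only [zero_mul, add_zero, neg_mul, ← sub_eq_add_neg] at h2
  rw [h2]
  congr 2
  ring

/-- Cameron–Martin formula: under the measure with density proportional to the exponential of a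
linear combination `Z` of values of the process, the process is translated by its covariance
with `Z`. -/
theorem cameronMartin [IsProbabilityMeasure P]
    (hX : IsCentredGaussian P X c) (s t : T) (a b : ℝ) {B : Set (T → ℝ)}
    (hB : MeasurableSet B) :
    ∫⁻ ω in {ω | (fun u => X u ω) ∈ B}, ENNReal.ofReal (Real.exp (a * X s ω + b * X t ω)) ∂P
      = ENNReal.ofReal (Real.exp ((a ^ 2 * c s s + b ^ 2 * c t t) / 2 + a * b * c s t))
        * P {ω | (fun u => X u ω + (a * c s u + b * c t u)) ∈ B} := by
  set Z : Ω → ℝ := fun ω => a * X s ω + b * X t ω with hZdef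
  have hZm : Measurable Z := ((hX.measurable s).const_mul a).add ((hX.measurable t).const_mul b)
  set m : T → ℝ := fun u => a * c s u + b * c t u with hm
  set V : ℝ := a ^ 2 * c s s + b ^ 2 * c t t + 2 * a * b * c s t with hV
  have hXm : Measurable (fun ω u => X u ω) := measurable_pi_iff.2 hX.measurable
  have hlaw : HasGaussianLaw Z P := by
    simpa using (hX.isGaussianProcess_comb (fun _ : Unit => s) (fun _ => t)
      (fun _ => t) (fun _ => a) (fun _ => b) (fun _ => 0)).hasGaussianLaw_eval ()
  have hZ0 : ∫ ω, Z ω ∂P = 0 := by simpa using hX.integral_comb s t t a b 0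
  have hZsq : ∫ ω, Z ω ^ 2 ∂P = V := by simpa using hX.integral_comb_sq s t t a b 0
  have hZX : ∀ u, ∫ ω, Z ω * X u ω ∂P = m u := fun u => by
    simpa using hX.integral_comb_mul s t t u a b 0
  have hZ2 : MemLp Z 2 P := ((hX.memLp s).const_mul a).add ((hX.memLp t).const_mul b)
  have hexp : (a ^ 2 * c s s + b ^ 2 * c t t) / 2 + a * b * c s t = V / 2 := by
    rw [hV]; ring
  rw [hexp]
  have hV0 : 0 ≤ V := hZsq ▸ integral_nonneg fun _ => sq_nonneg _
  -- the degenerate case: `Z` vanishes and so do its covariances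
  rcases hV0.eq_or_lt with hVz | hVpos
  · have hZae : Z =ᵐ[P] 0 := by
      have h1 : ∫ ω, Z ω ^ 2 ∂P = 0 := by rw [hZsq, ← hVz]
      have h2 := (integral_eq_zero_iff_of_nonneg (fun ω => sq_nonneg (Z ω)) hZ2.integrable_sq).1 h1
      filter_upwards [h2] with ω hω
      simpa using hω
    have hm0 : ∀ u, m u = 0 := fun u => by
      rw [← hZX u]
      refine integral_eq_zero_of_ae ?_
      filter_upwards [hZae] with ω hω
      simp [hω]
    have h3 : ∫⁻ ω in {ω | (fun u => X u ω) ∈ B}, ENNReal.ofReal (Real.exp (Z ω)) ∂P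
        = ∫⁻ _ in {ω | (fun u => X u ω) ∈ B}, 1 ∂P := by
      refine lintegral_congr_ae (ae_restrict_of_ae ?_)
      filter_upwards [hZae] with ω hω
      simp [hω]
    rw [h3, ← hVz]
    change _ = _ * P {ω | (fun u => X u ω + m u) ∈ B}
    simp [hm0]
  -- `X` is the sum of a multiple of `Z` and of a process `R` uncorrelated with `Z`, hence
  -- independent of it; the tilting only acts on the law of `Z`
  set ρ : T → ℝ := fun u => m u / V with hρ
  set R : T → Ω → ℝ := fun u ω => X u ω - ρ u * Z ω with hR
  have hRm : ∀ u, Measurable (R u) := fun u => (hX.measurable u).sub (hZm.const_mul _)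
  have hRm' : Measurable (fun ω u => R u ω) := measurable_pi_iff.2 hRm
  have hind : IndepFun (fun ω (_ : Unit) => Z ω) (fun ω u => R u ω) P := by
    refine IsGaussianProcess.indepFun_of_covariance_eq_zero (X := fun _ : Unit => Z) (Y := R)
      ?_ (fun _ => hZm.aemeasurable) (fun u => (hRm u).aemeasurable) ?_
    · have h := hX.isGaussianProcess_comb (S := Unit ⊕ T) (Sum.elim (fun _ => s) fun _ => s)
        (Sum.elim (fun _ => t) fun _ => t) (Sum.elim (fun _ => t) fun u => u)
        (Sum.elim (fun _ => a) fun u => -(ρ u * a)) (Sum.elim (fun _ => b) fun u => -(ρ u * b))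
        (Sum.elim (fun _ => 0) fun _ => 1)
      convert! h using 2 with q
      rcases q with q | q
      · ext ω
        simp [hZdef]
      · ext ω
        simp only [Sum.elim_inr, hR, hZdef]
        ring
    · intro _ u
      have hR2 : MemLp (R u) 2 P := (hX.memLp u).sub (hZ2.const_mul _)
      rw [covariance_eq_sub hZ2 hR2, hZ0, zero_mul, sub_zero]
      have h1 : ∀ ω, (Z * R u) ω = Z ω * X u ω - ρ u * Z ω ^ 2 := fun ω => by
        simp only [Pi.mul_apply, hR]; ring
      simp only [h1]
      have hZXi : Integrable (fun ω => Z ω * X u ω) P := hZ2.integrable_mul (hX.memLp u)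
      rw [integral_sub hZXi (hZ2.integrable_sq.const_mul _), integral_const_mul, hZsq, hZX u, hρ]
      field_simp
      ring
  have hind' : IndepFun Z (fun ω u => R u ω) P :=
    hind.comp (φ := fun f : Unit → ℝ => f ()) (ψ := id) (measurable_pi_apply ()) measurable_id
  have hmap := (indepFun_iff_map_prod_eq_prod_map_map hZm.aemeasurable hRm'.aemeasurable).1 hind'
  have hlawZ := map_eq_gaussianReal_of_centred hlaw hZ0
  rw [hZsq] at hlawZ
  set v : NNReal := V.toNNReal with hv
  have hvV : (v : ℝ) = V := Real.coe_toNNReal _ hV0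
  have hv0 : v ≠ 0 := by simpa [hv] using hVpos
  have hPR : IsProbabilityMeasure (P.map (fun ω u => R u ω)) :=
    Measure.isProbabilityMeasure_map hRm'.aemeasurable
  -- reconstruct `X` from `(Z, R)`
  set Φ : ℝ × (T → ℝ) → T → ℝ := fun p u => p.2 u + ρ u * p.1 with hΦ
  have hΦm : Measurable Φ := measurable_pi_iff.2 fun u =>
    ((measurable_pi_apply u).comp measurable_snd).add (measurable_fst.const_mul _)
  have hΦX : ∀ ω, Φ (Z ω, fun u => R u ω) = fun u => X u ω := fun ω => by
    ext u; simp [hΦ, hR]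
  have hΦV : ∀ ω, Φ (Z ω + v, fun u => R u ω) = fun u => X u ω + m u := fun ω => by
    ext u
    simp only [hΦ, hR, hρ, hvV]
    field_simp
    ring
  have hFm : Measurable (fun p : ℝ × (T → ℝ) => B.indicator (fun _ => (1 : ENNReal)) (Φ p)) :=
    (measurable_const.indicator hB).comp hΦm
  have hFs : Measurable (fun p : ℝ × (T → ℝ) =>
      B.indicator (fun _ => (1 : ENNReal)) (Φ (p.1 + v, p.2))) :=
    hFm.comp (g := fun p : ℝ × (T → ℝ) => B.indicator (fun _ => (1 : ENNReal)) (Φ p))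
      (f := fun p : ℝ × (T → ℝ) => (p.1 + (v : ℝ), p.2)) (by fun_prop)
  have hZR : Measurable (fun ω => (Z ω, fun u => R u ω)) := hZm.prodMk hRm'
  have hL : ∫⁻ ω in {ω | (fun u => X u ω) ∈ B}, ENNReal.ofReal (Real.exp (Z ω)) ∂P
      = ∫⁻ ω, B.indicator (fun _ => (1 : ENNReal)) (Φ (Z ω, fun u => R u ω))
        * ENNReal.ofReal (Real.exp (Z ω)) ∂P := by
    have hmeas : MeasurableSet {ω | (fun u => X u ω) ∈ B} := hXm hB
    rw [← lintegral_indicator hmeas]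
    congr 1
    ext ω
    rw [hΦX]
    by_cases h : (fun u => X u ω) ∈ B <;> simp [indicator, h]
  have hRr : P {ω | (fun u => X u ω + m u) ∈ B}
      = ∫⁻ ω, B.indicator (fun _ => (1 : ENNReal)) (Φ (Z ω + v, fun u => R u ω)) ∂P := by
    simp only [hΦV]
    have hmeas : MeasurableSet {ω | (fun u => X u ω + m u) ∈ B} := by
      have : Measurable (fun ω u => X u ω + m u) :=
        measurable_pi_iff.2 fun u => (hX.measurable u).add_const _
      exact this hB
    rw [← lintegral_indicator_one hmeas]
    rfl
  rw [hL, hRr]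
  rw [← lintegral_map (g := fun ω => (Z ω, fun u => R u ω))
      (f := fun p : ℝ × (T → ℝ) => B.indicator (fun _ => (1 : ENNReal)) (Φ p)
        * ENNReal.ofReal (Real.exp p.1)) (by fun_prop) hZR,
    ← lintegral_map (g := fun ω => (Z ω, fun u => R u ω))
      (f := fun p : ℝ × (T → ℝ) => B.indicator (fun _ => (1 : ENNReal)) (Φ (p.1 + v, p.2)))
      hFs hZR,
    hmap, hlawZ, lintegral_prod_symm' _ (by fun_prop), lintegral_prod_symm' _ hFs,
    ← lintegral_const_mul _ (by
      exact hFs.lintegral_prod_left')]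
  congr 1
  ext r
  rw [lintegral_mul_exp_gaussianReal hv0
    (F := fun z => B.indicator (fun _ => (1 : ENNReal)) (Φ (z, r)))
    (hFm.comp (measurable_id.prodMk measurable_const)), hvV]

end IsCentredGaussian

/-! ### Jointly measurable versions of mollified fields -/

theorem measurableSet_innerDomain {d : ℕ} {D : Set (Euc d)} (hD : IsOpen D) (ε : ℝ) :
    MeasurableSet (innerDomain D ε) :=
  hD.measurableSet.inter (measurableSet_lt measurable_const measurable_infEDist)

/-- At a fixed scale, a continuous version of the mollified field coincides, almost surely and
simultaneously for all points, with a field that is jointly measurable in the point and in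
`ω`. -/
theorem IsMollifiedField.exists_measurable_version {d : ℕ} {Ω : Type*} [MeasurableSpace Ω]
    {P : Measure Ω} {D : Set (Euc d)} (hD : IsOpen D) {X : TestFun D → Ω → ℝ}
    (hX : ∀ φ, Measurable (X φ)) {θ : Mollifier d} {Xc : ℝ → Euc d → Ω → ℝ}
    (h : IsMollifiedField P X θ Xc) {ε : ℝ} (hε : ε ∈ Ioc (0 : ℝ) 1) :
    ∃ U : Euc d → Ω → ℝ, Measurable (Function.uncurry U) ∧
      (∀ᵐ ω ∂P, ∀ x ∈ innerDomain D ε, U x ω = Xc ε x ω) ∧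
      ∀ (x : Euc d) (hx : (ε, x) ∈ mollDomain D), U x =ᵐ[P] X (θ.testFun ε x hx) := by
  classical
  have hmem : ∀ x : innerDomain D ε, (ε, (x : Euc d)) ∈ mollDomain D := fun x => ⟨hε, x.2⟩
  obtain ⟨Q, hQc, hQd⟩ := TopologicalSpace.exists_countable_dense (innerDomain D ε)
  have hae : ∀ᵐ ω ∂P, ContinuousOn (fun p : ℝ × Euc d => Xc p.1 p.2 ω) (mollDomain D) ∧
      ∀ x ∈ Q, Xc ε x ω = X (θ.testFun ε x (hmem x)) ω :=
    h.continuous.and ((ae_ball_iff hQc).2 fun x _ => h.version ε x (hmem x))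
  -- the exceptional null set need not be measurable; it is enlarged to a measurable one, off which
  -- the field is a continuous function of the point, with measurable values on a dense set
  set Ω₁ : Set Ω := (toMeasurable P {ω | ¬ (ContinuousOn (fun p : ℝ × Euc d => Xc p.1 p.2 ω)
    (mollDomain D) ∧ ∀ x ∈ Q, Xc ε x ω = X (θ.testFun ε x (hmem x)) ω)})ᶜ with hΩ₁
  have hΩ₁m : MeasurableSet Ω₁ := (measurableSet_toMeasurable _ _).compl
  have hΩ₁p : ∀ ω ∈ Ω₁, ContinuousOn (fun p : ℝ × Euc d => Xc p.1 p.2 ω) (mollDomain D) ∧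
      ∀ x ∈ Q, Xc ε x ω = X (θ.testFun ε x (hmem x)) ω := by
    intro ω hω
    by_contra hcon
    exact hω (subset_toMeasurable P _ hcon)
  have hΩ₁ae : ∀ᵐ ω ∂P, ω ∈ Ω₁ := by
    rw [ae_iff]
    simp only [hΩ₁, mem_compl_iff, not_not]
    exact (measure_toMeasurable _).trans hae
  set u : innerDomain D ε → Ω → ℝ := fun x => Ω₁.indicator (Xc ε x) with hu
  have hucont : ∀ ω, Continuous fun x => u x ω := by
    intro ω
    by_cases hω : ω ∈ Ω₁
    · simp only [hu, indicator_of_mem hω]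
      exact (hΩ₁p ω hω).1.comp_continuous
        (f := fun x : innerDomain D ε => (ε, (x : Euc d))) (by fun_prop) hmem
    · simp only [hu, indicator_of_notMem hω]
      exact continuous_const
  have humQ : ∀ x ∈ Q, Measurable (u x) := by
    intro x hx
    have h1 : u x = Ω₁.indicator (X (θ.testFun ε x (hmem x))) := by
      ext ω
      by_cases hω : ω ∈ Ω₁
      · simp only [hu, indicator_of_mem hω]
        exact (hΩ₁p ω hω).2 x hx
      · simp only [hu, indicator_of_notMem hω]
    rw [h1]
    exact (hX _).indicator hΩ₁m
  have hum : ∀ x, Measurable (u x) := by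
    intro x
    obtain ⟨s, hs, hsx⟩ := mem_closure_iff_seq_limit.1 (hQd x)
    refine measurable_of_tendsto_metrizable (f := fun n => u (s n)) (fun n => humQ _ (hs n)) ?_
    rw [tendsto_pi_nhds]
    exact fun ω => ((hucont ω).tendsto x).comp hsx
  have hjoint : Measurable (Function.uncurry u) :=
    measurable_uncurry_of_continuous_of_measurable hucont hum
  refine ⟨fun x ω => if hx : x ∈ innerDomain D ε then u ⟨x, hx⟩ ω else 0, ?_, ?_, ?_⟩
  · have hs : MeasurableSet {p : Euc d × Ω | p.1 ∈ innerDomain D ε} :=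
      measurable_fst (measurableSet_innerDomain hD ε)
    refine measurable_of_restrict_of_restrict_compl hs ?_ ?_
    · have h1 : Measurable (fun p : {p : Euc d × Ω | p.1 ∈ innerDomain D ε} =>
          ((⟨p.1.1, p.2⟩ : innerDomain D ε), p.1.2)) :=
        (Measurable.subtype_mk (measurable_fst.comp measurable_subtype_coe)).prodMk
          (measurable_snd.comp measurable_subtype_coe)
      convert! hjoint.comp h1 using 1
      ext p
      have hp : p.1.1 ∈ innerDomain D ε := p.2
      simp [Function.uncurry, hp]
    · convert! measurable_const (a := (0 : ℝ)) using 1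
      ext p
      have hp : p.1.1 ∉ innerDomain D ε := p.2
      simp [Function.uncurry, hp]
  · filter_upwards [hΩ₁ae] with ω hω x hx
    simp [hu, hx, indicator_of_mem hω]
  · intro x hx
    filter_upwards [hΩ₁ae, h.version ε x hx] with ω hω hω2
    have hx' : x ∈ innerDomain D ε := hx.2
    simp [hu, hx', indicator_of_mem hω, hω2]

/-! ### Second moments of random integrals -/

/-- The second moment of a random integral is at most the double integral of the absolute values
of the correlations of the integrand. -/
theorem lintegral_sq_integral_le {E Ω : Type*} [MeasurableSpace E] [MeasurableSpace Ω]
    {μ : Measure E} [IsFiniteMeasure μ] {P : Measure Ω} [IsProbabilityMeasure P]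
    {F : E → Ω → ℂ} (hF : Measurable (Function.uncurry F))
    (hF2 : ∫⁻ p, ‖Function.uncurry F p‖ₑ ^ 2 ∂(μ.prod P) ≠ ⊤) :
    ∫⁻ ω, ‖∫ x, F x ω ∂μ‖ₑ ^ 2 ∂P
      ≤ ∫⁻ p, ‖∫ ω, F p.1 ω * (starRingEnd ℂ) (F p.2 ω) ∂P‖ₑ ∂(μ.prod μ) := by
  set G : Ω × (E × E) → ℂ := fun q => F q.2.1 q.1 * (starRingEnd ℂ) (F q.2.2 q.1) with hG
  have hm1 : Measurable (fun q : Ω × (E × E) => F q.2.1 q.1) :=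
    hF.comp (g := Function.uncurry F) (f := fun q : Ω × (E × E) => (q.2.1, q.1)) (by fun_prop)
  have hm2 : Measurable (fun q : Ω × (E × E) => F q.2.2 q.1) :=
    hF.comp (g := Function.uncurry F) (f := fun q : Ω × (E × E) => (q.2.2, q.1)) (by fun_prop)
  have hGm : Measurable G := hm1.mul (Complex.continuous_conj.measurable.comp hm2)
  have hF2' : ∫⁻ ω, ∫⁻ x, ‖F x ω‖ₑ ^ 2 ∂μ ∂P ≠ ⊤ := by
    rw [lintegral_prod_symm' _ (by fun_prop)] at hF2
    exact hF2
  have hFω : ∀ ω, Measurable fun x => F x ω := fun ω =>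
    hF.comp (g := Function.uncurry F) (f := fun x : E => (x, ω)) (by fun_prop)
  have hGi : Integrable G (P.prod (μ.prod μ)) := by
    refine ⟨hGm.aestronglyMeasurable, ?_⟩
    rw [HasFiniteIntegral, lintegral_prod _ (by fun_prop)]
    have hle : ∀ ω, ∫⁻ p : E × E, ‖G (ω, p)‖ₑ ∂(μ.prod μ)
        ≤ 2 * (μ univ * ∫⁻ x, ‖F x ω‖ₑ ^ 2 ∂μ) := by
      intro ω
      have h1 : ∀ p : E × E, ‖G (ω, p)‖ₑ ≤ ‖F p.1 ω‖ₑ ^ 2 + ‖F p.2 ω‖ₑ ^ 2 := by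
        intro p
        simp only [hG, enorm_mul, RCLike.enorm_conj]
        rcases le_total ‖F p.1 ω‖ₑ ‖F p.2 ω‖ₑ with h | h
        · exact (mul_le_mul_left h _).trans (by rw [← sq]; exact le_add_self)
        · exact (mul_le_mul_right h _).trans (by rw [← sq]; exact le_self_add)
      refine (lintegral_mono h1).trans ?_
      have hm : Measurable fun x => ‖F x ω‖ₑ ^ 2 := by
        have := hFω ω
        fun_prop
      rw [lintegral_add_left (by fun_prop), lintegral_prod _ (by fun_prop),
        lintegral_prod _ (by fun_prop)]
      simp only [lintegral_const, lintegral_mul_const _ hm]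
      rw [two_mul]
      exact add_le_add (by rw [mul_comm]) (by rw [mul_comm])
    refine (lintegral_mono hle).trans_lt ?_
    have hm : Measurable fun ω => ∫⁻ x, ‖F x ω‖ₑ ^ 2 ∂μ :=
      Measurable.lintegral_prod_left' (f := fun p : E × Ω => ‖F p.1 p.2‖ₑ ^ 2)
        ((hF.enorm).pow_const 2)
    rw [lintegral_const_mul _ (by fun_prop), lintegral_const_mul _ hm]
    exact ENNReal.mul_lt_top (by simp) (ENNReal.mul_lt_top (measure_lt_top μ univ) hF2'.lt_top)
  have hprod : ∀ ω, ∫ p, G (ω, p) ∂(μ.prod μ) = ((‖∫ x, F x ω ∂μ‖ ^ 2 : ℝ) : ℂ) := by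
    intro ω
    simp only [hG]
    rw [integral_prod_mul (fun x => F x ω) (fun y => (starRingEnd ℂ) (F y ω)), integral_conj,
      Complex.mul_conj, Complex.normSq_eq_norm_sq]
  have hsq : Integrable (fun ω => ‖∫ x, F x ω ∂μ‖ ^ 2) P := by
    have h := hGi.integral_prod_left
    simp only [hprod] at h
    exact h.re.congr (Eventually.of_forall fun ω => Complex.ofReal_re _)
  have hlhs : ∫⁻ ω, ‖∫ x, F x ω ∂μ‖ₑ ^ 2 ∂P
      = ‖∫ p, ∫ ω, G (ω, p) ∂P ∂(μ.prod μ)‖ₑ := by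
    rw [← integral_integral_swap (f := fun ω p => G (ω, p)) hGi]
    simp only [hprod]
    rw [integral_complex_ofReal]
    have h0 : 0 ≤ ∫ ω, ‖∫ x, F x ω ∂μ‖ ^ 2 ∂P := integral_nonneg fun _ => sq_nonneg _
    rw [← ofReal_norm, Complex.norm_real, Real.norm_of_nonneg h0,
      ofReal_integral_eq_lintegral_ofReal hsq (Eventually.of_forall fun _ => sq_nonneg _)]
    congr 1
    ext ω
    rw [ENNReal.ofReal_pow (norm_nonneg _), ofReal_norm]
  rw [hlhs]
  exact enorm_integral_le_lintegral_enorm _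

/-! ### Correlations of complex Wick exponentials -/

/-- The complex Wick exponential `exp (α x + i β y + (β² - α²) κ / 2)`. -/
def wick (α β κ x y : ℝ) : ℂ :=
  Complex.exp ((α : ℂ) * (x : ℂ) + Complex.I * (β : ℂ) * (y : ℂ)
    + ((β : ℂ) ^ 2 - (α : ℂ) ^ 2) / 2 * (κ : ℂ))

theorem norm_wick_sq (α β κ x y : ℝ) :
    ‖wick α β κ x y‖ ^ 2 = Real.exp ((β ^ 2 - α ^ 2) * κ) * Real.exp (2 * α * x) := by
  rw [wick, Complex.norm_exp, ← Real.exp_nat_mul, ← Real.exp_add]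
  congr 1
  have h : ((α : ℂ) * (x : ℂ) + Complex.I * (β : ℂ) * (y : ℂ)
    + ((β : ℂ) ^ 2 - (α : ℂ) ^ 2) / 2 * (κ : ℂ))
      = ((α * x + (β ^ 2 - α ^ 2) / 2 * κ : ℝ) : ℂ) + ((β * y : ℝ) : ℂ) * Complex.I := by
    push_cast; ring
  rw [h]
  simp only [Complex.add_re, Complex.ofReal_re, Complex.mul_re, Complex.I_re, Complex.I_im,
    Complex.ofReal_im]
  push_cast
  ring

theorem wick_mul_conj (α β κ κ' x x' y y' : ℝ) :
    wick α β κ x y * (starRingEnd ℂ) (wick α β κ' x' y')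
      = ((Real.exp ((β ^ 2 - α ^ 2) / 2 * (κ + κ')) : ℝ) : ℂ)
        * (((Real.exp (α * x + α * x') : ℝ) : ℂ)
          * Complex.exp (Complex.I * ((β * y - β * y' : ℝ) : ℂ))) := by
  rw [wick, wick, ← Complex.exp_conj, ← Complex.exp_add, Complex.ofReal_exp, Complex.ofReal_exp,
    ← Complex.exp_add, ← Complex.exp_add]
  congr 1
  simp only [map_add, map_mul, map_div₀, map_sub, map_pow, Complex.conj_ofReal, Complex.conj_I,
    map_ofNat]
  push_cast
  ring

@[fun_prop]
theorem continuous_wick (α β : ℝ) :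
    Continuous fun p : ℝ × ℝ × ℝ => wick α β p.1 p.2.1 p.2.2 := by
  unfold wick
  fun_prop

section Gram

variable {Ω T : Type*} [MeasurableSpace Ω] {P : Measure Ω} {X Y : T → Ω → ℝ} {c : T → T → ℝ}

/-- Correlation of two Wick exponentials restricted to an event of the field `X`: the
imaginary part contributes through a characteristic function, the real part through the
Cameron–Martin shift. -/
theorem integral_wick_mul_conj [IsProbabilityMeasure P] (hX : IsCentredGaussian P X c)
    (hY : IsCentredGaussian P Y c) (hXY : IndepFun (fun ω u => X u ω) (fun ω u => Y u ω) P)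
    (s t : T) (α β : ℝ) {B : Set (T → ℝ)} (hB : MeasurableSet B) :
    ∫ ω, B.indicator (fun _ => (1 : ℂ)) (fun u => X u ω) * (wick α β (c s s) (X s ω) (Y s ω)
        * (starRingEnd ℂ) (wick α β (c t t) (X t ω) (Y t ω))) ∂P
      = ((Real.exp ((α ^ 2 + β ^ 2) * c s t)
          * P.real {ω | (fun u => X u ω + (α * c s u + α * c t u)) ∈ B} : ℝ) : ℂ) := by
  have hXm : Measurable (fun ω u => X u ω) := measurable_pi_iff.2 hX.measurable
  have hYm : Measurable (fun ω u => Y u ω) := measurable_pi_iff.2 hY.measurable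
  set F : (T → ℝ) → ℂ := fun g =>
    B.indicator (fun _ => (1 : ℂ)) g * ((Real.exp (α * g s + α * g t) : ℝ) : ℂ) with hF
  set G : (T → ℝ) → ℂ := fun g =>
    Complex.exp (Complex.I * ((β * g s - β * g t : ℝ) : ℂ)) with hG
  have hFm : Measurable F := by
    refine (measurable_const.indicator hB).mul (Complex.measurable_ofReal.comp ?_)
    fun_prop
  have hGm : Measurable G := by
    refine Complex.measurable_exp.comp (measurable_const.mul (Complex.measurable_ofReal.comp ?_))
    fun_prop
  have h1 : ∀ ω, B.indicator (fun _ => (1 : ℂ)) (fun u => X u ω)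
        * (wick α β (c s s) (X s ω) (Y s ω)
        * (starRingEnd ℂ) (wick α β (c t t) (X t ω) (Y t ω)))
      = ((Real.exp ((β ^ 2 - α ^ 2) / 2 * (c s s + c t t)) : ℝ) : ℂ)
        * (F (fun u => X u ω) * G (fun u => Y u ω)) := by
    intro ω
    rw [wick_mul_conj]
    simp only [hF, hG]
    ring
  simp only [h1]
  rw [integral_const_mul, hXY.integral_fun_comp_mul_comp hXm.aemeasurable hYm.aemeasurable
    hFm.aestronglyMeasurable hGm.aestronglyMeasurable]
  have hA : MeasurableSet {ω | (fun u => X u ω) ∈ B} := hXm hB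
  have h2 : ∫ ω, F (fun u => X u ω) ∂P
      = ((Real.exp ((α ^ 2 * c s s + α ^ 2 * c t t) / 2 + α * α * c s t)
        * P.real {ω | (fun u => X u ω + (α * c s u + α * c t u)) ∈ B} : ℝ) : ℂ) := by
    have h3 : ∀ ω, F (fun u => X u ω) = ((({ω | (fun u => X u ω) ∈ B}).indicator
        (fun ω => Real.exp (α * X s ω + α * X t ω)) ω : ℝ) : ℂ) := by
      intro ω
      by_cases h : (fun u => X u ω) ∈ B
      · simp [hF, indicator, h]
      · simp [hF, indicator, h]
    simp only [h3]
    have hsm : Measurable (fun ω => Real.exp (α * X s ω + α * X t ω)) :=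
      (((hX.measurable s).const_mul α).add ((hX.measurable t).const_mul α)).exp
    rw [integral_complex_ofReal, integral_indicator hA,
      integral_eq_lintegral_of_nonneg_ae (Eventually.of_forall fun _ => (Real.exp_pos _).le)
        hsm.aestronglyMeasurable, hX.cameronMartin s t α α hB, ENNReal.toReal_mul,
      ENNReal.toReal_ofReal (Real.exp_pos _).le]
    rfl
  have h4 : ∫ ω, G (fun u => Y u ω) ∂P
      = ((Real.exp (-(β ^ 2 * (c s s + c t t - 2 * c s t)) / 2) : ℝ) : ℂ) :=
    hY.integral_cexp_sub s t β
  rw [h2, h4]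
  norm_cast
  rw [← mul_assoc, ← mul_assoc, ← Real.exp_add, mul_right_comm (Real.exp _), ← Real.exp_add]
  congr 2
  ring

/-- Chernoff bound for the lower tail. -/
theorem IsCentredGaussian.measureReal_le_le [IsProbabilityMeasure P]
    (hX : IsCentredGaussian P X c) (w : T) {σ : ℝ} (hσ : 0 ≤ σ) (τ : ℝ) :
    P.real {ω | X w ω ≤ τ} ≤ Real.exp (σ * τ + σ ^ 2 / 2 * c w w) := by
  have h1 := hX.integral_exp_comb w w w (-σ) 0 0
  have h2 := hX.integrable_exp_comb w w w (-σ) 0 0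
  simp only [zero_mul, add_zero] at h1 h2
  have h := measure_le_le_exp_mul_mgf (X := X w) (μ := P) τ (t := -σ) (by linarith) h2
  refine h.trans (le_of_eq ?_)
  rw [mgf, h1, ← Real.exp_add]
  congr 1
  ring

/-- Chernoff bound for the upper tail. -/
theorem IsCentredGaussian.measureReal_lt_le [IsProbabilityMeasure P]
    (hX : IsCentredGaussian P X c) (w : T) {σ : ℝ} (hσ : 0 ≤ σ) (τ : ℝ) :
    P.real {ω | τ < X w ω} ≤ Real.exp (-(σ * τ) + σ ^ 2 / 2 * c w w) := by
  have h1 := hX.integral_exp_comb w w w σ 0 0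
  have h2 := hX.integrable_exp_comb w w w σ 0 0
  simp only [zero_mul, add_zero] at h1 h2
  have h := measure_ge_le_exp_mul_mgf (X := X w) (μ := P) τ hσ h2
  refine (measureReal_mono (fun ω (hω : τ < X w ω) => hω.le)).trans (h.trans (le_of_eq ?_))
  rw [mgf, h1, ← Real.exp_add]
  congr 1
  ring

/-- Under a family of shifts converging pointwise, growing in `k` at most like `a k` with
`a < lam`, the event that a sequence of Gaussian variables stays below the barrier `lam k + q` is
almost surely eventually decided by the limiting shift. -/
theorem IsCentredGaussian.ae_eventually_barrier_iff [IsProbabilityMeasure P]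
    (hX : IsCentredGaussian P X c) {ι : Type*} {l : Filter ι} [l.NeBot] (w : ℕ → T) (k0 : ℕ)
    {C lam q a m : ℝ} (hlam : a < lam) (hvar : ∀ k ≥ k0, c (w k) (w k) ≤ k + C)
    (hpos : ∀ k ≥ k0, 0 < c (w k) (w k)) {b : ι → ℕ → ℝ} {b' : ℕ → ℝ}
    (hb : ∀ k ≥ k0, Tendsto (fun i => b i k) l (𝓝 (b' k)))
    (hbm : ∀ᶠ i in l, ∀ k ≥ k0, b i k ≤ a * k + m) :
    ∀ᵐ ω ∂P, ∀ᶠ i in l, (∀ k ≥ k0, X (w k) ω + b i k ≤ lam * k + q) ↔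
      (∀ k ≥ k0, X (w k) ω + b' k ≤ lam * k + q) := by
  have hbm' : ∀ k ≥ k0, b' k ≤ a * k + m := fun k hk =>
    le_of_tendsto (hb k hk) (hbm.mono fun i hi => hi k hk)
  set s : ℕ → Set Ω := fun k =>
    {ω | k ≥ k0 ∧ (lam - a) * k + (q - m) < X (w k) ω} with hs
  -- by Borel–Cantelli, all but finitely many of the constraints hold for every admissible shift
  have hsum : ∑' k, P (s k) ≠ ⊤ := by
    have hle : ∀ k, P (s k) ≤ ENNReal.ofReal (Real.exp (-((lam - a) * (q - m))
        + (lam - a) ^ 2 / 2 * C) * Real.exp (-((lam - a) ^ 2 / 2)) ^ k) := by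
      intro k
      by_cases hk : k ≥ k0
      · have h1 : s k = {ω | (lam - a) * k + (q - m) < X (w k) ω} := by simp [hs, hk]
        rw [h1, ← ofReal_measureReal]
        refine ENNReal.ofReal_le_ofReal ((hX.measureReal_lt_le (w k)
          (σ := lam - a) (by linarith) _).trans ?_)
        rw [← Real.exp_nat_mul, ← Real.exp_add]
        refine Real.exp_le_exp.2 ?_
        have h2 := mul_le_mul_of_nonneg_left (hvar k hk) (by positivity : 0 ≤ (lam - a) ^ 2 / 2)
        linarith
      · have h1 : s k = ∅ := by simp [hs, hk]
        simp [h1]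
    refine ne_top_of_le_ne_top ?_ (ENNReal.tsum_le_tsum hle)
    have hsm : Summable fun k : ℕ => Real.exp (-((lam - a) * (q - m))
        + (lam - a) ^ 2 / 2 * C) * Real.exp (-((lam - a) ^ 2 / 2)) ^ k := by
      refine (summable_geometric_of_lt_one (Real.exp_pos _).le ?_).mul_left _
      have : 0 < lam - a := by linarith
      exact Real.exp_lt_one_iff.2 (by linarith [pow_pos this 2])
    exact hsm.tsum_ofReal_ne_top
  have hBC := ae_eventually_notMem hsum
  -- none of the limiting constraints is an equality, so each is decided near the limit
  have hne : ∀ᵐ ω ∂P, ∀ k ≥ k0, X (w k) ω ≠ lam * k + q - b' k := by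
    refine ae_all_iff.2 fun k => ?_
    by_cases hk : k ≥ k0
    · have h1 := measure_eq_zero_of_gaussian (hX.gaussian.hasGaussianLaw_eval (w k))
        (hX.centred _) (by
          have h := hX.covariance (w k) (w k)
          simp only [← sq] at h
          rw [h]
          exact hpos k hk) (lam * k + q - b' k)
      have h2 : ∀ᵐ ω ∂P, X (w k) ω ≠ lam * k + q - b' k := by simpa [ae_iff] using h1
      filter_upwards [h2] with ω hω _ using hω
    · exact Eventually.of_forall fun ω h => absurd h hk
  filter_upwards [hBC, hne] with ω hω1 hω2
  obtain ⟨k1, hk1⟩ := eventually_atTop.1 hω1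
  have htail : ∀ k ≥ k1, k ≥ k0 → X (w k) ω + (a * k + m) ≤ lam * k + q := by
    intro k hk hk0
    have h1 : ¬ (k ≥ k0 ∧ (lam - a) * k + (q - m) < X (w k) ω) := hk1 k hk
    have h2 := not_lt.1 fun h => h1 ⟨hk0, h⟩
    linarith
  have hfin : ∀ᶠ i in l, ∀ k ∈ Finset.Ico k0 k1,
      (X (w k) ω + b i k ≤ lam * k + q ↔ X (w k) ω + b' k ≤ lam * k + q) := by
    refine (Finset.eventually_all _).2 fun k hk => ?_
    have hk0 : k ≥ k0 := (Finset.mem_Ico.1 hk).1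
    have hne' : X (w k) ω + b' k ≠ lam * k + q := fun h => hω2 k hk0 (by linarith)
    have ht := (hb k hk0).const_add (X (w k) ω)
    rcases lt_or_gt_of_ne hne' with h | h
    · filter_upwards [ht.eventually_lt_const h] with i hi using iff_of_true hi.le h.le
    · filter_upwards [ht.eventually_const_lt h] with i hi using iff_of_false hi.not_ge h.not_ge
  filter_upwards [hfin, hbm] with i hi hi2
  constructor
  · intro hall k hk
    by_cases hkk : k < k1
    · exact (hi k (Finset.mem_Ico.2 ⟨hk, hkk⟩)).1 (hall k hk)
    · linarith [htail k (not_lt.1 hkk) hk, hbm' k hk]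
  · intro hall k hk
    by_cases hkk : k < k1
    · exact (hi k (Finset.mem_Ico.2 ⟨hk, hkk⟩)).2 (hall k hk)
    · linarith [htail k (not_lt.1 hkk) hk, hi2 k hk]

end Gram

/-! ### The grid of scale `e⁻ᵏ` -/

/-- The index of the cell, in the cubic grid of mesh `e⁻ᵏ`, that contains `x`. -/
def gridIdx {d : ℕ} (k : ℕ) (x : Euc d) : Fin d → ℤ := fun i => ⌊x i * Real.exp k⌋

/-- The corner of the cell with index `n` in the cubic grid of mesh `e⁻ᵏ`. -/
def gridPt {d : ℕ} (k : ℕ) (n : Fin d → ℤ) : Euc d :=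
  WithLp.toLp 2 fun i => (n i : ℝ) * Real.exp (-k)

theorem dist_gridPt_le {d : ℕ} (k : ℕ) (x : Euc d) :
    dist (gridPt k (gridIdx k x)) x ≤ √d * Real.exp (-k) := by
  have hi : ∀ i, dist (gridPt k (gridIdx k x) i) (x i) ^ 2 ≤ Real.exp (-k) ^ 2 := by
    intro i
    have he : Real.exp k * Real.exp (-k) = 1 := by rw [← Real.exp_add]; simp
    have h1 := Int.floor_le (x i * Real.exp k)
    have h2 := Int.lt_floor_add_one (x i * Real.exp k)
    have h3 : x i = x i * Real.exp k * Real.exp (-k) := by rw [mul_assoc, he, mul_one]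
    have hpos := Real.exp_pos (-(k : ℝ))
    refine pow_le_pow_left₀ dist_nonneg ?_ 2
    have h4 : gridPt k (gridIdx k x) i = (⌊x i * Real.exp k⌋ : ℝ) * Real.exp (-k) := rfl
    rw [Real.dist_eq, abs_le, h4]
    constructor
    · nlinarith
    · nlinarith
  rw [EuclideanSpace.dist_eq]
  calc √(∑ i, dist (gridPt k (gridIdx k x) i) (x i) ^ 2)
      ≤ √(∑ _i : Fin d, Real.exp (-k) ^ 2) := Real.sqrt_le_sqrt (Finset.sum_le_sum fun i _ => hi i)
    _ = √d * Real.exp (-k) := by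
      rw [Finset.sum_const, Finset.card_univ, Fintype.card_fin, nsmul_eq_mul,
        Real.sqrt_mul (Nat.cast_nonneg _), Real.sqrt_sq (Real.exp_pos _).le]

theorem measurable_gridIdx {d : ℕ} (k : ℕ) : Measurable (gridIdx (d := d) k) := by
  refine measurable_pi_iff.2 fun i => ?_
  have : Measurable fun x : Euc d => x i * Real.exp k := by fun_prop
  exact this.floor

/-- The number of cells of mesh `e⁻ᵏ` meeting a bounded set is `O(e^{dk})`. -/
theorem exists_gridIdx_card {d : ℕ} {S : Set (Euc d)} (hS : IsCompact S) :
    ∃ A : ℝ, 0 ≤ A ∧ ∀ k : ℕ, ∃ I : Finset (Fin d → ℤ), gridIdx k '' S ⊆ I ∧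
      (I.card : ℝ) ≤ (A * Real.exp k) ^ d := by
  obtain ⟨B, hB⟩ := hS.isBounded.exists_norm_le
  refine ⟨2 * |B| + 5, by positivity, fun k => ?_⟩
  set m : ℕ := ⌈(|B| + 1) * Real.exp k⌉₊ with hm
  have hk1 : 1 ≤ Real.exp k := Real.one_le_exp (Nat.cast_nonneg k)
  have hm1 : (|B| + 1) * Real.exp k ≤ m := Nat.le_ceil _
  have hm2 : (m : ℝ) < (|B| + 1) * Real.exp k + 1 := Nat.ceil_lt_add_one (by positivity)
  refine ⟨Fintype.piFinset fun _ => Finset.Icc (-(m : ℤ)) m, ?_, ?_⟩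
  · rintro _ ⟨x, hx, rfl⟩
    simp only [Finset.mem_coe, Fintype.mem_piFinset, Finset.mem_Icc]
    intro i
    have h1 : |x i| ≤ |B| := ((PiLp.norm_apply_le x i).trans (hB x hx)).trans (le_abs_self B)
    have h2 : |x i * Real.exp k| ≤ |B| * Real.exp k := by
      rw [abs_mul, abs_of_pos (Real.exp_pos _)]
      exact mul_le_mul_of_nonneg_right h1 (Real.exp_pos _).le
    have h3 := abs_le.1 h2
    constructor
    · refine Int.le_floor.2 ?_
      push_cast
      linarith
    · refine Int.floor_le_iff.2 ?_
      push_cast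
      linarith
  · rw [Fintype.card_piFinset]
    simp only [Finset.prod_const, Finset.card_univ, Fintype.card_fin, Int.card_Icc]
    push_cast
    refine pow_le_pow_left₀ (Nat.cast_nonneg _) ?_ d
    have h4 : ((m : ℤ) + 1 - -(m : ℤ)).toNat = 2 * m + 1 := by omega
    rw [h4]
    push_cast
    linarith

/-! ### Correlations of the truncated chaos -/

/-- The covariance estimates satisfied by two families of approximations `φ false`, `φ true` of
the field at the points of `S` (and of its neighbourhood `S₁`): logarithmic bounds, and
convergence as the scales go to `0`. -/
structure CovData {d : ℕ} {T : Type*} (c : T → T → ℝ) (S S₁ : Set (Euc d)) (δ C : ℝ)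
    (φ : Bool → ℝ → Euc d → T) (κ : Euc d → Euc d → ℝ) (h : T → Euc d → ℝ) : Prop where
  compact : IsCompact S
  thick : ∀ x ∈ S, ∀ z, dist z x ≤ δ → z ∈ S₁
  pos : 0 < δ
  nonneg : 0 ≤ C
  lower : ∀ i j, ∀ ε ∈ Ioc 0 δ, ∀ ε' ∈ Ioc 0 δ, ∀ x ∈ S₁, ∀ y ∈ S₁,
    Real.log (1 / (ε + ε' + dist x y)) - C ≤ c (φ i ε x) (φ j ε' y)
  upper : ∀ i j, ∀ ε ∈ Ioc 0 δ, ∀ ε' ∈ Ioc 0 δ, ∀ x ∈ S₁, ∀ y ∈ S₁,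
    c (φ i ε x) (φ j ε' y) ≤ Real.log (1 / max (max ε ε') (dist x y)) + C
  tendsto_ne : ∀ i j, ∀ x ∈ S, ∀ y ∈ S, x ≠ y →
    Tendsto (fun p : ℝ × ℝ => c (φ i p.1 x) (φ j p.2 y)) (𝓝[>] 0 ×ˢ 𝓝[>] 0) (𝓝 (κ x y))
  tendsto_potential : ∀ i, ∀ x ∈ S, ∀ u,
    Tendsto (fun ε : ℝ => c (φ i ε x) u) (𝓝[>] 0) (𝓝 (h u x))

/-- Admissible parameters: `lam` is the slope of the barrier, `σ` the exponent used in the Chernoff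
bound for the tilted field, and `γ` the resulting exponent of the singularity of the
correlations. For `γ < d` the singularity is integrable, `σ < √(2d)` makes the barrier removable,
and `lam > √(2d)` makes exceedances rare. -/
structure IsAdmissible (d : ℕ) (α β lam σ γ : ℝ) : Prop where
  alpha_nonneg : 0 ≤ α
  alpha_lt : α < lam
  lt_lam : √(2 * d) < lam
  sigma_nonneg : 0 ≤ σ
  sigma_lt : σ < √(2 * d)
  le_gamma : α ^ 2 + β ^ 2 + σ * lam - 2 * σ * α + σ ^ 2 / 2 ≤ γ
  gamma_nonneg : 0 ≤ γ
  gamma_lt : γ < d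

/-- In the subcritical phase admissible parameters exist: no Chernoff bound is needed in the disc
`α² + β² < d`, and `σ = 2α - lam` with `lam` slightly above `√(2d)` works in the rest. -/
theorem exists_isAdmissible {d : ℕ} {α β : ℝ} (h : (α, β) ∈ subcritical d) (hα : 0 ≤ α) :
    ∃ lam σ γ, IsAdmissible d α β lam σ γ := by
  rcases h with h | ⟨⟨h1, h2⟩, h3⟩
  · simp only [mem_ofPred_eq] at h
    have hd : (0 : ℝ) < d := by nlinarith
    have hs : 0 < √(2 * (d : ℝ)) := Real.sqrt_pos.2 (by linarith)
    have hss : √(2 * (d : ℝ)) ^ 2 = 2 * d := Real.sq_sqrt (by linarith)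
    refine ⟨√(2 * d) + 1, 0, α ^ 2 + β ^ 2, hα, ?_, by linarith, le_rfl, hs, by simp,
      by positivity, h⟩
    nlinarith [sq_nonneg β]
  · simp only [abs_of_nonneg hα] at h1 h2 h3
    set u := √(2 * (d : ℝ)) with hu
    have hupos : 0 < u := hα.trans_lt h2
    have hd : (0 : ℝ) < d := by
      have := Real.sqrt_pos.1 hupos
      linarith
    have huu : u ^ 2 = 2 * d := Real.sq_sqrt (by linarith)
    have h1' : u < 2 * α := by
      have h4 : u = 2 * √((d : ℝ) / 2) := by
        rw [hu, show (2 * (d : ℝ)) = 2 ^ 2 * (d / 2) by ring, Real.sqrt_mul (by norm_num),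
          Real.sqrt_sq (by norm_num)]
      linarith
    have h3' : β ^ 2 < (u - α) ^ 2 := by
      rw [← sq_abs β]
      exact pow_lt_pow_left₀ h3 (abs_nonneg _) two_ne_zero
    -- the exponent at `lam = u` equals `α² + β² - (2α - u)² / 2`, which is less than `d`
    have hlim : α ^ 2 + β ^ 2 - (2 * α - u) ^ 2 / 2 < d := by nlinarith
    have hcont : Tendsto (fun lam : ℝ => α ^ 2 + β ^ 2 - (2 * α - lam) ^ 2 / 2) (𝓝[>] u)
        (𝓝 (α ^ 2 + β ^ 2 - (2 * α - u) ^ 2 / 2)) := by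
      refine Tendsto.mono_left (Continuous.tendsto ?_ u) nhdsWithin_le_nhds
      fun_prop
    have hid : Tendsto (fun lam : ℝ => lam) (𝓝[>] u) (𝓝 u) := nhdsWithin_le_nhds
    obtain ⟨lam, hl1, hl2, hl3⟩ := ((hcont.eventually_lt_const hlim).and
      ((hid.eventually_lt_const h1').and self_mem_nhdsWithin)).exists
    have hl3' : u < lam := hl3
    refine ⟨lam, 2 * α - lam, max (α ^ 2 + β ^ 2 - (2 * α - lam) ^ 2 / 2) 0, hα,
      by linarith, hl3', by linarith, by linarith, ?_, le_max_right _ _, max_lt hl1 hd⟩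
    refine le_trans (le_of_eq ?_) (le_max_left _ _)
    ring

/-- The configurations that stay below the barrier `lam k + q` along the sequence `w`, from
the scale `k0` on. -/
def barrierSet {T : Type*} (lam q : ℝ) (k0 : ℕ) (w : ℕ → T) : Set (T → ℝ) :=
  {g | ∀ k ≥ k0, g (w k) ≤ lam * k + q}

theorem measurableSet_barrierSet {T : Type*} (lam q : ℝ) (k0 : ℕ) (w : ℕ → T) :
    MeasurableSet (barrierSet lam q k0 w) := by
  have : barrierSet lam q k0 w = ⋂ k, ⋂ (_ : k ≥ k0), {g : T → ℝ | g (w k) ≤ lam * k + q} := by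
    ext g
    simp [barrierSet]
  rw [this]
  exact MeasurableSet.iInter fun k => MeasurableSet.iInter fun _ =>
    measurableSet_le (measurable_pi_apply _) measurable_const

/-- The approximation of the field at scale `e⁻ᵏ` at the grid point next to `x`. -/
def refSeq {d : ℕ} {T : Type*} (φ : Bool → ℝ → Euc d → T) (x : Euc d) (k : ℕ) : T :=
  φ false (Real.exp (-k)) (gridPt k (gridIdx k x))

namespace CovData

variable {d : ℕ} {T : Type*} {c : T → T → ℝ} {S S₁ : Set (Euc d)} {δ C : ℝ}
  {φ : Bool → ℝ → Euc d → T} {κ : Euc d → Euc d → ℝ} {h : T → Euc d → ℝ}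

theorem mem (hc : CovData c S S₁ δ C φ κ h) {x : Euc d} (hx : x ∈ S) : x ∈ S₁ :=
  hc.thick x hx x (by simpa using hc.pos.le)

/-- A scale from which on the grid approximations are well inside the domain and have positive
variance. -/
theorem exists_start (hc : CovData c S S₁ δ C φ κ h) :
    ∃ k0 : ℕ, ∀ k ≥ k0, (√d + 1) * Real.exp (-k) ≤ δ ∧ Real.log 2 + C < k := by
  have h1 : Tendsto (fun k : ℕ => (√d + 1) * Real.exp (-(k : ℝ))) atTop (𝓝 ((√d + 1) * 0)) :=
    (Real.tendsto_exp_neg_atTop_nhds_zero.comp tendsto_natCast_atTop_atTop).const_mul _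
  rw [mul_zero] at h1
  have h2 := tendsto_natCast_atTop_atTop (R := ℝ).eventually_gt_atTop (Real.log 2 + C)
  exact eventually_atTop.1 ((h1.eventually_le_const hc.pos).and h2)

theorem grid (hc : CovData c S S₁ δ C φ κ h) {k : ℕ}
    (hk : (√d + 1) * Real.exp (-k) ≤ δ) {x : Euc d} (hx : x ∈ S) :
    Real.exp (-k) ∈ Ioc 0 δ ∧ gridPt k (gridIdx k x) ∈ S₁ := by
  have h1 := Real.exp_pos (-(k : ℝ))
  have h2 : 0 ≤ √(d : ℝ) * Real.exp (-k) := by positivity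
  exact ⟨⟨h1, by linarith⟩, hc.thick x hx _ ((dist_gridPt_le k x).trans (by linarith))⟩

theorem refSeq_var (hc : CovData c S S₁ δ C φ κ h) {k : ℕ}
    (hk : (√d + 1) * Real.exp (-k) ≤ δ ∧ Real.log 2 + C < k) {x : Euc d} (hx : x ∈ S) :
    0 < c (refSeq φ x k) (refSeq φ x k) ∧ c (refSeq φ x k) (refSeq φ x k) ≤ k + C := by
  obtain ⟨h1, h2⟩ := hc.grid hk.1 hx
  have hl := hc.lower false false _ h1 _ h1 _ h2 _ h2
  have hu := hc.upper false false _ h1 _ h1 _ h2 _ h2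
  have h3 : Real.log (1 / (Real.exp (-k) + Real.exp (-k) + 0)) = k - Real.log 2 := by
    rw [add_zero, ← two_mul, one_div, Real.log_inv, Real.log_mul (by norm_num) (Real.exp_pos _).ne',
      Real.log_exp]
    ring
  have h4 : Real.log (1 / max (max (Real.exp (-k)) (Real.exp (-k))) 0) = k := by
    rw [max_self, max_eq_left (Real.exp_pos _).le, one_div, Real.log_inv, Real.log_exp, neg_neg]
  rw [dist_self, h3] at hl
  rw [dist_self, h4] at hu
  exact ⟨by simp only [refSeq]; linarith [hk.2], hu⟩

/-- At the scale `e⁻ᵏ` comparable to the largest of `ε`, `ε'` and `|x - y|`, the barrier event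
compensates the correlations: the truncated correlations are at most a multiple of
`|x - y|^(-γ)`, uniformly in the scales of approximation. -/
theorem exists_truncated_le {Ω : Type*} [MeasurableSpace Ω] {P : Measure Ω}
    [IsProbabilityMeasure P] {X : T → Ω → ℝ} (hX : IsCentredGaussian P X c)
    (hc : CovData c S S₁ δ C φ κ h) {α β lam σ γ : ℝ} (hp : IsAdmissible d α β lam σ γ) {k0 : ℕ}
    (hk0 : ∀ k ≥ k0, (√d + 1) * Real.exp (-k) ≤ δ ∧ Real.log 2 + C < k) :
    ∃ M : ℝ, 0 ≤ M ∧ ∀ (q : ℝ) (i j : Bool), ∀ ε ∈ Ioc 0 δ, ∀ ε' ∈ Ioc 0 δ, ∀ x ∈ S, ∀ y ∈ S,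
      x ≠ y →
      Real.exp ((α ^ 2 + β ^ 2) * c (φ i ε x) (φ j ε' y))
        * P.real {ω | (fun u => X u ω + (α * c (φ i ε x) u + α * c (φ j ε' y) u))
          ∈ barrierSet lam q k0 (refSeq φ x) ∩ barrierSet lam q k0 (refSeq φ y)}
      ≤ M * Real.exp (σ * q) * dist x y ^ (-γ) := by
  obtain ⟨ρ, hρ1, hρ⟩ : ∃ ρ : ℝ, 1 ≤ ρ ∧ ∀ x ∈ S, ∀ y ∈ S, max δ (dist x y) ≤ ρ := by
    obtain ⟨B, hB⟩ := Metric.isBounded_iff.1 hc.compact.isBounded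
    refine ⟨max 1 (max δ B), le_max_left _ _, fun x hx y hy => ?_⟩
    exact (max_le_max le_rfl (hB hx hy)).trans (le_max_right _ _)
  have hlogρ : 0 ≤ Real.log ρ := Real.log_nonneg hρ1
  set Q : ℝ := Real.log (3 + √d) + C with hQ
  set m : ℝ := k0 + 1 + Real.log ρ with hm
  set a : ℝ := α ^ 2 + β ^ 2 + σ * lam - 2 * σ * α + σ ^ 2 / 2 with ha
  have hlam : 0 ≤ lam := (Real.sqrt_nonneg _).trans hp.lt_lam.le
  have hσ := hp.sigma_nonneg
  have hα := hp.alpha_nonneg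
  refine ⟨Real.exp ((α ^ 2 + β ^ 2) * C + σ * lam * m + 2 * α * σ * Q + σ ^ 2 / 2 * (m + C)
    + (γ - a) * Real.log ρ), (Real.exp_pos _).le, ?_⟩
  intro q i j ε hε ε' hε' x hx y hy hxy
  have hdist : 0 < dist x y := dist_pos.2 hxy
  set R : ℝ := max (max ε ε') (dist x y) with hR
  have hRpos : 0 < R := lt_max_of_lt_right hdist
  have hRρ : R ≤ ρ := (max_le_max (max_le hε.2 hε'.2) le_rfl).trans (hρ x hx y hy)
  set ℓ : ℝ := Real.log (1 / R) with hℓ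
  have hℓ0 : -Real.log ρ ≤ ℓ := by
    rw [hℓ, one_div, Real.log_inv]
    exact neg_le_neg (Real.log_le_log hRpos hRρ)
  have hℓd : ℓ ≤ -Real.log (dist x y) := by
    rw [hℓ, one_div, Real.log_inv]
    exact neg_le_neg (Real.log_le_log hdist (le_max_right _ _))
  -- the scale at which the barrier is used: `e⁻ᵏ` is comparable to `R`
  set k : ℕ := max k0 ⌈ℓ⌉₊ with hk
  have hkk0 : k ≥ k0 := le_max_left _ _
  have hkℓ : ℓ ≤ k := (Nat.le_ceil ℓ).trans (by exact_mod_cast le_max_right _ _)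
  have hkm : (k : ℝ) ≤ ℓ + m := by
    rw [hk, Nat.cast_max]
    refine max_le (by rw [hm]; linarith) ?_
    rcases le_total 0 ℓ with h0 | h0
    · linarith [Nat.ceil_lt_add_one h0, (Nat.cast_nonneg k0 : (0 : ℝ) ≤ k0)]
    · rw [Nat.ceil_eq_zero.2 h0, Nat.cast_zero]
      linarith [(Nat.cast_nonneg k0 : (0 : ℝ) ≤ k0)]
  have hrR : Real.exp (-k) ≤ R := by
    rw [← Real.exp_log hRpos]
    refine Real.exp_le_exp.2 ?_
    rw [hℓ, one_div, Real.log_inv] at hkℓ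
    linarith
  obtain ⟨hr, hz⟩ := hc.grid (hk0 k hkk0).1 hx
  set z : Euc d := gridPt k (gridIdx k x) with hzdef
  set w : T := refSeq φ x k with hw
  have hxz : dist x z ≤ √d * R := by
    rw [dist_comm]
    exact (dist_gridPt_le k x).trans (mul_le_mul_of_nonneg_left hrR (Real.sqrt_nonneg _))
  have hyz : dist y z ≤ R + √d * R :=
    (dist_triangle_left y z x).trans (add_le_add (le_max_right _ _) hxz)
  have hlow : ∀ e : ℝ, 0 < e → e ≤ R → ∀ v : Euc d, dist v z ≤ R + √d * R →
      ℓ - Q ≤ Real.log (1 / (e + Real.exp (-k) + dist v z)) - C := by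
    intro e he heR v hv
    have h1 : e + Real.exp (-k) + dist v z ≤ (3 + √d) * R := by linarith
    have h2 : 0 < e + Real.exp (-k) + dist v z := by positivity
    have h3 := Real.log_le_log h2 h1
    rw [Real.log_mul (by positivity) hRpos.ne'] at h3
    rw [hℓ, hQ, one_div, Real.log_inv, one_div, Real.log_inv]
    linarith
  have hsw : ℓ - Q ≤ c (φ i ε x) w :=
    (hlow ε hε.1 ((le_max_left _ _).trans (le_max_left _ _)) x (by linarith)).trans
      (hc.lower i false ε hε _ hr x (hc.mem hx) z hz)
  have htw : ℓ - Q ≤ c (φ j ε' y) w :=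
    (hlow ε' hε'.1 ((le_max_right _ _).trans (le_max_left _ _)) y hyz).trans
      (hc.lower j false ε' hε' _ hr y (hc.mem hy) z hz)
  have hst : c (φ i ε x) (φ j ε' y) ≤ ℓ + C := hc.upper i j ε hε ε' hε' x (hc.mem hx) y (hc.mem hy)
  have hww := (hc.refSeq_var (hk0 k hkk0) hx).2
  -- only the constraint at the scale `k` is kept; the shift there is about `2 α ℓ`
  have hprob : P.real {ω | (fun u => X u ω + (α * c (φ i ε x) u + α * c (φ j ε' y) u))
        ∈ barrierSet lam q k0 (refSeq φ x) ∩ barrierSet lam q k0 (refSeq φ y)}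
      ≤ Real.exp (σ * (lam * k + q - (α * c (φ i ε x) w + α * c (φ j ε' y) w))
        + σ ^ 2 / 2 * c w w) := by
    refine (measureReal_mono fun ω hω => ?_).trans (hX.measureReal_le_le w hσ _)
    have h1 : X w ω + (α * c (φ i ε x) w + α * c (φ j ε' y) w) ≤ lam * k + q := hω.1 k hkk0
    exact le_sub_iff_add_le.2 h1
  refine (mul_le_mul_of_nonneg_left hprob (Real.exp_pos _).le).trans ?_
  rw [Real.rpow_def_of_pos hdist, ← Real.exp_add, ← Real.exp_add, ← Real.exp_add]
  refine Real.exp_le_exp.2 ?_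
  have e1 := mul_le_mul_of_nonneg_left hst (by positivity : 0 ≤ α ^ 2 + β ^ 2)
  have e2 := mul_le_mul_of_nonneg_left hkm (mul_nonneg hσ hlam)
  have e3 := mul_le_mul_of_nonneg_left hsw (mul_nonneg hσ hα)
  have e4 := mul_le_mul_of_nonneg_left htw (mul_nonneg hσ hα)
  have e5 : σ ^ 2 / 2 * c w w ≤ σ ^ 2 / 2 * (ℓ + m + C) :=
    mul_le_mul_of_nonneg_left (hww.trans (by linarith)) (by positivity)
  have e6 : a * ℓ ≤ γ * ℓ + (γ - a) * Real.log ρ := by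
    have := mul_le_mul_of_nonneg_left hℓ0 (show 0 ≤ γ - a from sub_nonneg.2 hp.le_gamma)
    linarith
  have e7 := mul_le_mul_of_nonneg_left hℓd hp.gamma_nonneg
  have e8 : a * ℓ = (α ^ 2 + β ^ 2) * ℓ + σ * lam * ℓ - 2 * (σ * α * ℓ) + σ ^ 2 / 2 * ℓ := by
    rw [ha]; ring
  linarith

/-- Convergence of the truncated correlations off the diagonal, to a limit that does not depend
on the families of approximations. -/
theorem exists_tendsto_truncated {Ω : Type*} [MeasurableSpace Ω] {P : Measure Ω}
    [IsProbabilityMeasure P] {X : T → Ω → ℝ} (hX : IsCentredGaussian P X c)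
    (hc : CovData c S S₁ δ C φ κ h) {α β lam q : ℝ} (hα : 0 ≤ α) (hαl : α < lam) {k0 : ℕ}
    (hk0 : ∀ k ≥ k0, (√d + 1) * Real.exp (-k) ≤ δ ∧ Real.log 2 + C < k) {x y : Euc d}
    (hx : x ∈ S) (hy : y ∈ S) (hxy : x ≠ y) :
    ∃ Λ : ℝ, ∀ i j, Tendsto (fun p : ℝ × ℝ =>
      Real.exp ((α ^ 2 + β ^ 2) * c (φ i p.1 x) (φ j p.2 y))
        * P.real {ω | (fun u => X u ω + (α * c (φ i p.1 x) u + α * c (φ j p.2 y) u))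
          ∈ barrierSet lam q k0 (refSeq φ x) ∩ barrierSet lam q k0 (refSeq φ y)})
      (𝓝[>] 0 ×ˢ 𝓝[>] 0) (𝓝 Λ) := by
  set E : Set Ω := {ω | (fun u => X u ω + (α * h u x + α * h u y))
    ∈ barrierSet lam q k0 (refSeq φ x) ∩ barrierSet lam q k0 (refSeq φ y)} with hE
  refine ⟨Real.exp ((α ^ 2 + β ^ 2) * κ x y) * P.real E, fun i j => ?_⟩
  have hmeas : ∀ b : T → ℝ, MeasurableSet {ω | (fun u => X u ω + b u)
      ∈ barrierSet lam q k0 (refSeq φ x) ∩ barrierSet lam q k0 (refSeq φ y)} := fun b => by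
    have : Measurable (fun ω u => X u ω + b u) :=
      measurable_pi_iff.2 fun u => (hX.measurable u).add_const _
    exact this ((measurableSet_barrierSet _ _ _ _).inter (measurableSet_barrierSet _ _ _ _))
  refine Tendsto.mul ((Real.continuous_exp.tendsto _).comp
    ((hc.tendsto_ne i j x hx y hy hxy).const_mul _)) ?_
  have hdist : 0 < dist x y := dist_pos.2 hxy
  set m : ℝ := 2 * C + |Real.log ((1 + √d) / dist x y)| with hm
  have hsmall : ∀ᶠ ε : ℝ in 𝓝[>] 0, ε ∈ Ioc 0 δ := Ioc_mem_nhdsGT hc.pos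
  have hsmall2 : ∀ᶠ p : ℝ × ℝ in 𝓝[>] 0 ×ˢ 𝓝[>] 0, p.1 ∈ Ioc 0 δ ∧ p.2 ∈ Ioc 0 δ :=
    hsmall.prod_mk hsmall
  -- the shift of the reference variables next to `v` caused by the nearby point `v`
  have hnear : ∀ i', ∀ v ∈ S, ∀ k ≥ k0, ∀ ε ∈ Ioc 0 δ, c (φ i' ε v) (refSeq φ v k) ≤ k + C := by
    intro i' v hv k hk ε hε
    obtain ⟨hr, hz⟩ := hc.grid (hk0 k hk).1 hv
    refine (hc.upper i' false ε hε _ hr v (hc.mem hv) _ hz).trans ?_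
    have h1 : Real.exp (-k) ≤ max (max ε (Real.exp (-k))) (dist v (gridPt k (gridIdx k v))) :=
      (le_max_right _ _).trans (le_max_left _ _)
    have h2 := Real.log_le_log hr.1 h1
    rw [Real.log_exp] at h2
    rw [one_div, Real.log_inv]
    linarith
  -- the shift of the reference variables next to `v` caused by the other point `v'`
  have hfar : ∀ i', ∀ v ∈ S, ∀ v' ∈ S, dist v v' = dist x y → ∀ k ≥ k0, ∀ ε ∈ Ioc 0 δ,
      c (φ i' ε v') (refSeq φ v k) ≤ |Real.log ((1 + √d) / dist x y)| + C := by
    intro i' v hv v' hv' hvv k hk ε hε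
    obtain ⟨hr, hz⟩ := hc.grid (hk0 k hk).1 hv
    refine (hc.upper i' false ε hε _ hr v' (hc.mem hv') _ hz).trans ?_
    set z := gridPt k (gridIdx k v) with hzd
    set R := max (max ε (Real.exp (-k))) (dist v' z) with hR
    have h1 : Real.exp (-k) ≤ R := (le_max_right _ _).trans (le_max_left _ _)
    have h2 : dist v' z ≤ R := le_max_right _ _
    have h3 : dist x y ≤ (1 + √d) * R := by
      rw [← hvv]
      have h4 := dist_triangle_right v v' z
      have h5 := dist_gridPt_le k v
      rw [dist_comm] at h5
      have h6 := mul_le_mul_of_nonneg_left h1 (Real.sqrt_nonneg (d : ℝ))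
      linarith
    have hRpos : 0 < R := hr.1.trans_le h1
    have h7 : Real.log (1 / R) ≤ Real.log ((1 + √d) / dist x y) := by
      refine Real.log_le_log (by positivity) ?_
      rw [div_le_div_iff₀ hRpos hdist]
      linarith
    linarith [le_abs_self (Real.log ((1 + √d) / dist x y))]
  have hpot : ∀ u, Tendsto (fun p : ℝ × ℝ => α * c (φ i p.1 x) u + α * c (φ j p.2 y) u)
      (𝓝[>] 0 ×ˢ 𝓝[>] 0) (𝓝 (α * h u x + α * h u y)) := fun u =>
    (((hc.tendsto_potential i x hx u).comp tendsto_fst).const_mul α).add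
      (((hc.tendsto_potential j y hy u).comp tendsto_snd).const_mul α)
  have hbx := hX.ae_eventually_barrier_iff (l := 𝓝[>] (0 : ℝ) ×ˢ 𝓝[>] (0 : ℝ)) (refSeq φ x) k0
    (C := C) (q := q) (m := α * m) hαl (fun k hk => (hc.refSeq_var (hk0 k hk) hx).2)
    (fun k hk => (hc.refSeq_var (hk0 k hk) hx).1) (fun k _ => hpot (refSeq φ x k))
    (by
      filter_upwards [hsmall2] with p hp k hk
      have h1 := hnear i x hx k hk p.1 hp.1
      have h2 := hfar j x hx y hy rfl k hk p.2 hp.2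
      have h3 := mul_le_mul_of_nonneg_left (add_le_add h1 h2) hα
      rw [hm]
      linarith)
  have hby := hX.ae_eventually_barrier_iff (l := 𝓝[>] (0 : ℝ) ×ˢ 𝓝[>] (0 : ℝ)) (refSeq φ y) k0
    (C := C) (q := q) (m := α * m) hαl (fun k hk => (hc.refSeq_var (hk0 k hk) hy).2)
    (fun k hk => (hc.refSeq_var (hk0 k hk) hy).1) (fun k _ => hpot (refSeq φ y k))
    (by
      filter_upwards [hsmall2] with p hp k hk
      have h1 := hnear j y hy k hk p.2 hp.2
      have h2 := hfar i y hy x hx (dist_comm _ _) k hk p.1 hp.1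
      have h3 := mul_le_mul_of_nonneg_left (add_le_add h1 h2) hα
      rw [hm]
      linarith)
  have hconv := tendsto_measure_of_ae_tendsto_indicator_of_isFiniteMeasure
    (μ := P) (𝓝[>] (0 : ℝ) ×ˢ 𝓝[>] (0 : ℝ)) (hmeas fun u => α * h u x + α * h u y)
    (fun p : ℝ × ℝ => hmeas fun u => α * c (φ i p.1 x) u + α * c (φ j p.2 y) u)
    (by
      filter_upwards [hbx, hby] with ω h1 h2
      filter_upwards [h1, h2] with p h3 h4
      exact and_congr h3 h4)
  exact (ENNReal.tendsto_toReal (measure_ne_top P E)).comp hconv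

end CovData

/-! ### The truncated chaos -/

/-- Two independent Gaussian fields `X`, `Y` with covariance `c`, together with jointly measurable
versions `U i ε x`, `V i ε x` of their approximations `X (φ i ε x)`, `Y (φ i ε x)`. -/
structure ChaosSetup {d : ℕ} {Ω T : Type*} [MeasurableSpace Ω] (P : Measure Ω) (X Y : T → Ω → ℝ)
    (c : T → T → ℝ) (S S₁ : Set (Euc d)) (δ C : ℝ) (φ : Bool → ℝ → Euc d → T)
    (κ : Euc d → Euc d → ℝ) (h : T → Euc d → ℝ) (U V : Bool → ℝ → Euc d → Ω → ℝ) : Prop where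
  cov : CovData c S S₁ δ C φ κ h
  fieldX : IsCentredGaussian P X c
  fieldY : IsCentredGaussian P Y c
  indep : IndepFun (fun ω u => X u ω) (fun ω u => Y u ω) P
  measurable_left : ∀ i, ∀ ε ∈ Ioc 0 δ, Measurable (Function.uncurry (U i ε))
  measurable_right : ∀ i, ∀ ε ∈ Ioc 0 δ, Measurable (Function.uncurry (V i ε))
  ae_eq_left : ∀ i, ∀ ε ∈ Ioc 0 δ, ∀ x ∈ S, U i ε x =ᵐ[P] X (φ i ε x)
  ae_eq_right : ∀ i, ∀ ε ∈ Ioc 0 δ, ∀ x ∈ S, V i ε x =ᵐ[P] Y (φ i ε x)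

/-- The density of the chaos: the Wick exponential of the fields `U`, `V`, times `g`. -/
def density {d : ℕ} {Ω : Type*} [MeasurableSpace Ω] (P : Measure Ω) (α β : ℝ) (g : Euc d → ℂ)
    (U V : Euc d → Ω → ℝ) (x : Euc d) (ω : Ω) : ℂ :=
  wick α β (∫ ω', U x ω' ^ 2 ∂P) (U x ω) (V x ω) * g x

/-- The indicator of the event that the field `X` stays below the barrier above the point `x`. -/
def barrierInd {d : ℕ} {Ω T : Type*} (X : T → Ω → ℝ) (φ : Bool → ℝ → Euc d → T) (lam q : ℝ)
    (k0 : ℕ) (x : Euc d) (ω : Ω) : ℂ :=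
  (barrierSet lam q k0 (refSeq φ x)).indicator (fun _ => (1 : ℂ)) (fun u => X u ω)

theorem norm_barrierInd_le {d : ℕ} {Ω T : Type*} (X : T → Ω → ℝ) (φ : Bool → ℝ → Euc d → T)
    (lam q : ℝ) (k0 : ℕ) (x : Euc d) (ω : Ω) : ‖barrierInd X φ lam q k0 x ω‖ₑ ≤ 1 := by
  rw [barrierInd]
  by_cases h : (fun u => X u ω) ∈ barrierSet lam q k0 (refSeq φ x) <;> simp [h]

/-- The correlation, without the weights, of truncated densities built on `s` and `t`. -/
def truncCorr {Ω T : Type*} [MeasurableSpace Ω] (P : Measure Ω) (X : T → Ω → ℝ) (c : T → T → ℝ)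
    (α β : ℝ) (B : Set (T → ℝ)) (s t : T) : ℝ :=
  Real.exp ((α ^ 2 + β ^ 2) * c s t)
    * P.real {ω | (fun u => X u ω + (α * c s u + α * c t u)) ∈ B}

theorem truncCorr_nonneg {Ω T : Type*} [MeasurableSpace Ω] (P : Measure Ω) (X : T → Ω → ℝ)
    (c : T → T → ℝ) (α β : ℝ) (B : Set (T → ℝ)) (s t : T) : 0 ≤ truncCorr P X c α β B s t :=
  mul_nonneg (Real.exp_pos _).le measureReal_nonneg

/-- A form of Young's inequality: the mean of `f` over an event of small probability is small if
`f` has a moderate second moment. -/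
theorem setLIntegral_le_of_sq {Ω : Type*} [MeasurableSpace Ω] {P : Measure Ω} {f : Ω → ENNReal}
    (hf : Measurable f) (B : Set Ω) {t : ENNReal} (ht : t ≠ 0)
    (ht' : t ≠ ⊤) : ∫⁻ ω in B, f ω ∂P ≤ t * ∫⁻ ω, f ω ^ 2 ∂P + t⁻¹ * P B := by
  have h1 : ∀ ω, f ω ≤ t * f ω ^ 2 + t⁻¹ := by
    intro ω
    rcases le_total (f ω) t⁻¹ with h | h
    · exact h.trans le_add_self
    · refine le_trans ?_ le_self_add
      calc f ω = t * t⁻¹ * f ω := by rw [ENNReal.mul_inv_cancel ht ht', one_mul]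
        _ ≤ t * f ω * f ω := by gcongr
        _ = t * f ω ^ 2 := by rw [sq, mul_assoc]
  calc ∫⁻ ω in B, f ω ∂P ≤ ∫⁻ ω in B, (t * f ω ^ 2 + t⁻¹) ∂P := lintegral_mono h1
    _ = t * ∫⁻ ω in B, f ω ^ 2 ∂P + t⁻¹ * P B := by
      rw [lintegral_add_right _ measurable_const, lintegral_const_mul _ (hf.pow_const 2)]
      simp
    _ ≤ _ := by
      gcongr
      exact Measure.restrict_le_self

namespace ChaosSetup

variable {d : ℕ} {Ω T : Type*} [MeasurableSpace Ω] {P : Measure Ω} {X Y : T → Ω → ℝ}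
  {c : T → T → ℝ} {S S₁ : Set (Euc d)} {δ C : ℝ} {φ : Bool → ℝ → Euc d → T}
  {κ : Euc d → Euc d → ℝ} {h : T → Euc d → ℝ} {U V : Bool → ℝ → Euc d → Ω → ℝ}

theorem measurable_density [IsProbabilityMeasure P] (hs : ChaosSetup P X Y c S S₁ δ C φ κ h U V)
    (α β : ℝ) {g : Euc d → ℂ} (hg : Measurable g) (i : Bool) {ε : ℝ} (hε : ε ∈ Ioc 0 δ) :
    Measurable (Function.uncurry (density P α β g (U i ε) (V i ε))) := by
  have hU := hs.measurable_left i ε hε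
  have hV := hs.measurable_right i ε hε
  have hκ : Measurable fun x => ∫ ω', U i ε x ω' ^ 2 ∂P := by
    have h1 : StronglyMeasurable (Function.uncurry fun x ω' => U i ε x ω' ^ 2) :=
      (hU.pow_const 2).stronglyMeasurable
    exact h1.integral_prod_right.measurable
  exact ((continuous_wick α β).measurable.comp ((hκ.comp measurable_fst).prodMk
    (hU.prodMk hV))).mul (hg.comp measurable_fst)

theorem measurable_barrierInd (hX : ∀ u, Measurable (X u)) (φ : Bool → ℝ → Euc d → T)
    (lam q : ℝ) (k0 : ℕ) : Measurable (Function.uncurry (barrierInd X φ lam q k0)) := by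
  have h1 : ∀ k, Measurable fun p : Euc d × Ω => X (refSeq φ p.1 k) p.2 := by
    intro k
    have h2 : Measurable fun p : (Fin d → ℤ) × Ω =>
        X (φ false (Real.exp (-k)) (gridPt k p.1)) p.2 :=
      measurable_from_prod_countable_right
        fun n => hX (φ false (Real.exp (-k)) (gridPt k n))
    exact h2.comp (((measurable_gridIdx k).comp measurable_fst).prodMk measurable_snd)
  have h3 : MeasurableSet {p : Euc d × Ω |
      (fun u => X u p.2) ∈ barrierSet lam q k0 (refSeq φ p.1)} := by
    have : {p : Euc d × Ω | (fun u => X u p.2) ∈ barrierSet lam q k0 (refSeq φ p.1)}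
        = ⋂ k, ⋂ (_ : k ≥ k0), {p : Euc d × Ω | X (refSeq φ p.1 k) p.2 ≤ lam * k + q} := by
      ext p
      simp [barrierSet]
    rw [this]
    exact MeasurableSet.iInter fun k => MeasurableSet.iInter fun _ =>
      measurableSet_le (h1 k) measurable_const
  exact (measurable_const (a := (1 : ℂ))).indicator h3

theorem integral_sq (hs : ChaosSetup P X Y c S S₁ δ C φ κ h U V) {i : Bool} {ε : ℝ}
    (hε : ε ∈ Ioc 0 δ) {x : Euc d} (hx : x ∈ S) :
    ∫ ω, U i ε x ω ^ 2 ∂P = c (φ i ε x) (φ i ε x) := by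
  rw [← hs.fieldX.covariance]
  refine integral_congr_ae ?_
  filter_upwards [hs.ae_eq_left i ε hε x hx] with ω hω
  rw [hω, sq]

theorem density_ae_eq (hs : ChaosSetup P X Y c S S₁ δ C φ κ h U V) (α β : ℝ) (g : Euc d → ℂ)
    {i : Bool} {ε : ℝ} (hε : ε ∈ Ioc 0 δ) {x : Euc d} (hx : x ∈ S) :
    density P α β g (U i ε) (V i ε) x =ᵐ[P] fun ω =>
      wick α β (c (φ i ε x) (φ i ε x)) (X (φ i ε x) ω) (Y (φ i ε x) ω) * g x := by
  filter_upwards [hs.ae_eq_left i ε hε x hx, hs.ae_eq_right i ε hε x hx] with ω h1 h2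
  rw [density, hs.integral_sq hε hx, h1, h2]

variable [IsProbabilityMeasure P]

theorem lintegral_density_sq (hs : ChaosSetup P X Y c S S₁ δ C φ κ h U V) (α β : ℝ)
    (g : Euc d → ℂ) {i : Bool} {ε : ℝ} (hε : ε ∈ Ioc 0 δ) {x : Euc d} (hx : x ∈ S) :
    ∫⁻ ω, ‖density P α β g (U i ε) (V i ε) x ω‖ₑ ^ 2 ∂P
      = ENNReal.ofReal (Real.exp ((α ^ 2 + β ^ 2) * c (φ i ε x) (φ i ε x)) * ‖g x‖ ^ 2) := by
  set s := φ i ε x with hsdef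
  have h1 : ∫⁻ ω, ‖density P α β g (U i ε) (V i ε) x ω‖ₑ ^ 2 ∂P
      = ∫⁻ ω, ENNReal.ofReal (Real.exp ((β ^ 2 - α ^ 2) * c s s) * Real.exp (2 * α * X s ω)
        * ‖g x‖ ^ 2) ∂P := by
    refine lintegral_congr_ae ?_
    filter_upwards [hs.density_ae_eq α β g hε hx] with ω hω
    rw [hω, ← ofReal_norm, ← ENNReal.ofReal_pow (norm_nonneg _), norm_mul, mul_pow, norm_wick_sq]
  have h2 := hs.fieldX.integrable_exp_comb s s s (2 * α) 0 0
  have h3 := hs.fieldX.integral_exp_comb s s s (2 * α) 0 0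
  simp only [zero_mul, add_zero] at h2 h3
  rw [h1, ← ofReal_integral_eq_lintegral_ofReal ((h2.const_mul _).mul_const _)
    (Eventually.of_forall fun ω => by positivity), integral_mul_const, integral_const_mul, h3,
    ← Real.exp_add]
  congr 3
  ring

theorem lintegral_trunc_sq_le (hs : ChaosSetup P X Y c S S₁ δ C φ κ h U V) (α β : ℝ)
    (g : Euc d → ℂ) (lam q : ℝ) (k0 : ℕ) {i : Bool} {ε : ℝ} (hε : ε ∈ Ioc 0 δ) {x : Euc d}
    (hx : x ∈ S) :
    ∫⁻ ω, ‖barrierInd X φ lam q k0 x ω * density P α β g (U i ε) (V i ε) x ω‖ₑ ^ 2 ∂P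
      ≤ ENNReal.ofReal (Real.exp ((α ^ 2 + β ^ 2) * c (φ i ε x) (φ i ε x)) * ‖g x‖ ^ 2) := by
  rw [← hs.lintegral_density_sq α β g hε hx]
  refine lintegral_mono fun ω => ?_
  simp only
  gcongr
  rw [enorm_mul]
  exact (mul_le_mul_left (norm_barrierInd_le X φ lam q k0 x ω) _).trans (one_mul _).le

theorem memLp_trunc (hs : ChaosSetup P X Y c S S₁ δ C φ κ h U V) (α β : ℝ)
    {g : Euc d → ℂ} (hg : Measurable g) (lam q : ℝ) (k0 : ℕ) {i : Bool} {ε : ℝ}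
    (hε : ε ∈ Ioc 0 δ) {x : Euc d} (hx : x ∈ S) :
    MemLp (fun ω => barrierInd X φ lam q k0 x ω * density P α β g (U i ε) (V i ε) x ω) 2 P := by
  have hm : Measurable (fun ω => barrierInd X φ lam q k0 x ω
      * density P α β g (U i ε) (V i ε) x ω) :=
    ((measurable_barrierInd hs.fieldX.measurable φ lam q k0).comp
      (f := fun ω => (x, ω)) (by fun_prop)).mul
      ((hs.measurable_density α β hg i hε).comp (f := fun ω => (x, ω)) (by fun_prop))
  refine ⟨hm.aestronglyMeasurable, ?_⟩
  rw [eLpNorm_lt_top_iff_lintegral_rpow_enorm_lt_top (by simp) (by simp)]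
  simp only [ENNReal.toReal_ofNat, ENNReal.rpow_ofNat]
  exact (hs.lintegral_trunc_sq_le α β g lam q k0 hε hx).trans_lt ENNReal.ofReal_lt_top

theorem integral_trunc_mul_conj (hs : ChaosSetup P X Y c S S₁ δ C φ κ h U V) (α β : ℝ)
    (g : Euc d → ℂ) (lam q : ℝ) (k0 : ℕ) {i j : Bool} {ε ε' : ℝ} (hε : ε ∈ Ioc 0 δ)
    (hε' : ε' ∈ Ioc 0 δ) {x y : Euc d} (hx : x ∈ S) (hy : y ∈ S) :
    ∫ ω, (barrierInd X φ lam q k0 x ω * density P α β g (U i ε) (V i ε) x ω)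
        * (starRingEnd ℂ) (barrierInd X φ lam q k0 y ω
          * density P α β g (U j ε') (V j ε') y ω) ∂P
      = g x * (starRingEnd ℂ) (g y) * (truncCorr P X c α β
        (barrierSet lam q k0 (refSeq φ x) ∩ barrierSet lam q k0 (refSeq φ y))
        (φ i ε x) (φ j ε' y) : ℂ) := by
  set B := barrierSet lam q k0 (refSeq φ x) ∩ barrierSet lam q k0 (refSeq φ y) with hB
  have hBm : MeasurableSet B :=
    (measurableSet_barrierSet _ _ _ _).inter (measurableSet_barrierSet _ _ _ _)
  rw [truncCorr, ← integral_wick_mul_conj hs.fieldX hs.fieldY hs.indep _ _ α β hBm,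
    ← integral_const_mul]
  refine integral_congr_ae ?_
  filter_upwards [hs.density_ae_eq α β g hε hx, hs.density_ae_eq α β g hε' hy] with ω h1 h2
  rw [h1, h2]
  have h3 : barrierInd X φ lam q k0 x ω * (starRingEnd ℂ) (barrierInd X φ lam q k0 y ω)
      = B.indicator (fun _ => (1 : ℂ)) (fun u => X u ω) := by
    simp only [barrierInd, hB]
    by_cases hx' : (fun u => X u ω) ∈ barrierSet lam q k0 (refSeq φ x) <;>
    by_cases hy' : (fun u => X u ω) ∈ barrierSet lam q k0 (refSeq φ y) <;>
    simp [hx', hy']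
  rw [← h3]
  simp only [map_mul]
  ring

theorem lintegral_prod_trunc_sq_lt_top (hs : ChaosSetup P X Y c S S₁ δ C φ κ h U V) (α β : ℝ)
    {g : Euc d → ℂ} (hg : Measurable g) {G : ℝ} (hG : ∀ x ∈ S, ‖g x‖ ≤ G) (lam q : ℝ) (k0 : ℕ)
    (i : Bool) {ε : ℝ} (hε : ε ∈ Ioc 0 δ) :
    ∫⁻ p, ‖Function.uncurry (fun x ω => barrierInd X φ lam q k0 x ω
      * density P α β g (U i ε) (V i ε) x ω) p‖ₑ ^ 2 ∂((volume.restrict S).prod P) < ⊤ := by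
  have hm : Measurable (Function.uncurry fun x ω => barrierInd X φ lam q k0 x ω
      * density P α β g (U i ε) (V i ε) x ω) :=
    (measurable_barrierInd hs.fieldX.measurable φ lam q k0).mul
      (hs.measurable_density α β hg i hε)
  rw [lintegral_prod _ (hm.enorm.pow_const 2).aemeasurable]
  have hle : ∫⁻ x in S, ∫⁻ ω, ‖Function.uncurry (fun x ω => barrierInd X φ lam q k0 x ω
      * density P α β g (U i ε) (V i ε) x ω) (x, ω)‖ₑ ^ 2 ∂P
      ≤ ∫⁻ _ in S, ENNReal.ofReal (Real.exp ((α ^ 2 + β ^ 2) * (Real.log (1 / ε) + C))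
        * G ^ 2) := by
    refine setLIntegral_mono' hs.cov.compact.measurableSet fun x hx => ?_
    refine (hs.lintegral_trunc_sq_le α β g lam q k0 hε hx).trans (ENNReal.ofReal_le_ofReal ?_)
    have h1 := hs.cov.upper i i ε hε ε hε x (hs.cov.mem hx) x (hs.cov.mem hx)
    rw [dist_self, max_self, max_eq_left hε.1.le] at h1
    gcongr
    exact hG x hx
  refine hle.trans_lt ?_
  rw [setLIntegral_const]
  exact ENNReal.mul_lt_top ENNReal.ofReal_lt_top hs.cov.compact.measure_lt_top

end ChaosSetup

/-! ### Convergence of the truncated chaos in `L²` -/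

/-- The chaos: the integral over `S` of the density. -/
def chaos {d : ℕ} {Ω : Type*} [MeasurableSpace Ω] (P : Measure Ω) (α β : ℝ) (g : Euc d → ℂ)
    (S : Set (Euc d)) (U V : Euc d → Ω → ℝ) (ω : Ω) : ℂ :=
  ∫ x in S, density P α β g U V x ω

/-- The truncated chaos: the integral of the density over the points of `S` above which the field
stays below the barrier. -/
def truncChaos {d : ℕ} {Ω T : Type*} [MeasurableSpace Ω] (P : Measure Ω) (X : T → Ω → ℝ)
    (φ : Bool → ℝ → Euc d → T) (lam q : ℝ) (k0 : ℕ) (α β : ℝ) (g : Euc d → ℂ)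
    (S : Set (Euc d)) (U V : Euc d → Ω → ℝ) (ω : Ω) : ℂ :=
  ∫ x in S, barrierInd X φ lam q k0 x ω * density P α β g U V x ω

theorem ae_prod_restrict {d : ℕ} (hd : 0 < d) {S : Set (Euc d)} (hS : MeasurableSet S) :
    ∀ᵐ p ∂((volume.restrict S).prod (volume.restrict S) : Measure (Euc d × Euc d)),
      p.1 ∈ S ∧ p.2 ∈ S ∧ p.1 ≠ p.2 := by
  rw [Measure.prod_restrict]
  filter_upwards [ae_restrict_of_ae (s := S ×ˢ S) (ae_ne_prod (d := d) hd),
    ae_restrict_mem (hS.prod hS)] with p h1 h2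
  exact ⟨h2.1, h2.2, h1⟩

theorem lintegral_rpow_dist {d : ℕ} (hd : 0 < d) {γ : ℝ} (hγ : γ < d) {S : Set (Euc d)}
    (hS : IsCompact S) {A : ℝ} (hA : 0 ≤ A) :
    ∫⁻ p, ENNReal.ofReal (A * dist p.1 p.2 ^ (-γ))
      ∂((volume.restrict S).prod (volume.restrict S) : Measure (Euc d × Euc d))
      = ENNReal.ofReal (A * ∫ p in S ×ˢ S, dist p.1 p.2 ^ (-γ) ∂(volume : Measure (Euc d × Euc d)))
    := by
  have h := integrable_prod_rpow_dist hd hγ hS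
  rw [Measure.prod_restrict, ← Measure.volume_eq_prod, ← integral_const_mul,
    ofReal_integral_eq_lintegral_ofReal (h.const_mul A)
      (Eventually.of_forall fun p => by positivity)]

namespace ChaosSetup

variable {d : ℕ} {Ω T : Type*} [MeasurableSpace Ω] {P : Measure Ω} {X Y : T → Ω → ℝ}
  {c : T → T → ℝ} {S S₁ : Set (Euc d)} {δ C : ℝ} {φ : Bool → ℝ → Euc d → T}
  {κ : Euc d → Euc d → ℝ} {h : T → Euc d → ℝ} {U V : Bool → ℝ → Euc d → Ω → ℝ}
  [IsProbabilityMeasure P]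

theorem measurable_trunc (hs : ChaosSetup P X Y c S S₁ δ C φ κ h U V) (α β : ℝ)
    {g : Euc d → ℂ} (hg : Measurable g) (lam q : ℝ) (k0 : ℕ) (i : Bool) {ε : ℝ}
    (hε : ε ∈ Ioc 0 δ) :
    Measurable (Function.uncurry fun x ω => barrierInd X φ lam q k0 x ω
      * density P α β g (U i ε) (V i ε) x ω) :=
  (measurable_barrierInd hs.fieldX.measurable φ lam q k0).mul (hs.measurable_density α β hg i hε)

theorem measurable_truncChaos (hs : ChaosSetup P X Y c S S₁ δ C φ κ h U V) (α β : ℝ)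
    {g : Euc d → ℂ} (hg : Measurable g) (lam q : ℝ) (k0 : ℕ) (i : Bool) {ε : ℝ}
    (hε : ε ∈ Ioc 0 δ) :
    Measurable (truncChaos P X φ lam q k0 α β g S (U i ε) (V i ε)) := by
  have h1 := (hs.measurable_trunc α β hg lam q k0 i hε).stronglyMeasurable
  exact h1.integral_prod_left.measurable

theorem measurable_chaos (hs : ChaosSetup P X Y c S S₁ δ C φ κ h U V) (α β : ℝ)
    {g : Euc d → ℂ} (hg : Measurable g) (i : Bool) {ε : ℝ} (hε : ε ∈ Ioc 0 δ) :
    Measurable (chaos P α β g S (U i ε) (V i ε)) := by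
  have h1 := (hs.measurable_density α β hg i hε).stronglyMeasurable
  exact h1.integral_prod_left.measurable

/-- The second moment of the truncated chaos is bounded uniformly in the scale, and grows at most
like `e^{σ q}` in the offset `q` of the barrier. -/
theorem exists_lintegral_truncChaos_sq_le (hd : 0 < d)
    (hs : ChaosSetup P X Y c S S₁ δ C φ κ h U V) {α β lam σ γ : ℝ}
    (hp : IsAdmissible d α β lam σ γ) {g : Euc d → ℂ} (hg : Measurable g) {G : ℝ}
    (hG : ∀ x ∈ S, ‖g x‖ ≤ G) {k0 : ℕ}
    (hk0 : ∀ k ≥ k0, (√d + 1) * Real.exp (-k) ≤ δ ∧ Real.log 2 + C < k) :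
    ∃ A : ℝ, 0 ≤ A ∧ ∀ (q : ℝ) (i : Bool), ∀ ε ∈ Ioc 0 δ,
      ∫⁻ ω, ‖truncChaos P X φ lam q k0 α β g S (U i ε) (V i ε) ω‖ₑ ^ 2 ∂P
        ≤ ENNReal.ofReal (A * Real.exp (σ * q)) := by
  obtain ⟨M, hM, hdom⟩ := hs.cov.exists_truncated_le hs.fieldX hp hk0
  have hS := hs.cov.compact
  have : IsFiniteMeasure ((volume : Measure (Euc d)).restrict S) :=
    isFiniteMeasure_restrict.2 hS.measure_lt_top.ne
  set J := ∫ p in S ×ˢ S, dist p.1 p.2 ^ (-γ) ∂(volume : Measure (Euc d × Euc d)) with hJ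
  have hJ0 : 0 ≤ J := integral_nonneg fun p => by positivity
  refine ⟨G ^ 2 * M * J, by positivity, fun q i ε hε => ?_⟩
  refine (lintegral_sq_integral_le (hs.measurable_trunc α β hg lam q k0 i hε)
    (hs.lintegral_prod_trunc_sq_lt_top α β hg hG lam q k0 i hε).ne).trans ?_
  have h1 : ENNReal.ofReal (G ^ 2 * M * J * Real.exp (σ * q))
      = ENNReal.ofReal (G ^ 2 * (M * Real.exp (σ * q)) * J) := by
    congr 1; ring
  rw [h1, hJ, ← lintegral_rpow_dist hd hp.gamma_lt hS (by positivity)]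
  refine lintegral_mono_ae ?_
  filter_upwards [ae_prod_restrict hd hS.measurableSet] with p hp'
  obtain ⟨hx, hy, hxy⟩ := hp'
  rw [hs.integral_trunc_mul_conj α β g lam q k0 hε hε hx hy, ← ofReal_norm, norm_mul, norm_mul,
    RCLike.norm_conj, Complex.norm_real, Real.norm_of_nonneg (truncCorr_nonneg _ _ _ _ _ _ _ _),
    mul_assoc (G ^ 2)]
  refine ENNReal.ofReal_le_ofReal (mul_le_mul ?_ (hdom q i i ε hε ε hε p.1 hx p.2 hy hxy)
    (truncCorr_nonneg _ _ _ _ _ _ _ _) (sq_nonneg _))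
  rw [sq]
  exact mul_le_mul (hG _ hx) (hG _ hy) (norm_nonneg _) ((norm_nonneg _).trans (hG _ hx))

/-- The truncated chaos is Cauchy in `L²`, also across different families of approximations. -/
theorem tendsto_lintegral_truncChaos_sub_sq (hd : 0 < d)
    (hs : ChaosSetup P X Y c S S₁ δ C φ κ h U V) {α β lam σ γ : ℝ}
    (hp : IsAdmissible d α β lam σ γ) {g : Euc d → ℂ} (hg : Measurable g) {G : ℝ}
    (hG : ∀ x ∈ S, ‖g x‖ ≤ G) {k0 : ℕ}
    (hk0 : ∀ k ≥ k0, (√d + 1) * Real.exp (-k) ≤ δ ∧ Real.log 2 + C < k) (q : ℝ) (i j : Bool) :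
    Tendsto (fun p : ℝ × ℝ =>
      ∫⁻ ω, ‖truncChaos P X φ lam q k0 α β g S (U i p.1) (V i p.1) ω
        - truncChaos P X φ lam q k0 α β g S (U j p.2) (V j p.2) ω‖ₑ ^ 2 ∂P)
      (𝓝[>] 0 ×ˢ 𝓝[>] 0) (𝓝 0) := by
  obtain ⟨M, hM, hdom⟩ := hs.cov.exists_truncated_le hs.fieldX hp hk0
  have hS := hs.cov.compact
  have : IsFiniteMeasure ((volume : Measure (Euc d)).restrict S) :=
    isFiniteMeasure_restrict.2 hS.measure_lt_top.ne
  set f : Bool → ℝ → Euc d → Ω → ℂ := fun i ε x ω =>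
    barrierInd X φ lam q k0 x ω * density P α β g (U i ε) (V i ε) x ω with hf
  set Γ : Bool → Bool → ℝ → ℝ → Euc d × Euc d → ℝ := fun i j ε ε' p => truncCorr P X c α β
        (barrierSet lam q k0 (refSeq φ p.1) ∩ barrierSet lam q k0 (refSeq φ p.2))
        (φ i ε p.1) (φ j ε' p.2) with hΓ
  have hfm : ∀ i, ∀ ε ∈ Ioc 0 δ, Measurable (Function.uncurry (f i ε)) := fun i ε hε =>
    hs.measurable_trunc α β hg lam q k0 i hε
  have hf2 : ∀ i, ∀ ε ∈ Ioc 0 δ, ∀ x ∈ S, MemLp (f i ε x) 2 P := fun i ε hε x hx =>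
    hs.memLp_trunc α β hg lam q k0 hε hx
  have hfprod : ∀ i, ∀ ε ∈ Ioc 0 δ,
      MemLp (Function.uncurry (f i ε)) 2 ((volume.restrict S).prod P) := by
    intro i ε hε
    refine ⟨(hfm i ε hε).aestronglyMeasurable, ?_⟩
    rw [eLpNorm_lt_top_iff_lintegral_rpow_enorm_lt_top (by simp) (by simp)]
    simp only [ENNReal.toReal_ofNat, ENNReal.rpow_ofNat]
    exact hs.lintegral_prod_trunc_sq_lt_top α β hg hG lam q k0 i hε
  set F : ℝ × ℝ → Euc d → Ω → ℂ := fun p x ω => f i p.1 x ω - f j p.2 x ω with hF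
  have hFm : ∀ p : ℝ × ℝ, p.1 ∈ Ioc 0 δ → p.2 ∈ Ioc 0 δ → Measurable (Function.uncurry (F p)) :=
    fun p h1 h2 => (hfm i _ h1).sub (hfm j _ h2)
  have hsmall : ∀ᶠ ε : ℝ in 𝓝[>] 0, ε ∈ Ioc 0 δ := Ioc_mem_nhdsGT hs.cov.pos
  have hsmall2 : ∀ᶠ p : ℝ × ℝ in 𝓝[>] 0 ×ˢ 𝓝[>] 0, p.1 ∈ Ioc 0 δ ∧ p.2 ∈ Ioc 0 δ :=
    hsmall.prod_mk hsmall
  set H : ℝ × ℝ → Euc d × Euc d → ENNReal := fun p z =>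
    ‖∫ ω, F p z.1 ω * (starRingEnd ℂ) (F p z.2 ω) ∂P‖ₑ with hH
  have hFL2 : ∀ p : ℝ × ℝ, p.1 ∈ Ioc 0 δ → p.2 ∈ Ioc 0 δ →
      ∫⁻ z, ‖Function.uncurry (F p) z‖ₑ ^ 2 ∂((volume.restrict S).prod P) ≠ ⊤ := by
    intro p h1 h2
    have h3 := ((hfprod i _ h1).sub (hfprod j _ h2)).2
    rw [eLpNorm_lt_top_iff_lintegral_rpow_enorm_lt_top (by simp) (by simp)] at h3
    simp only [ENNReal.toReal_ofNat, ENNReal.rpow_ofNat] at h3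
    exact h3.ne
  -- the second moment is controlled by the correlations of the difference of the densities
  have hle : ∀ᶠ p : ℝ × ℝ in 𝓝[>] 0 ×ˢ 𝓝[>] 0,
      ∫⁻ ω, ‖truncChaos P X φ lam q k0 α β g S (U i p.1) (V i p.1) ω
        - truncChaos P X φ lam q k0 α β g S (U j p.2) (V j p.2) ω‖ₑ ^ 2 ∂P
      ≤ ∫⁻ z, H p z ∂((volume.restrict S).prod (volume.restrict S)) := by
    filter_upwards [hsmall2] with p hp'
    refine le_trans (lintegral_mono_ae ?_)
      (lintegral_sq_integral_le (hFm p hp'.1 hp'.2) (hFL2 p hp'.1 hp'.2))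
    have h1 := ((hfprod i _ hp'.1).integrable one_le_two).prod_left_ae
    have h2 := ((hfprod j _ hp'.2).integrable one_le_two).prod_left_ae
    filter_upwards [h1, h2] with ω h3 h4
    have h5 : Integrable (fun x => f i p.1 x ω) (volume.restrict S) := h3
    have h6 : Integrable (fun x => f j p.2 x ω) (volume.restrict S) := h4
    simp only [truncChaos, hF]
    rw [integral_sub h5 h6]
  have hexp : ∀ p : ℝ × ℝ, p.1 ∈ Ioc 0 δ → p.2 ∈ Ioc 0 δ → ∀ z : Euc d × Euc d, z.1 ∈ S →
      z.2 ∈ S → ∫ ω, F p z.1 ω * (starRingEnd ℂ) (F p z.2 ω) ∂P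
        = g z.1 * (starRingEnd ℂ) (g z.2) * ((Γ i i p.1 p.1 z - Γ i j p.1 p.2 z
          - Γ j i p.2 p.1 z + Γ j j p.2 p.2 z : ℝ) : ℂ) := by
    intro p h1 h2 z hx hy
    have hint : ∀ i' j' : Bool, ∀ ε ∈ Ioc 0 δ, ∀ ε' ∈ Ioc 0 δ,
        Integrable (fun ω => f i' ε z.1 ω * (starRingEnd ℂ) (f j' ε' z.2 ω)) P :=
      fun i' j' ε hε ε' hε' => (hf2 i' ε hε z.1 hx).integrable_mul (hf2 j' ε' hε' z.2 hy).star
    have hcorr : ∀ i' j' : Bool, ∀ ε ∈ Ioc 0 δ, ∀ ε' ∈ Ioc 0 δ,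
        ∫ ω, f i' ε z.1 ω * (starRingEnd ℂ) (f j' ε' z.2 ω) ∂P
          = g z.1 * (starRingEnd ℂ) (g z.2) * (Γ i' j' ε ε' z : ℂ) :=
      fun i' j' ε hε ε' hε' => hs.integral_trunc_mul_conj α β g lam q k0 hε hε' hx hy
    have h3 : ∀ ω, F p z.1 ω * (starRingEnd ℂ) (F p z.2 ω)
        = (f i p.1 z.1 ω * (starRingEnd ℂ) (f i p.1 z.2 ω)
          - f i p.1 z.1 ω * (starRingEnd ℂ) (f j p.2 z.2 ω))
        - (f j p.2 z.1 ω * (starRingEnd ℂ) (f i p.1 z.2 ω)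
          - f j p.2 z.1 ω * (starRingEnd ℂ) (f j p.2 z.2 ω)) := by
      intro ω
      simp only [hF, map_sub]
      ring
    have s1 : Integrable (fun ω => f i p.1 z.1 ω * (starRingEnd ℂ) (f i p.1 z.2 ω)
        - f i p.1 z.1 ω * (starRingEnd ℂ) (f j p.2 z.2 ω)) P :=
      (hint i i _ h1 _ h1).sub (hint i j _ h1 _ h2)
    have s2 : Integrable (fun ω => f j p.2 z.1 ω * (starRingEnd ℂ) (f i p.1 z.2 ω)
        - f j p.2 z.1 ω * (starRingEnd ℂ) (f j p.2 z.2 ω)) P :=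
      (hint j i _ h2 _ h1).sub (hint j j _ h2 _ h2)
    simp only [h3]
    rw [integral_sub s1 s2,
      integral_sub (hint i i _ h1 _ h1) (hint i j _ h1 _ h2),
      integral_sub (hint j i _ h2 _ h1) (hint j j _ h2 _ h2), hcorr i i _ h1 _ h1,
      hcorr i j _ h1 _ h2, hcorr j i _ h2 _ h1, hcorr j j _ h2 _ h2]
    push_cast
    ring
  refine tendsto_of_tendsto_of_tendsto_of_le_of_le' tendsto_const_nhds ?_
    (Eventually.of_forall fun _ => zero_le) hle
  have h0 : ∫⁻ _, (0 : ENNReal) ∂((volume.restrict S).prod (volume.restrict S) :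
      Measure (Euc d × Euc d)) = 0 := lintegral_zero
  rw [← h0]
  refine tendsto_lintegral_filter_of_dominated_convergence
    (fun z => ENNReal.ofReal (G ^ 2 * (4 * (M * Real.exp (σ * q))) * dist z.1 z.2 ^ (-γ)))
    ?_ ?_ ?_ ?_
  · filter_upwards [hsmall2] with p hp'
    have h1 := hFm p hp'.1 hp'.2
    have h2 : Measurable fun w : (Euc d × Euc d) × Ω =>
        F p w.1.1 w.2 * (starRingEnd ℂ) (F p w.1.2 w.2) :=
      (h1.comp (f := fun w : (Euc d × Euc d) × Ω => (w.1.1, w.2)) (by fun_prop)).mul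
        (Complex.continuous_conj.measurable.comp
          (h1.comp (f := fun w : (Euc d × Euc d) × Ω => (w.1.2, w.2)) (by fun_prop)))
    exact (h2.stronglyMeasurable.integral_prod_right').measurable.enorm
  · filter_upwards [hsmall2] with p hp'
    obtain ⟨h1, h2⟩ := hp'
    filter_upwards [ae_prod_restrict hd hS.measurableSet] with z hz
    obtain ⟨hx, hy, hxy⟩ := hz
    have hΓ0 : ∀ i' j' ε ε', 0 ≤ Γ i' j' ε ε' z := fun _ _ _ _ => truncCorr_nonneg _ _ _ _ _ _ _ _
    have hΓle : ∀ i' j', ∀ ε ∈ Ioc 0 δ, ∀ ε' ∈ Ioc 0 δ,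
        Γ i' j' ε ε' z ≤ M * Real.exp (σ * q) * dist z.1 z.2 ^ (-γ) := fun i' j' ε hε ε' hε' =>
      hdom q i' j' ε hε ε' hε' z.1 hx z.2 hy hxy
    simp only [hH]
    rw [hexp p h1 h2 z hx hy, ← ofReal_norm, norm_mul, norm_mul, RCLike.norm_conj,
      Complex.norm_real, Real.norm_eq_abs, mul_assoc (G ^ 2)]
    refine ENNReal.ofReal_le_ofReal (mul_le_mul ?_ ?_ (abs_nonneg _) (sq_nonneg _))
    · rw [sq]
      exact mul_le_mul (hG _ hx) (hG _ hy) (norm_nonneg _) ((norm_nonneg _).trans (hG _ hx))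
    · have a1 := hΓle i i _ h1 _ h1
      have a2 := hΓle i j _ h1 _ h2
      have a3 := hΓle j i _ h2 _ h1
      have a4 := hΓle j j _ h2 _ h2
      have b1 := hΓ0 i i p.1 p.1
      have b2 := hΓ0 i j p.1 p.2
      have b3 := hΓ0 j i p.2 p.1
      have b4 := hΓ0 j j p.2 p.2
      rw [abs_le]
      constructor <;> linarith
  · rw [lintegral_rpow_dist hd hp.gamma_lt hS (by positivity)]
    exact ENNReal.ofReal_ne_top
  · filter_upwards [ae_prod_restrict hd hS.measurableSet] with z hz
    obtain ⟨hx, hy, hxy⟩ := hz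
    obtain ⟨Λ, hΛ⟩ := hs.cov.exists_tendsto_truncated hs.fieldX (α := α) (β := β) (lam := lam)
      (q := q) hp.alpha_nonneg hp.alpha_lt hk0 hx hy hxy
    have hfst : Tendsto Prod.fst (𝓝[>] (0 : ℝ) ×ˢ 𝓝[>] (0 : ℝ)) (𝓝[>] 0) := tendsto_fst
    have hsnd : Tendsto Prod.snd (𝓝[>] (0 : ℝ) ×ˢ 𝓝[>] (0 : ℝ)) (𝓝[>] 0) := tendsto_snd
    have t1 := (hΛ i i).comp (hfst.prodMk hfst)
    have t2 := hΛ i j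
    have t3 := (hΛ j i).comp (hsnd.prodMk hfst)
    have t4 := (hΛ j j).comp (hsnd.prodMk hsnd)
    have t5 := (((t1.sub t2).sub t3).add t4)
    have hzero : Λ - Λ - Λ + Λ = 0 := by ring
    rw [hzero] at t5
    have t6 := (((Complex.continuous_ofReal.tendsto _).comp t5).const_mul
      (g z.1 * (starRingEnd ℂ) (g z.2))).enorm
    simp only [Complex.ofReal_zero, mul_zero, enorm_zero] at t6
    refine t6.congr' ?_
    filter_upwards [hsmall2] with p hp'
    simp only [hH]
    rw [hexp p hp'.1 hp'.2 z hx hy]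
    rfl

end ChaosSetup

/-! ### Removing the barrier, and convergence of the chaos in `L¹` -/

/-- The event that the field exceeds the barrier `lam k + q` at some point of the grids next
to `S`, at some scale from `k0` on. -/
def exceedSet {d : ℕ} {Ω T : Type*} (X : T → Ω → ℝ) (φ : Bool → ℝ → Euc d → T) (S : Set (Euc d))
    (lam : ℝ) (k0 : ℕ) (q : ℝ) : Set Ω :=
  {ω | ∃ k ≥ k0, ∃ x ∈ S, lam * k + q < X (refSeq φ x k) ω}

theorem exceedSet_eq {d : ℕ} {Ω T : Type*} (X : T → Ω → ℝ) (φ : Bool → ℝ → Euc d → T)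
    (S : Set (Euc d)) (lam : ℝ) (k0 : ℕ) (q : ℝ) :
    exceedSet X φ S lam k0 q = ⋃ k : ℕ, ⋃ (_ : k ≥ k0), ⋃ n ∈ gridIdx k '' S,
      {ω | lam * k + q < X (φ false (Real.exp (-k)) (gridPt k n)) ω} := by
  ext ω
  simp only [exceedSet, mem_ofPred_eq, mem_iUnion, exists_prop, mem_image,
    exists_exists_and_eq_and]
  rfl

theorem exceedSet_anti {d : ℕ} {Ω T : Type*} (X : T → Ω → ℝ) (φ : Bool → ℝ → Euc d → T)
    (S : Set (Euc d)) (lam : ℝ) (k0 : ℕ) : Antitone (exceedSet X φ S lam k0) := by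
  rintro q q' hqq ω ⟨k, hk, x, hx, hlt⟩
  exact ⟨k, hk, x, hx, by linarith⟩

theorem lintegral_enorm_le_rpow_lintegral_sq {Ω : Type*} [MeasurableSpace Ω] {P : Measure Ω}
    [IsProbabilityMeasure P] {f : Ω → ℂ} (hf : Measurable f) :
    ∫⁻ ω, ‖f ω‖ₑ ∂P ≤ (∫⁻ ω, ‖f ω‖ₑ ^ 2 ∂P) ^ (1 / 2 : ℝ) := by
  have h := eLpNorm_le_eLpNorm_of_exponent_le (p := 1) (q := 2) (μ := P) (by norm_num)
    hf.aestronglyMeasurable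
  rw [eLpNorm_one_eq_lintegral_enorm, eLpNorm_eq_lintegral_rpow_enorm_toReal (by simp) (by simp)]
    at h
  simpa using h

namespace ChaosSetup

variable {d : ℕ} {Ω T : Type*} [MeasurableSpace Ω] {P : Measure Ω} {X Y : T → Ω → ℝ}
  {c : T → T → ℝ} {S S₁ : Set (Euc d)} {δ C : ℝ} {φ : Bool → ℝ → Euc d → T}
  {κ : Euc d → Euc d → ℝ} {h : T → Euc d → ℝ} {U V : Bool → ℝ → Euc d → Ω → ℝ}

/-- Off the exceedance event the truncation has no effect. -/
theorem truncChaos_eq_chaos (hs : ChaosSetup P X Y c S S₁ δ C φ κ h U V) (α β : ℝ)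
    (g : Euc d → ℂ) {lam q : ℝ} {k0 : ℕ} (U' V' : Euc d → Ω → ℝ) {ω : Ω}
    (hω : ω ∉ exceedSet X φ S lam k0 q) :
    truncChaos P X φ lam q k0 α β g S U' V' ω = chaos P α β g S U' V' ω := by
  refine setIntegral_congr_fun hs.cov.compact.measurableSet fun x hx => ?_
  have h1 : (fun u => X u ω) ∈ barrierSet lam q k0 (refSeq φ x) := by
    intro k hk
    by_contra hlt
    exact hω ⟨k, hk, x, hx, not_le.1 hlt⟩
  simp [barrierInd, h1]

variable [IsProbabilityMeasure P]

/-- As the slope of the barrier is larger than `√(2d)`, a union bound over the grids shows that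
the field exceeds the barrier with a probability exponentially small in the offset. -/
theorem exists_measure_exceedSet_le (hs : ChaosSetup P X Y c S S₁ δ C φ κ h U V)
    {lam : ℝ} (hlam : √(2 * d) < lam) (hd : 0 < d) {k0 : ℕ}
    (hk0 : ∀ k ≥ k0, (√d + 1) * Real.exp (-k) ≤ δ ∧ Real.log 2 + C < k) :
    ∃ M : ℝ, 0 ≤ M ∧ ∀ q : ℝ,
      P (exceedSet X φ S lam k0 q) ≤ ENNReal.ofReal (M * Real.exp (-(√(2 * d) * q))) := by
  obtain ⟨A, hA, hcard⟩ := exists_gridIdx_card hs.cov.compact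
  set u := √(2 * (d : ℝ)) with hu
  have hu0 : 0 < u := Real.sqrt_pos.2 (by positivity)
  have huu : u ^ 2 = 2 * d := Real.sq_sqrt (by positivity)
  -- the ratio of the bounds at consecutive scales: `e^{dk}` grid points, each exceeding the barrier
  -- with probability `e^{-(u lam - u² / 2) k}`, where `u² / 2 = d`
  set r := Real.exp (-(u * lam - 2 * d)) with hr
  have hr0 : 0 ≤ r := (Real.exp_pos _).le
  have hr1 : r < 1 := by
    rw [hr, Real.exp_lt_one_iff]
    nlinarith
  set B : ℝ := A ^ d * Real.exp (d * C) with hB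
  refine ⟨B * (1 - r)⁻¹, mul_nonneg (by positivity) (inv_nonneg.2 (by linarith)), fun q => ?_⟩
  have hk : ∀ k : ℕ, P (⋃ (_ : k ≥ k0), ⋃ n ∈ gridIdx k '' S,
      {ω | lam * k + q < X (φ false (Real.exp (-k)) (gridPt k n)) ω})
      ≤ ENNReal.ofReal (B * Real.exp (-(u * q)) * r ^ k) := by
    intro k
    by_cases hkk : k ≥ k0
    · simp only [hkk, iUnion_true]
      obtain ⟨I, hI, hIc⟩ := hcard k
      classical
      have hsub : (⋃ n ∈ gridIdx k '' S,
          {ω | lam * k + q < X (φ false (Real.exp (-k)) (gridPt k n)) ω})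
          ⊆ ⋃ n ∈ I.filter (fun n => n ∈ gridIdx k '' S),
            {ω | lam * k + q < X (φ false (Real.exp (-k)) (gridPt k n)) ω} := by
        refine iUnion₂_subset fun n hn => ?_
        exact subset_iUnion₂_of_subset n (Finset.mem_filter.2 ⟨hI hn, hn⟩) subset_rfl
      refine (measure_mono hsub).trans ((measure_biUnion_finset_le _ _).trans ?_)
      set E := Real.exp (-(u * (lam * k + q)) + u ^ 2 / 2 * (k + C)) with hE
      have h1 : ∀ n ∈ I.filter (fun n => n ∈ gridIdx k '' S),
          P {ω | lam * k + q < X (φ false (Real.exp (-k)) (gridPt k n)) ω}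
            ≤ ENNReal.ofReal E := by
        intro n hn
        obtain ⟨x, hx, rfl⟩ := (Finset.mem_filter.1 hn).2
        rw [← ofReal_measureReal]
        refine ENNReal.ofReal_le_ofReal ((hs.fieldX.measureReal_lt_le (refSeq φ x k) hu0.le
          (lam * k + q)).trans (Real.exp_le_exp.2 ?_))
        have := (hs.cov.refSeq_var (hk0 k hkk) hx).2
        gcongr
      refine (Finset.sum_le_sum h1).trans ?_
      rw [Finset.sum_const, nsmul_eq_mul]
      have h2 : ((I.filter fun n => n ∈ gridIdx k '' S).card : ℝ) ≤ (A * Real.exp k) ^ d :=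
        le_trans (by exact_mod_cast Finset.card_filter_le _ _) hIc
      rw [← ENNReal.ofReal_natCast, ← ENNReal.ofReal_mul (Nat.cast_nonneg _)]
      refine ENNReal.ofReal_le_ofReal ((mul_le_mul_of_nonneg_right h2
        (Real.exp_pos _).le).trans (le_of_eq ?_))
      rw [mul_pow, hB, hr, ← Real.exp_nat_mul, ← Real.exp_nat_mul, huu]
      have h3 : ∀ a b e f g : ℝ, a + b = e + f + g → A ^ d * Real.exp a * Real.exp b
          = A ^ d * Real.exp e * Real.exp f * Real.exp g := by
        intro a b e f g h
        rw [mul_assoc, mul_assoc, mul_assoc, ← Real.exp_add, ← Real.exp_add, ← Real.exp_add, h,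
          add_assoc]
      apply h3
      ring
    · simp [hkk]
  rw [exceedSet_eq]
  refine (measure_iUnion_le _).trans ((ENNReal.tsum_le_tsum hk).trans ?_)
  have hsum : Summable fun k : ℕ => B * Real.exp (-(u * q)) * r ^ k :=
    (summable_geometric_of_lt_one hr0 hr1).mul_left _
  rw [← ENNReal.ofReal_tsum_of_nonneg (fun k => by positivity) hsum, tsum_mul_left,
    tsum_geometric_of_lt_one hr0 hr1]
  exact ENNReal.ofReal_le_ofReal (le_of_eq (by ring))

theorem ae_exists_notMem_exceedSet (hs : ChaosSetup P X Y c S S₁ δ C φ κ h U V)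
    {lam : ℝ} (hlam : √(2 * d) < lam) (hd : 0 < d) {k0 : ℕ}
    (hk0 : ∀ k ≥ k0, (√d + 1) * Real.exp (-k) ≤ δ ∧ Real.log 2 + C < k) :
    ∀ᵐ ω ∂P, ∃ n : ℕ, ω ∉ exceedSet X φ S lam k0 n := by
  obtain ⟨M, -, hle⟩ := hs.exists_measure_exceedSet_le hlam hd hk0
  have hu0 : 0 < √(2 * (d : ℝ)) := Real.sqrt_pos.2 (by positivity)
  have h1 : Tendsto (fun n : ℕ => ENNReal.ofReal (M * Real.exp (-(√(2 * d) * n)))) atTop (𝓝 0) := by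
    have h2 : Tendsto (fun n : ℕ => M * Real.exp (-(√(2 * d) * n))) atTop (𝓝 (M * 0)) :=
      (Real.tendsto_exp_neg_atTop_nhds_zero.comp
        (tendsto_natCast_atTop_atTop.const_mul_atTop hu0)).const_mul M
    simpa using ENNReal.tendsto_ofReal h2
  rw [ae_iff]
  refine le_antisymm (ge_of_tendsto' h1 fun n => (measure_mono fun ω hω => ?_).trans (hle n))
    bot_le
  by_contra hn
  exact hω ⟨n, hn⟩

/-- The chaos and the truncated chaos differ, in mean, by an amount exponentially small in the
offset of the barrier, uniformly in the scale. The variation between consecutive offsets lives on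
an event of probability of order `e^{-uq}`, `u = √(2d)`, and has a second moment of order
`e^{σq}` with `σ < u`. -/
theorem exists_lintegral_chaos_sub_le (hd : 0 < d)
    (hs : ChaosSetup P X Y c S S₁ δ C φ κ h U V) {α β lam σ γ : ℝ}
    (hp : IsAdmissible d α β lam σ γ) {g : Euc d → ℂ} (hg : Measurable g) {G : ℝ}
    (hG : ∀ x ∈ S, ‖g x‖ ≤ G) {k0 : ℕ}
    (hk0 : ∀ k ≥ k0, (√d + 1) * Real.exp (-k) ≤ δ ∧ Real.log 2 + C < k) :
    ∃ M τ : ℝ, 0 ≤ M ∧ 0 < τ ∧ ∀ (q : ℕ) (i : Bool), ∀ ε ∈ Ioc 0 δ,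
      ∫⁻ ω, ‖chaos P α β g S (U i ε) (V i ε) ω
          - truncChaos P X φ lam q k0 α β g S (U i ε) (V i ε) ω‖ₑ ∂P
        ≤ ENNReal.ofReal (M * Real.exp (-(τ * q))) := by
  obtain ⟨A, hA, hsq⟩ := hs.exists_lintegral_truncChaos_sq_le hd hp hg hG hk0
  obtain ⟨M, hM, hexc⟩ := hs.exists_measure_exceedSet_le hp.lt_lam hd hk0
  have hsu := hp.sigma_lt
  set u := √(2 * (d : ℝ)) with hu
  set τ := (u - σ) / 2 with hτ
  have hτ0 : 0 < τ := by rw [hτ]; linarith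
  set r := Real.exp (-τ) with hr
  have hr0 : 0 ≤ r := (Real.exp_pos _).le
  have hr1 : r < 1 := by rw [hr, Real.exp_lt_one_iff]; linarith
  set B := 4 * A * Real.exp σ + M with hB
  have hB0 : 0 ≤ B := by positivity
  refine ⟨B * (1 - r)⁻¹, τ, mul_nonneg hB0 (inv_nonneg.2 (by linarith)), hτ0,
    fun q i ε hε => ?_⟩
  set Z : ℕ → Ω → ℂ := fun n => truncChaos P X φ lam n k0 α β g S (U i ε) (V i ε) with hZ
  have hZm : ∀ n, Measurable (Z n) := fun n => hs.measurable_truncChaos α β hg lam n k0 i hε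
  have hstep : ∀ n : ℕ, ∫⁻ ω, ‖Z (n + 1) ω - Z n ω‖ₑ ∂P
      ≤ ENNReal.ofReal (B * Real.exp (-(τ * n))) := by
    intro n
    have hm : Measurable fun ω => ‖Z (n + 1) ω - Z n ω‖ₑ := ((hZm _).sub (hZm _)).enorm
    have hsupp : Function.support (fun ω => ‖Z (n + 1) ω - Z n ω‖ₑ)
        ⊆ exceedSet X φ S lam k0 n := by
      intro ω hω
      by_contra hn
      have hn' : ω ∉ exceedSet X φ S lam k0 ((n + 1 : ℕ) : ℝ) := fun hm' =>
        hn (exceedSet_anti X φ S lam k0 (by push_cast; linarith) hm')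
      refine hω ?_
      simp only [hZ]
      rw [hs.truncChaos_eq_chaos α β g _ _ hn, hs.truncChaos_eq_chaos α β g _ _ hn', sub_self,
        enorm_zero]
    rw [← setLIntegral_eq_of_support_subset hsupp]
    -- this weight balances the second moment `e^{σ n}` and the probability `e^{-u n}`
    have ht : ENNReal.ofReal (Real.exp (-((σ + u) / 2 * n))) ≠ 0 :=
      (ENNReal.ofReal_pos.2 (Real.exp_pos _)).ne'
    refine (setLIntegral_le_of_sq hm _ ht ENNReal.ofReal_ne_top).trans ?_
    have h1 : ∫⁻ ω, ‖Z (n + 1) ω - Z n ω‖ₑ ^ 2 ∂P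
        ≤ ENNReal.ofReal (4 * A * Real.exp σ * Real.exp (σ * n)) := by
      have h2 : ∀ ω, ‖Z (n + 1) ω - Z n ω‖ₑ ^ 2
          ≤ 2 * (‖Z (n + 1) ω‖ₑ ^ 2 + ‖Z n ω‖ₑ ^ 2) := by
        intro ω
        have h3 : ‖Z (n + 1) ω - Z n ω‖ ^ 2 ≤ 2 * (‖Z (n + 1) ω‖ ^ 2 + ‖Z n ω‖ ^ 2) := by
          have h4 := norm_sub_le (Z (n + 1) ω) (Z n ω)
          nlinarith [sq_nonneg (‖Z (n + 1) ω‖ - ‖Z n ω‖), norm_nonneg (Z (n + 1) ω - Z n ω)]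
        simp only [← ofReal_norm]
        rw [← ENNReal.ofReal_pow (norm_nonneg _), ← ENNReal.ofReal_pow (norm_nonneg _),
          ← ENNReal.ofReal_pow (norm_nonneg _), ← ENNReal.ofReal_add (by positivity)
          (by positivity), ← ENNReal.ofReal_ofNat, ← ENNReal.ofReal_mul (by positivity)]
        exact ENNReal.ofReal_le_ofReal h3
      refine (lintegral_mono h2).trans ?_
      have hm2 : ∀ m, Measurable fun ω => ‖Z m ω‖ₑ ^ 2 := fun m => (hZm m).enorm.pow_const 2
      rw [lintegral_const_mul' _ _ (by simp), lintegral_add_left (hm2 _)]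
      refine (mul_le_mul_right (add_le_add (hsq _ i ε hε) (hsq _ i ε hε)) _).trans ?_
      rw [← ENNReal.ofReal_add (by positivity) (by positivity), ← ENNReal.ofReal_ofNat,
        ← ENNReal.ofReal_mul (by positivity)]
      refine ENNReal.ofReal_le_ofReal ?_
      have h5 : Real.exp (σ * ((n + 1 : ℕ) : ℝ)) = Real.exp σ * Real.exp (σ * n) := by
        rw [← Real.exp_add]; congr 1; push_cast; ring
      have h6 : Real.exp (σ * n) ≤ Real.exp σ * Real.exp (σ * n) :=
        le_mul_of_one_le_left (Real.exp_pos _).le (Real.one_le_exp hp.sigma_nonneg)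
      have h7 := mul_le_mul_of_nonneg_left h6 hA
      rw [h5]
      linarith
    refine (add_le_add (mul_le_mul_right h1 _) (mul_le_mul_right (hexc n) _)).trans ?_
    rw [← ENNReal.ofReal_inv_of_pos (Real.exp_pos _), ← Real.exp_neg,
      ← ENNReal.ofReal_mul (Real.exp_pos _).le, ← ENNReal.ofReal_mul (Real.exp_pos _).le,
      ← ENNReal.ofReal_add (by positivity) (by positivity)]
    refine ENNReal.ofReal_le_ofReal (le_of_eq ?_)
    have h8 : Real.exp (-((σ + u) / 2 * n)) * Real.exp (σ * n) = Real.exp (-(τ * n)) := by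
      rw [← Real.exp_add, hτ]; congr 1; ring
    have h9 : Real.exp (-(-((σ + u) / 2 * n))) * Real.exp (-(u * n)) = Real.exp (-(τ * n)) := by
      rw [← Real.exp_add, hτ]; congr 1; ring
    rw [hB, add_mul, ← h8]
    rw [show M * (Real.exp (-((σ + u) / 2 * n)) * Real.exp (σ * n))
      = M * (Real.exp (-(-((σ + u) / 2 * n))) * Real.exp (-(u * n))) by rw [h8, h9]]
    ring
  -- almost surely the truncation is eventually without effect, so that the sum telescopes
  have htel : ∀ᵐ ω ∂P, ‖chaos P α β g S (U i ε) (V i ε) ω - Z q ω‖ₑ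
      ≤ ∑' j : ℕ, ‖Z (q + j + 1) ω - Z (q + j) ω‖ₑ := by
    filter_upwards [hs.ae_exists_notMem_exceedSet hp.lt_lam hd hk0] with ω hω
    obtain ⟨n, hn⟩ := hω
    have hn' : ω ∉ exceedSet X φ S lam k0 ((q + n : ℕ) : ℝ) := fun hm' =>
      hn (exceedSet_anti X φ S lam k0
        (by push_cast; linarith [(Nat.cast_nonneg q : (0 : ℝ) ≤ q)]) hm')
    rw [← hs.truncChaos_eq_chaos α β g _ _ hn', ← edist_eq_enorm_sub, edist_comm]
    refine (edist_le_range_sum_edist (fun j => Z (q + j) ω) n).trans ?_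
    refine le_trans (Finset.sum_le_sum fun j _ => ?_) (ENNReal.sum_le_tsum (Finset.range n))
    rw [edist_comm, edist_eq_enorm_sub, add_assoc]
  refine (lintegral_mono_ae htel).trans ?_
  have hmj : ∀ j : ℕ, AEMeasurable (fun ω => ‖Z (q + j + 1) ω - Z (q + j) ω‖ₑ) P := fun j =>
    ((hZm _).sub (hZm _)).enorm.aemeasurable
  rw [lintegral_tsum hmj]
  refine (ENNReal.tsum_le_tsum fun j => hstep (q + j)).trans ?_
  have h1 : ∀ j : ℕ, B * Real.exp (-(τ * ((q + j : ℕ) : ℝ)))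
      = B * Real.exp (-(τ * q)) * r ^ j := by
    intro j
    rw [hr, ← Real.exp_nat_mul, mul_assoc, ← Real.exp_add]
    congr 2
    push_cast
    ring
  simp only [h1]
  rw [← ENNReal.ofReal_tsum_of_nonneg (fun k => by positivity)
    ((summable_geometric_of_lt_one hr0 hr1).mul_left _), tsum_mul_left,
    tsum_geometric_of_lt_one hr0 hr1]
  exact ENNReal.ofReal_le_ofReal (le_of_eq (by ring))

theorem integrable_chaos (hd : 0 < d)
    (hs : ChaosSetup P X Y c S S₁ δ C φ κ h U V) {α β lam σ γ : ℝ}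
    (hp : IsAdmissible d α β lam σ γ) {g : Euc d → ℂ} (hg : Measurable g) {G : ℝ}
    (hG : ∀ x ∈ S, ‖g x‖ ≤ G) (i : Bool) {ε : ℝ} (hε : ε ∈ Ioc 0 δ) :
    Integrable (chaos P α β g S (U i ε) (V i ε)) P := by
  obtain ⟨k0, hk0⟩ := hs.cov.exists_start
  obtain ⟨A, hA, hsq⟩ := hs.exists_lintegral_truncChaos_sq_le hd hp hg hG hk0
  obtain ⟨M, τ, hM, hτ, hle⟩ := hs.exists_lintegral_chaos_sub_le hd hp hg hG hk0
  have hm := hs.measurable_truncChaos α β hg lam ((0 : ℕ) : ℝ) k0 i hε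
  have h1 : Integrable (truncChaos P X φ lam ((0 : ℕ) : ℝ) k0 α β g S (U i ε) (V i ε)) P := by
    refine ⟨hm.aestronglyMeasurable, (lintegral_enorm_le_rpow_lintegral_sq hm).trans_lt ?_⟩
    exact ENNReal.rpow_lt_top_of_nonneg (by norm_num)
      ((hsq _ i ε hε).trans_lt ENNReal.ofReal_lt_top).ne
  have h2 : Integrable (fun ω => chaos P α β g S (U i ε) (V i ε) ω
      - truncChaos P X φ lam ((0 : ℕ) : ℝ) k0 α β g S (U i ε) (V i ε) ω) P :=
    ⟨((hs.measurable_chaos α β hg i hε).sub hm).aestronglyMeasurable,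
      (hle 0 i ε hε).trans_lt ENNReal.ofReal_lt_top⟩
  exact (h2.add h1).congr (Eventually.of_forall fun ω => by simp)

/-- The chaos is Cauchy in `L¹`, also across different families of approximations. -/
theorem tendsto_lintegral_chaos_sub (hd : 0 < d)
    (hs : ChaosSetup P X Y c S S₁ δ C φ κ h U V) {α β lam σ γ : ℝ}
    (hp : IsAdmissible d α β lam σ γ) {g : Euc d → ℂ} (hg : Measurable g) {G : ℝ}
    (hG : ∀ x ∈ S, ‖g x‖ ≤ G) (i j : Bool) :
    Tendsto (fun p : ℝ × ℝ => ∫⁻ ω, ‖chaos P α β g S (U i p.1) (V i p.1) ω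
        - chaos P α β g S (U j p.2) (V j p.2) ω‖ₑ ∂P) (𝓝[>] 0 ×ˢ 𝓝[>] 0) (𝓝 0) := by
  obtain ⟨k0, hk0⟩ := hs.cov.exists_start
  obtain ⟨M, τ, hM, hτ, hle⟩ := hs.exists_lintegral_chaos_sub_le hd hp hg hG hk0
  rw [ENNReal.tendsto_nhds_zero]
  intro η hη
  have h1 : Tendsto (fun n : ℕ => ENNReal.ofReal (M * Real.exp (-(τ * n)))) atTop (𝓝 0) := by
    have h2 : Tendsto (fun n : ℕ => M * Real.exp (-(τ * n))) atTop (𝓝 (M * 0)) :=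
      (Real.tendsto_exp_neg_atTop_nhds_zero.comp
        (tendsto_natCast_atTop_atTop.const_mul_atTop hτ)).const_mul M
    simpa using ENNReal.tendsto_ofReal h2
  have hη3 : 0 < η / 3 := ENNReal.div_pos hη.ne' (by simp)
  obtain ⟨q, hq⟩ := (ENNReal.tendsto_nhds_zero.1 h1 _ hη3).exists
  have hmid := (ENNReal.continuous_rpow_const (y := (1 / 2 : ℝ))).tendsto 0 |>.comp
    (hs.tendsto_lintegral_truncChaos_sub_sq hd hp hg hG hk0 q i j)
  rw [ENNReal.zero_rpow_of_pos (by norm_num)] at hmid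
  have hsmall : ∀ᶠ ε : ℝ in 𝓝[>] 0, ε ∈ Ioc 0 δ := Ioc_mem_nhdsGT hs.cov.pos
  filter_upwards [hsmall.prod_mk hsmall, ENNReal.tendsto_nhds_zero.1 hmid _ hη3] with p hp' hp3
  obtain ⟨e1, e2⟩ := hp'
  have m1 := hs.measurable_truncChaos α β hg lam q k0 i e1
  have m2 := hs.measurable_truncChaos α β hg lam q k0 j e2
  have c1 := hs.measurable_chaos α β hg i e1
  have c2 := hs.measurable_chaos α β hg j e2
  set a := chaos P α β g S (U i p.1) (V i p.1)
  set b := chaos P α β g S (U j p.2) (V j p.2)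
  set a' := truncChaos P X φ lam q k0 α β g S (U i p.1) (V i p.1)
  set b' := truncChaos P X φ lam q k0 α β g S (U j p.2) (V j p.2)
  have htri : ∀ ω, ‖a ω - b ω‖ₑ ≤ ‖a ω - a' ω‖ₑ + ‖a' ω - b' ω‖ₑ + ‖b ω - b' ω‖ₑ := by
    intro ω
    rw [← edist_eq_enorm_sub, ← edist_eq_enorm_sub, ← edist_eq_enorm_sub, ← edist_eq_enorm_sub,
      edist_comm (b ω)]
    exact edist_triangle4 _ _ _ _
  have hmeas1 : Measurable fun ω => ‖a ω - a' ω‖ₑ := (c1.sub m1).enorm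
  have hmeas2 : Measurable fun ω => ‖a' ω - b' ω‖ₑ := (m1.sub m2).enorm
  calc ∫⁻ ω, ‖a ω - b ω‖ₑ ∂P
      ≤ ∫⁻ ω, (‖a ω - a' ω‖ₑ + ‖a' ω - b' ω‖ₑ + ‖b ω - b' ω‖ₑ) ∂P := lintegral_mono htri
    _ = ∫⁻ ω, ‖a ω - a' ω‖ₑ ∂P + ∫⁻ ω, ‖a' ω - b' ω‖ₑ ∂P + ∫⁻ ω, ‖b ω - b' ω‖ₑ ∂P := by
      have hmeas3 : Measurable fun ω => ‖a ω - a' ω‖ₑ + ‖a' ω - b' ω‖ₑ := hmeas1.add hmeas2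
      rw [lintegral_add_left hmeas3, lintegral_add_left hmeas1]
    _ ≤ η / 3 + η / 3 + η / 3 :=
      add_le_add (add_le_add ((hle q i _ e1).trans hq)
        ((lintegral_enorm_le_rpow_lintegral_sq (m1.sub m2)).trans hp3)) ((hle q j _ e2).trans hq)
    _ = η := ENNReal.add_thirds η

end ChaosSetup

/-! ### The subcritical phase, with either sign of `α` -/

theorem IsCentredGaussian.neg {Ω T : Type*} [MeasurableSpace Ω] {P : Measure Ω} {X : T → Ω → ℝ}
    {c : T → T → ℝ} (hX : IsCentredGaussian P X c) :
    IsCentredGaussian P (fun t ω => -X t ω) c where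
  measurable t := (hX.measurable t).neg
  gaussian := by
    have h := hX.gaussian.smul fun _ => -1
    simpa using h
  centred t := by rw [integral_neg, hX.centred, neg_zero]
  covariance s t := by simp only [neg_mul_neg, hX.covariance]

namespace ChaosSetup

variable {d : ℕ} {Ω T : Type*} [MeasurableSpace Ω] {P : Measure Ω} {X Y : T → Ω → ℝ}
  {c : T → T → ℝ} {S S₁ : Set (Euc d)} {δ C : ℝ} {φ : Bool → ℝ → Euc d → T}
  {κ : Euc d → Euc d → ℝ} {h : T → Euc d → ℝ} {U V : Bool → ℝ → Euc d → Ω → ℝ}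

theorem neg_left (hs : ChaosSetup P X Y c S S₁ δ C φ κ h U V) :
    ChaosSetup P (fun t ω => -X t ω) Y c S S₁ δ C φ κ h (fun i ε x ω => -U i ε x ω) V where
  cov := hs.cov
  fieldX := hs.fieldX.neg
  fieldY := hs.fieldY
  indep := by
    have hm : Measurable fun (w : T → ℝ) t => -w t :=
      measurable_pi_iff.2 fun t => (measurable_pi_apply t).neg
    exact hs.indep.comp hm measurable_id
  measurable_left i ε hε := (hs.measurable_left i ε hε).neg
  measurable_right := hs.measurable_right
  ae_eq_left i ε hε x hx := (hs.ae_eq_left i ε hε x hx).fun_comp fun r => -r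
  ae_eq_right := hs.ae_eq_right

theorem chaos_neg (P : Measure Ω) (α β : ℝ) (g : Euc d → ℂ) (S : Set (Euc d))
    (U V : Euc d → Ω → ℝ) :
    chaos P (-α) β g S (fun x ω => -U x ω) V = chaos P α β g S U V := by
  funext ω
  simp only [chaos, density, wick, neg_sq, Complex.ofReal_neg, neg_mul_neg]

/-- In the subcritical phase the chaos is integrable and Cauchy in `L¹`. For negative `α` this is
the case of `-α` with the field `-X`. -/
theorem integrable_and_tendsto [IsProbabilityMeasure P] (hd : 0 < d)
    (hs : ChaosSetup P X Y c S S₁ δ C φ κ h U V) {α β : ℝ} (hαβ : (α, β) ∈ subcritical d)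
    {g : Euc d → ℂ} (hg : Measurable g) {G : ℝ} (hG : ∀ x ∈ S, ‖g x‖ ≤ G) :
    (∀ i, ∀ ε ∈ Ioc 0 δ, Integrable (chaos P α β g S (U i ε) (V i ε)) P) ∧
    ∀ i j, Tendsto (fun p : ℝ × ℝ => ∫⁻ ω, ‖chaos P α β g S (U i p.1) (V i p.1) ω
        - chaos P α β g S (U j p.2) (V j p.2) ω‖ₑ ∂P) (𝓝[>] 0 ×ˢ 𝓝[>] 0) (𝓝 0) := by
  rcases le_total 0 α with hα | hα
  · obtain ⟨lam, σ, γ, hp⟩ := exists_isAdmissible hαβ hα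
    exact ⟨fun i ε hε => hs.integrable_chaos hd hp hg hG i hε,
      fun i j => hs.tendsto_lintegral_chaos_sub hd hp hg hG i j⟩
  · have hαβ' : (-α, β) ∈ subcritical d := by simpa [subcritical] using hαβ
    obtain ⟨lam, σ, γ, hp⟩ := exists_isAdmissible hαβ' (neg_nonneg.2 hα)
    have h1 := fun i ε hε => hs.neg_left.integrable_chaos hd hp hg hG i (ε := ε) hε
    have h2 := fun i j => hs.neg_left.tendsto_lintegral_chaos_sub hd hp hg hG i j
    simp only [chaos_neg] at h1 h2
    exact ⟨h1, h2⟩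

end ChaosSetup

/-! ### Mollified fields as approximations -/

theorem isTestFun_zero {d : ℕ} (D : Set (Euc d)) : IsTestFun D (0 : Euc d → ℝ) :=
  ⟨continuous_const, HasCompactSupport.zero, by simp⟩

open Classical in
/-- The test function `y ↦ θ_ε(x - y)`, extended by the junk value `0` to the pairs `(ε, x)` for
which it is not a test function in `D`. -/
def Mollifier.testAt {d : ℕ} (θ : Mollifier d) (D : Set (Euc d)) (ε : ℝ) (x : Euc d) : TestFun D :=
  if h : (ε, x) ∈ mollDomain D then θ.testFun ε x h else ⟨0, isTestFun_zero D⟩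

theorem Mollifier.testAt_eq {d : ℕ} (θ : Mollifier d) {D : Set (Euc d)} {ε : ℝ} {x : Euc d}
    (h : (ε, x) ∈ mollDomain D) : θ.testAt D ε x = θ.testFun ε x h := dif_pos h

/-- Near a compact subset of `D` the mollifiers of small scale are test functions. -/
theorem exists_cthickening_mollDomain {d : ℕ} {D : Set (Euc d)} (hD : IsOpen D) {S : Set (Euc d)}
    (hS : IsCompact S) (hSD : S ⊆ D) :
    ∃ δ : ℝ, 0 < δ ∧ Metric.cthickening δ (Metric.cthickening δ S) ⊆ D ∧
      ∀ ε ∈ Ioc 0 δ, ∀ x ∈ Metric.cthickening δ S, (ε, x) ∈ mollDomain D := by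
  obtain ⟨δ₀, hδ₀, hsub⟩ := hS.exists_cthickening_subset_open hD hSD
  set δ := min (δ₀ / 4) 1 with hδ
  have hpos : 0 < δ := lt_min (by linarith) one_pos
  have h4 : δ + 3 * δ ≤ δ₀ := by linarith [min_le_left (δ₀ / 4) 1]
  refine ⟨δ, hpos, ?_, fun ε hε x hx => ⟨⟨hε.1, hε.2.trans (min_le_right _ _)⟩, ?_, ?_⟩⟩
  · exact (Metric.cthickening_cthickening_subset hpos.le hpos.le S).trans
      ((Metric.cthickening_mono (by linarith) S).trans hsub)
  · exact hsub (Metric.cthickening_mono (by linarith) S hx)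
  · refine lt_of_lt_of_le ((ENNReal.ofReal_lt_ofReal_iff (by linarith [hε.1] : 0 < 3 * δ)).2
      (by linarith [hε.1, hε.2])) (Metric.le_infEDist.2 fun y hy => ?_)
    by_contra hlt
    refine hy (hsub ?_)
    refine Metric.cthickening_mono h4 S ?_
    rw [Metric.mem_cthickening_iff] at hx ⊢
    rw [ENNReal.ofReal_add hpos.le (by linarith)]
    refine Metric.infEDist_le_infEDist_add_edist.trans (add_le_add hx ?_)
    rw [edist_comm]
    exact (not_le.1 hlt).le

/-- The covariance estimates for the mollified fields. -/
theorem exists_covData {d : ℕ} (hd : 0 < d) {D : Set (Euc d)} (hD : IsOpen D)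
    {K : Euc d → Euc d → ℝ} (hK : IsLogKernel D K)
    (hsymm : ∀ φ ψ : TestFun D, kernelForm K φ.1 ψ.1 = kernelForm K ψ.1 φ.1)
    (θ : Bool → Mollifier d) {S : Set (Euc d)} (hS : IsCompact S) {δ : ℝ} (hδ : 0 < δ)
    (hthick : Metric.cthickening δ (Metric.cthickening δ S) ⊆ D)
    (hmem : ∀ ε ∈ Ioc 0 δ, ∀ x ∈ Metric.cthickening δ S, (ε, x) ∈ mollDomain D) :
    ∃ C : ℝ, CovData (fun φ ψ : TestFun D => kernelForm K φ.1 ψ.1) S (Metric.cthickening δ S) δ C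
      (fun i ε x => (θ i).testAt D ε x) K (fun φ x => potential K φ.1 x) := by
  obtain ⟨A₀, hA₀, hb₀⟩ := (θ false).exists_isBump
  obtain ⟨A₁, hA₁, hb₁⟩ := (θ true).exists_isBump
  set A := max A₀ A₁ with hA
  have hbump : ∀ i, ∀ ε ∈ Ioc 0 δ, ∀ x ∈ Metric.cthickening δ S,
      IsBump A x ε ((θ i).testAt D ε x).1 := by
    intro i ε hε x hx
    rw [(θ i).testAt_eq (hmem ε hε x hx)]
    cases i
    · exact (hb₀ ε hε.1 x).mono (le_max_left _ _) hε.1.le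
    · exact (hb₁ ε hε.1 x).mono (le_max_right _ _) hε.1.le
  obtain ⟨C, hC, hbd⟩ := exists_kernelForm_bounds hd hK hS.cthickening hthick
    (hA₀.trans (le_max_left A₀ A₁))
  have hself : S ⊆ Metric.cthickening δ S := Metric.self_subset_cthickening S
  have hSD : S ⊆ D := hself.trans ((Metric.self_subset_cthickening _).trans hthick)
  have hsmall : ∀ ρ > 0, ∀ᶠ ε : ℝ in 𝓝[>] 0, ε ∈ Ioc 0 δ ∧ ε < ρ := fun ρ hρ =>
    (eventually_mem_set.2 (Ioc_mem_nhdsGT hδ)).and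
      (eventually_nhdsWithin_of_eventually_nhds (eventually_lt_nhds hρ))
  refine ⟨C, ⟨hS, fun x hx z hz => Metric.mem_cthickening_of_dist_le z x δ S hx hz, hδ, hC,
    fun i j ε hε ε' hε' x hx y hy => (hbd _ _ x y ε ε' hx hy hε hε' (hbump i ε hε x hx)
      (hbump j ε' hε' y hy)).1,
    fun i j ε hε ε' hε' x hx y hy => (hbd _ _ x y ε ε' hx hy hε hε' (hbump i ε hε x hx)
      (hbump j ε' hε' y hy)).2, fun i j x hx y hy hxy => ?_, fun i x hx u => ?_⟩⟩
  · refine Metric.tendsto_nhds.2 fun η hη => ?_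
    obtain ⟨ρ, hρ, hnear⟩ := kernelForm_near_of_ne hd hD hK (hSD hx) (hSD hy) hxy (half_pos hη)
    filter_upwards [(hsmall ρ hρ).prod_mk (hsmall ρ hρ)] with p hp
    rw [Real.dist_eq]
    exact (hnear _ _ A A p.1 p.2 hp.1.2 hp.2.2 (hbump i _ hp.1.1 x (hself hx))
      (hbump j _ hp.2.1 y (hself hy))).trans_lt (half_lt_self hη)
  · refine Metric.tendsto_nhds.2 fun η hη => ?_
    obtain ⟨ρ, hρ, hnear⟩ := kernelForm_near_potential hd hD hK u (hSD hx) (half_pos hη)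
    filter_upwards [hsmall ρ hρ] with ε hε
    rw [Real.dist_eq, hsymm]
    exact (hnear _ A ε hε.2 (hbump i _ hε.1 x (hself hx))).trans_lt (half_lt_self hη)

/-- The mollified chaos built from two families of mollified fields is integrable at small scales
and Cauchy in `L¹`, within and across the families. -/
theorem mollChaos_cauchy {d : ℕ} {Ω : Type*} [MeasurableSpace Ω] {P : Measure Ω}
    [IsProbabilityMeasure P] {D : Set (Euc d)} (hD : IsOpen D) {K : Euc d → Euc d → ℝ}
    (hK : IsLogKernel D K) {X Y : TestFun D → Ω → ℝ} (hX : IsGaussianField P D K X)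
    (hY : IsGaussianField P D K Y) (hXY : IndepFun (fun ω φ => X φ ω) (fun ω φ => Y φ ω) P)
    {ϱ : Euc d → ℝ} (hϱ : Measurable ϱ) (hϱb : ∃ C : ℝ, ∀ x ∈ D, |ϱ x| ≤ C) {f : Euc d → ℂ}
    (hf : IsTestFun D f) {α β : ℝ} (hαβ : (α, β) ∈ subcritical d) (θ : Bool → Mollifier d)
    (Xc Yc : Bool → ℝ → Euc d → Ω → ℝ) (hXc : ∀ i, IsMollifiedField P X (θ i) (Xc i))
    (hYc : ∀ i, IsMollifiedField P Y (θ i) (Yc i)) :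
    (∀ i, ∀ᶠ ε in 𝓝[>] (0 : ℝ),
      Integrable (mollChaos D K (θ i) (Xc i) (Yc i) ϱ f α β ε) P) ∧
    ∀ i j, Tendsto (fun p : ℝ × ℝ => eLpNorm (fun ω =>
      mollChaos D K (θ i) (Xc i) (Yc i) ϱ f α β p.1 ω
        - mollChaos D K (θ j) (Xc j) (Yc j) ϱ f α β p.2 ω) 1 P)
      (𝓝[>] 0 ×ˢ 𝓝[>] 0) (𝓝 0) := by
  -- the subcritical phase is empty in dimension zero
  have hd : 0 < d := by
    rcases Nat.eq_zero_or_pos d with rfl | h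
    · exfalso
      rcases hαβ with h | ⟨⟨h1, h2⟩, -⟩
      · simp only [mem_ofPred_eq, Nat.cast_zero] at h
        nlinarith [sq_nonneg α, sq_nonneg β]
      · simp only [Nat.cast_zero, mul_zero, Real.sqrt_zero] at h2
        exact absurd h2 (not_lt.2 (abs_nonneg _))
    · exact h
  set S := tsupport f with hSdef
  have hS : IsCompact S := hf.hasCompactSupport
  obtain ⟨δ, hδ, hthick, hmem⟩ := exists_cthickening_mollDomain hD hS hf.tsupport_subset
  have hself : S ⊆ Metric.cthickening δ S := Metric.self_subset_cthickening S
  have hXg := hX.isCentredGaussian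
  obtain ⟨C, hcov⟩ := exists_covData hd hD hK hXg.symm θ hS hδ hthick hmem
  have hone : ∀ ε ∈ Ioc (0 : ℝ) δ, S.Nonempty → ε ∈ Ioc (0 : ℝ) 1 := fun ε hε ⟨x, hx⟩ =>
    (hmem ε hε x (hself hx)).1
  have hver : ∀ {Z : TestFun D → Ω → ℝ} {Zc : Bool → ℝ → Euc d → Ω → ℝ},
      (∀ φ, Measurable (Z φ)) → (∀ i, IsMollifiedField P Z (θ i) (Zc i)) →
      ∃ W : Bool → ℝ → Euc d → Ω → ℝ, ∀ i, ∀ ε ∈ Ioc (0 : ℝ) δ,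
        Measurable (Function.uncurry (W i ε)) ∧
        (∀ᵐ ω ∂P, ∀ x ∈ S, W i ε x ω = Zc i ε x ω) ∧
        ∀ x ∈ S, W i ε x =ᵐ[P] Z ((θ i).testAt D ε x) := by
    intro Z Zc hZ hZc
    -- the points of `S` show that `ε ≤ 1`; if there are none, any field will do
    have h1 : ∀ (i : Bool) (ε : ℝ), ∃ W : Euc d → Ω → ℝ, ε ∈ Ioc (0 : ℝ) δ →
        Measurable (Function.uncurry W) ∧ (∀ᵐ ω ∂P, ∀ x ∈ S, W x ω = Zc i ε x ω) ∧
        ∀ x ∈ S, W x =ᵐ[P] Z ((θ i).testAt D ε x) := by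
      intro i ε
      by_cases hε : ε ∈ Ioc (0 : ℝ) δ ∧ S.Nonempty
      · obtain ⟨W, hW1, hW2, hW3⟩ :=
          (hZc i).exists_measurable_version hD hZ (hone ε hε.1 hε.2)
        refine ⟨W, fun _ => ⟨hW1, ?_, fun x hx => ?_⟩⟩
        · filter_upwards [hW2] with ω hω x hx
          exact hω x (hmem ε hε.1 x (hself hx)).2
        · rw [(θ i).testAt_eq (hmem ε hε.1 x (hself hx))]
          exact hW3 x _
      · refine ⟨fun _ _ => 0, fun hε' => ⟨measurable_const, ?_, ?_⟩⟩
        · exact Eventually.of_forall fun ω x hx => absurd ⟨hε', ⟨x, hx⟩⟩ hε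
        · exact fun x hx => absurd ⟨hε', ⟨x, hx⟩⟩ hε
    choose W hW using h1
    exact ⟨W, hW⟩
  obtain ⟨U, hU⟩ := hver hX.measurable hXc
  obtain ⟨V, hV⟩ := hver hY.measurable hYc
  have hs : ChaosSetup P X Y (fun φ ψ : TestFun D => kernelForm K φ.1 ψ.1) S
      (Metric.cthickening δ S) δ C (fun i ε x => (θ i).testAt D ε x) K
      (fun φ x => potential K φ.1 x) U V :=
    ⟨hcov, hXg, hY.isCentredGaussian, hXY, fun i ε hε => (hU i ε hε).1,
      fun i ε hε => (hV i ε hε).1, fun i ε hε => (hU i ε hε).2.2, fun i ε hε => (hV i ε hε).2.2⟩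
  set g : Euc d → ℂ := fun x => f x * (ϱ x : ℂ) with hgdef
  have hg : Measurable g := hf.continuous.measurable.mul (Complex.measurable_ofReal.comp hϱ)
  obtain ⟨G, hG⟩ : ∃ G : ℝ, ∀ x ∈ S, ‖g x‖ ≤ G := by
    obtain ⟨B, hB⟩ := hϱb
    obtain ⟨F, hF⟩ := hS.exists_bound_of_continuousOn hf.continuous.continuousOn
    refine ⟨F * B, fun x hx => ?_⟩
    rw [hgdef, norm_mul, Complex.norm_real, Real.norm_eq_abs]
    exact mul_le_mul (hF x hx) (hB x (hf.tsupport_subset hx)) (abs_nonneg _)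
      ((norm_nonneg _).trans (hF x hx))
  obtain ⟨hint, hlim⟩ := hs.integrable_and_tendsto hd hαβ hg hG
  have hae : ∀ i, ∀ ε ∈ Ioc (0 : ℝ) δ, mollChaos D K (θ i) (Xc i) (Yc i) ϱ f α β ε
      =ᵐ[P] chaos P α β g S (U i ε) (V i ε) := by
    intro i ε hε
    filter_upwards [(hU i ε hε).2.1, (hV i ε hε).2.1] with ω h1 h2
    have hsub : S ⊆ innerDomain D ε := fun x hx => (hmem ε hε x (hself hx)).2
    rw [mollChaos, chaos, setIntegral_eq_of_subset_of_forall_sdiff_eq_zero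
      (measurableSet_innerDomain hD ε) hsub
      (fun x hx => by rw [image_eq_zero_of_notMem_tsupport hx.2]; simp)]
    refine setIntegral_congr_fun hS.measurableSet fun x hx => ?_
    have h3 : ∫ ω', U i ε x ω' ^ 2 ∂P = mollVariance K (θ i) ε x := by
      rw [hs.integral_sq hε hx, (θ i).testAt_eq (hmem ε hε x (hself hx))]
      rfl
    simp only [density, wick]
    rw [h1 x hx, h2 x hx, h3, hgdef, mul_assoc]
  have hsmall : ∀ᶠ ε : ℝ in 𝓝[>] 0, ε ∈ Ioc 0 δ := Ioc_mem_nhdsGT hδ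
  refine ⟨fun i => ?_, fun i j => (hlim i j).congr' ?_⟩
  · filter_upwards [hsmall] with ε hε
    exact (hint i ε hε).congr (hae i ε hε).symm
  · filter_upwards [hsmall.prod_mk hsmall] with p hp
    rw [eLpNorm_one_eq_lintegral_enorm]
    refine lintegral_congr_ae ?_
    filter_upwards [hae i p.1 hp.1, hae j p.2 hp.2] with ω h1 h2
    rw [h1, h2]

/-! ### The limit -/

/-- Completeness of `L¹`, for a Cauchy family along a general filter. -/
theorem exists_tendsto_eLpNorm_of_cauchy {Ω ι : Type*} [MeasurableSpace Ω] {P : Measure Ω}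
    {l : Filter ι} [l.NeBot] {M : ι → Ω → ℂ} (hM : ∀ᶠ ε in l, Integrable (M ε) P)
    (hc : Tendsto (fun p : ι × ι => eLpNorm (fun ω => M p.1 ω - M p.2 ω) 1 P) (l ×ˢ l) (𝓝 0)) :
    ∃ M₀ : Ω → ℂ, Integrable M₀ P ∧
      Tendsto (fun ε => eLpNorm (fun ω => M ε ω - M₀ ω) 1 P) l (𝓝 0) := by
  classical
  set L : ι → Lp ℂ 1 P := fun ε =>
    if h : Integrable (M ε) P then (memLp_one_iff_integrable.2 h).toLp else 0 with hL
  have hLM : ∀ ε, Integrable (M ε) P → L ε =ᵐ[P] M ε := by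
    intro ε h
    simp only [hL, h, dif_pos]
    exact MemLp.coeFn_toLp _
  have hcau : Cauchy (map L l) := by
    refine cauchy_map_iff.2 ⟨inferInstance, ?_⟩
    rw [tendsto_uniformity_iff_dist_tendsto_zero]
    have h1 := (ENNReal.tendsto_toReal ENNReal.zero_ne_top).comp hc
    rw [ENNReal.toReal_zero] at h1
    refine h1.congr' ?_
    filter_upwards [hM.prod_mk hM] with p hp
    rw [Lp.dist_def]
    refine congrArg ENNReal.toReal (eLpNorm_congr_ae ?_)
    filter_upwards [hLM _ hp.1, hLM _ hp.2] with ω h2 h3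
    simp [h2, h3]
  obtain ⟨M₀, hM₀⟩ := cauchy_iff_exists_le_nhds.1 hcau
  have hM₀' : Tendsto L l (𝓝 M₀) := hM₀
  refine ⟨M₀, memLp_one_iff_integrable.1 (Lp.memLp M₀), ?_⟩
  rw [tendsto_iff_edist_tendsto_0] at hM₀'
  refine hM₀'.congr' ?_
  filter_upwards [hM] with ε hε
  rw [Lp.edist_def]
  refine eLpNorm_congr_ae ?_
  filter_upwards [hLM _ hε] with ω h2
  simp [h2]

/-- Convergence in `L¹` implies convergence in probability, for families of functions that are
only eventually measurable. -/
theorem tendstoInMeasure_of_eventually {Ω ι : Type*} [MeasurableSpace Ω] {P : Measure Ω}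
    {l : Filter ι} {M : ι → Ω → ℂ} {M₀ : Ω → ℂ} (hM : ∀ᶠ ε in l, Integrable (M ε) P)
    (hM₀ : Integrable M₀ P)
    (h : Tendsto (fun ε => eLpNorm (fun ω => M ε ω - M₀ ω) 1 P) l (𝓝 0)) :
    TendstoInMeasure P M l M₀ := by
  classical
  set N : ι → Ω → ℂ := fun ε => if Integrable (M ε) P then M ε else M₀ with hN
  have hNM : ∀ᶠ ε in l, N ε = M ε := by
    filter_upwards [hM] with ε hε
    simp [hN, hε]
  have hNm : ∀ ε, AEStronglyMeasurable (N ε) P := by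
    intro ε
    by_cases hε : Integrable (M ε) P
    · simpa [hN, hε] using hε.aestronglyMeasurable
    · simpa [hN, hε] using hM₀.aestronglyMeasurable
  refine (tendstoInMeasure_of_tendsto_eLpNorm one_ne_zero hNm hM₀.aestronglyMeasurable
    (h.congr' ?_)).congr' ?_ (EventuallyEq.refl _ _)
  · filter_upwards [hNM] with ε hε
    rw [hε]
    rfl
  · filter_upwards [hNM] with ε hε
    rw [hε]

end ComplexGMC

end


theorem mainTheorem1 {d : ℕ} {Ω : Type*} [MeasurableSpace Ω]
    (P : Measure Ω) [IsProbabilityMeasure P]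
    (D : Set (ComplexGMC.Euc d)) (hD : IsOpen D)
    (K : ComplexGMC.Euc d → ComplexGMC.Euc d → ℝ) (hK : ComplexGMC.IsLogKernel D K)
    (X Y : ComplexGMC.TestFun D → Ω → ℝ)
    (hX : ComplexGMC.IsGaussianField P D K X) (hY : ComplexGMC.IsGaussianField P D K Y)
    (hXY : IndepFun (fun ω φ => X φ ω) (fun ω φ => Y φ ω) P)
    (ϱ : ComplexGMC.Euc d → ℝ) (hϱ : Measurable ϱ) (hϱb : ∃ C : ℝ, ∀ x ∈ D, |ϱ x| ≤ C)
    (f : ComplexGMC.Euc d → ℂ) (hf : ComplexGMC.IsTestFun D f)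
    (α β : ℝ) (hαβ : (α, β) ∈ ComplexGMC.subcritical d) :
    ∃ M₀ : Ω → ℂ, Integrable M₀ P ∧
      ∀ (θ : ComplexGMC.Mollifier d) (Xc Yc : ℝ → ComplexGMC.Euc d → Ω → ℝ),
        ComplexGMC.IsMollifiedField P X θ Xc → ComplexGMC.IsMollifiedField P Y θ Yc →
        (∀ᶠ ε in 𝓝[>] (0 : ℝ),
          Integrable (fun ω => ComplexGMC.mollChaos D K θ Xc Yc ϱ f α β ε ω) P) ∧
        TendstoInMeasure P (fun ε ω => ComplexGMC.mollChaos D K θ Xc Yc ϱ f α β ε ω)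
          (𝓝[>] (0 : ℝ)) M₀ ∧
        Tendsto
          (fun ε => eLpNorm (fun ω => ComplexGMC.mollChaos D K θ Xc Yc ϱ f α β ε ω - M₀ ω) 1 P)
          (𝓝[>] (0 : ℝ)) (𝓝 0) := by
  -- the limit is built from one reference choice of mollifier and of continuous versions, and any
  -- other choice is compared with it; if there is no such choice, nothing has to converge
  by_cases href : ∃ (θ : ComplexGMC.Mollifier d) (Xc Yc : ℝ → ComplexGMC.Euc d → Ω → ℝ),
      ComplexGMC.IsMollifiedField P X θ Xc ∧ ComplexGMC.IsMollifiedField P Y θ Yc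
  swap
  · exact ⟨fun _ => 0, integrable_zero _ _ _, fun θ Xc Yc h1 h2 =>
      absurd ⟨θ, Xc, Yc, h1, h2⟩ href⟩
  obtain ⟨θ₀, X₀, Y₀, hX₀, hY₀⟩ := href
  obtain ⟨hint₀, hlim₀⟩ := ComplexGMC.mollChaos_cauchy hD hK hX hY hXY hϱ hϱb hf hαβ
    (fun _ => θ₀) (fun _ => X₀) (fun _ => Y₀) (fun _ => hX₀) (fun _ => hY₀)
  obtain ⟨M₀, hM₀, hconv⟩ :=
    ComplexGMC.exists_tendsto_eLpNorm_of_cauchy (hint₀ false) (hlim₀ false false)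
  refine ⟨M₀, hM₀, fun θ Xc Yc hXc hYc => ?_⟩
  obtain ⟨hint, hlim⟩ := ComplexGMC.mollChaos_cauchy hD hK hX hY hXY hϱ hϱb hf hαβ
    (fun i => bif i then θ else θ₀) (fun i => bif i then Xc else X₀)
    (fun i => bif i then Yc else Y₀) (fun i => by cases i <;> assumption)
    (fun i => by cases i <;> assumption)
  have h1 := hint true
  have hdiag : Tendsto (fun ε : ℝ => (ε, ε)) (𝓝[>] 0) (𝓝[>] 0 ×ˢ 𝓝[>] 0) :=
    tendsto_id.prodMk tendsto_id
  have h2 := (hlim true false).comp hdiag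
  simp only [cond_true, cond_false] at h1 h2
  have h3 : Tendsto
      (fun ε => eLpNorm (fun ω => ComplexGMC.mollChaos D K θ Xc Yc ϱ f α β ε ω - M₀ ω) 1 P)
      (𝓝[>] (0 : ℝ)) (𝓝 0) := by
    have h4 := h2.add hconv
    rw [add_zero] at h4
    refine tendsto_of_tendsto_of_tendsto_of_le_of_le' tendsto_const_nhds h4
      (Eventually.of_forall fun _ => bot_le) ?_
    filter_upwards [h1, hint₀ false] with ε hε hε'
    refine le_trans (le_of_eq ?_) (eLpNorm_add_le (hε.sub hε').aestronglyMeasurable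
      (hε'.sub hM₀).aestronglyMeasurable le_rfl)
    refine congrArg (fun F => eLpNorm F 1 P) (funext fun ω => ?_)
    simp
  exact ⟨h1, ComplexGMC.tendstoInMeasure_of_eventually h1 hM₀ h3, h3⟩
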